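/- Let $0<q<1$. Let $\mathcal{O}(S^7_q)$ be the algebra of the quantum symplectic $7$-sphere, i.e. the unital *-algebra generated by $x_1,\dots,x_4$ with relations $$x_1x_2=qx_2x_1,\quad x_1x_3=qx_3x_1,\quad x_1x_4=q^2x_4x_1,\quad x_2x_3=q^2x_3x_2+q^2(q-q^{-1})x_4x_1,\quad x_2x_4=qx_4x_2,\quad x_3x_4=qx_4x_3,$$ $$x_1^*x_1=x_1x_1^*,\quad x_2^*x_2=x_2x_2^*+(1-q^2)x_1x_1^*,\quad x_3^*x_3=x_3x_3^*+(1-q^4)x_2x_2^*+(1-q^2)x_1x_1^*,$$ $$x_1^*x_2=qx_2x_1^*,\quad x_1^*x_3=qx_3x_1^*,\quad x_1^*x_4=q^2x_4x_1^*,\quad x_2^*x_3=q^2x_3x_2^*,$$ $$x_2^*x_4=qx_4x_2^*+q^2(q-q^{-1})x_3x_1^*,\quad x_3^*x_4=qx_4x_3^*-q^4(q-q^{-1})x_2x_1^*,$$ $$x_1x_1^*+x_2x_2^*+x_3x_3^*+x_4x_4^*=1,\qquad q^8x_1^*x_1+q^6x_2^*x_2+q^2x_3^*x_3+x_4^*x_4=1,$$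 and their adjoints. Let $H=\mathcal{O}(SU_q(2))$ be generated by $\alpha,\gamma,\alpha^*,\gamma^*$ with the relations saying that $T=\begin{pmatrix}\alpha&-q\gamma^*\\ \gamma&\alpha^*\end{pmatrix}$ is unitary, with $\Delta(T_i^{\,k})=\sum_jT_i^{\,j}\otimes T_j^{\,k}$. It coacts on $\mathcal{O}(S^7_q)$ from the right by the algebra map $\delta_R$ with $\delta_R(u_i^k)=\sum_ju_i^j\otimes T_j^{\,k}$, where $$u=\begin{pmatrix}qx_1&qx_2\\-q^2x_2^*&q^3x_1^*\\-x_3&x_4\\x_4^*&qx_3^*\end{pmatrix},$$ and $\mathcal{O}(S^4_q)=\{b:\delta_R(b)=b\otimes1\}$. For an irreducible left $H$-comodule $(V_n,\delta_L)$ of dimension $n+1$, let $$\mathcal{E}_n=\mathcal{O}(S^7_q)\,\Box^H\,V_n=\{t\in\mathcal{O}(S^7_q)\otimes V_n:(\delta_R\otimes\mathrm{id})(t)=(\mathrm{id}\otimes\delta_L)(t)\},$$ an $\mathcal{O}(S^4_q)$-bimodule by left and right multiplication on the first factor. Let $\varepsilon:\mathcal{O}(S^7_q)\to\mathbb{C}$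 be the character with $\varepsilon(x_4)=1$ and $\varepsilon(x_i)=0$ for $i\neq4$, and let $\pi$ be the *-representation of $\mathcal{O}(S^7_q)$ on $\ell^2(\mathbb{N}^2)$ (with $0\in\mathbb{N}$) given by $\pi(x_1)=0$ and $$\pi(x_2)|k_1,k_2\rangle=q^{k_1+2k_2}|k_1,k_2\rangle,\quad \pi(x_3)|k_1,k_2\rangle=q^{k_1}\sqrt{1-q^{4(k_2+1)}}\,|k_1,k_2+1\rangle,\quad \pi(x_4)|k_1,k_2\rangle=\sqrt{1-q^{2(k_1+1)}}\,|k_1+1,k_2\rangle.$$ For a right $\mathcal{O}(S^4_q)$-module $\mathcal{E}\cong p\,\mathcal{O}(S^4_q)^N$ with $p\in M_N(\mathcal{O}(S^4_q))$ idempotent, set $\mathrm{ch}_1(\mathcal{E})=\mathrm{Tr}\big(\pi(\mathrm{Tr}\,p)-\varepsilon(\mathrm{Tr}\,p)\big)$, where $\mathrm{Tr}\,p\in\mathcal{O}(S^4_q)$ is the matrix trace and the outer trace is that of trace class operators on $\ell^2(\mathbb{N}^2)$. Then, for every $n\geq1$, the right module $\mathcal{E}_n$ is of the form $p\,\mathcal{O}(S^4_q)^N$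 for some such $p$, for every such $p$ the operator $\pi(\mathrm{Tr}\,p)-\varepsilon(\mathrm{Tr}\,p)$ is of trace class, and $$\mathrm{ch}_1(\mathcal{E}_n)=-\frac{n(n+1)(n+2)}{6}.$$ -/

import Mathlib

open scoped TensorProduct

noncomputable section

namespace QuantumSphere

/-! ### Algebras given by generators and relations -/

section Presentation

variable {R : Type*} [Ring R] [Algebra ℂ R]

/-- The defining relations of the Hopf algebra of `SU_q(2)`, for elements `a, a', c, c'` playing the
roles of `α, α^*, γ, γ^*`.  They say, entry by entry, that the matrix
`T = !![a, -q c'; c, a']` and its adjoint `T^* = !![a', c'; -q c, a]` satisfy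
`T T^* = 1` and `T^* T = 1`. -/
def suRels (q : ℝ) (a a' c c' : R) : List (R × R) :=
  [ (a * a' + (q : ℂ) ^ 2 • (c' * c), 1),
    (a * c' - (q : ℂ) • (c' * a), 0),
    (c * a' - (q : ℂ) • (a' * c), 0),
    (c * c' + a' * a, 1),
    (a' * a + c' * c, 1),
    (c' * a' - (q : ℂ) • (a' * c'), 0),
    (a * c - (q : ℂ) • (c * a), 0),
    ((q : ℂ) ^ 2 • (c * c') + a * a', 1) ]

/-- The defining relations of the quantum symplectic 7-sphere, for elements
`x 0, x 1, x 2, x 3` playing the roles of `x_1, x_2, x_3, x_4` and `y 0, y 1, y 2, y 3` playing the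
roles of their adjoints `x_1^*, x_2^*, x_3^*, x_4^*`.  The last two blocks are the adjoints of the
first two (the relations with equal indices and the sphere relations are self-adjoint). -/
def s7Rels (q : ℝ) (x y : Fin 4 → R) : List (R × R) :=
  [ -- relations among the generators
    (x 0 * x 1, (q : ℂ) • (x 1 * x 0)),
    (x 0 * x 2, (q : ℂ) • (x 2 * x 0)),
    (x 0 * x 3, (q : ℂ) ^ 2 • (x 3 * x 0)),
    (x 1 * x 2, (q : ℂ) ^ 2 • (x 2 * x 1) +
      ((q : ℂ) ^ 2 * ((q : ℂ) - (q : ℂ)⁻¹)) • (x 3 * x 0)),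
    (x 1 * x 3, (q : ℂ) • (x 3 * x 1)),
    (x 2 * x 3, (q : ℂ) • (x 3 * x 2)),
    -- relations between adjoints and generators
    (y 0 * x 3, (q : ℂ) ^ 2 • (x 3 * y 0)),
    (y 1 * x 3, (q : ℂ) • (x 3 * y 1) +
      ((q : ℂ) ^ 2 * ((q : ℂ) - (q : ℂ)⁻¹)) • (x 2 * y 0)),
    (y 0 * x 1, (q : ℂ) • (x 1 * y 0)),
    (y 0 * x 2, (q : ℂ) • (x 2 * y 0)),
    (y 1 * x 2, (q : ℂ) ^ 2 • (x 2 * y 1)),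
    (y 2 * x 3, (q : ℂ) • (x 3 * y 2) -
      ((q : ℂ) ^ 4 * ((q : ℂ) - (q : ℂ)⁻¹)) • (x 1 * y 0)),
    -- the same with equal indices
    (y 0 * x 0, x 0 * y 0),
    (y 1 * x 1, x 1 * y 1 + (1 - (q : ℂ) ^ 2) • (x 0 * y 0)),
    (y 2 * x 2, x 2 * y 2 + (1 - (q : ℂ) ^ 4) • (x 1 * y 1) + (1 - (q : ℂ) ^ 2) • (x 0 * y 0)),
    -- sphere relations
    (x 0 * y 0 + x 1 * y 1 + x 2 * y 2 + x 3 * y 3, 1),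
    ((q : ℂ) ^ 8 • (y 0 * x 0) + (q : ℂ) ^ 6 • (y 1 * x 1) + (q : ℂ) ^ 2 • (y 2 * x 2) +
      y 3 * x 3, 1),
    -- adjoints of the first block
    (y 1 * y 0, (q : ℂ) • (y 0 * y 1)),
    (y 2 * y 0, (q : ℂ) • (y 0 * y 2)),
    (y 3 * y 0, (q : ℂ) ^ 2 • (y 0 * y 3)),
    (y 2 * y 1, (q : ℂ) ^ 2 • (y 1 * y 2) +
      ((q : ℂ) ^ 2 * ((q : ℂ) - (q : ℂ)⁻¹)) • (y 0 * y 3)),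
    (y 3 * y 1, (q : ℂ) • (y 1 * y 3)),
    (y 3 * y 2, (q : ℂ) • (y 2 * y 3)),
    -- adjoints of the second block
    (y 3 * x 0, (q : ℂ) ^ 2 • (x 0 * y 3)),
    (y 3 * x 1, (q : ℂ) • (x 1 * y 3) +
      ((q : ℂ) ^ 2 * ((q : ℂ) - (q : ℂ)⁻¹)) • (x 0 * y 2)),
    (y 1 * x 0, (q : ℂ) • (x 0 * y 1)),
    (y 2 * x 0, (q : ℂ) • (x 0 * y 2)),
    (y 2 * x 1, (q : ℂ) ^ 2 • (x 1 * y 2)),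
    (y 3 * x 2, (q : ℂ) • (x 2 * y 3) -
      ((q : ℂ) ^ 4 * ((q : ℂ) - (q : ℂ)⁻¹)) • (x 0 * y 1)) ]

/-- The unital `ℂ`-algebra generated by a set `ι` subject to a list of relations. -/
def Presented {ι : Type} (rels : List (FreeAlgebra ℂ ι × FreeAlgebra ℂ ι)) : Type :=
  RingQuot fun a b => (a, b) ∈ rels

namespace Presented

variable {ι : Type} (rels : List (FreeAlgebra ℂ ι × FreeAlgebra ℂ ι))

instance : Ring (Presented rels) := inferInstanceAs (Ring (RingQuot _))

instance : Algebra ℂ (Presented rels) := inferInstanceAs (Algebra ℂ (RingQuot _))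

/-- The quotient map from the free algebra. -/
def mk : FreeAlgebra ℂ ι →ₐ[ℂ] Presented rels := RingQuot.mkAlgHom ℂ _

theorem mk_eq : ∀ r ∈ rels, mk rels r.1 = mk rels r.2 := fun _ hr => RingQuot.mkAlgHom_rel ℂ hr

variable {rels}

/-- The universal property of an algebra given by generators and relations. -/
def lift (g : ι → R) (h : ∀ r ∈ rels, FreeAlgebra.lift ℂ g r.1 = FreeAlgebra.lift ℂ g r.2) :
    Presented rels →ₐ[ℂ] R :=
  RingQuot.liftAlgHom ℂ ⟨FreeAlgebra.lift ℂ g, fun _ _ huv => h _ huv⟩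

@[simp] theorem lift_mk (g : ι → R)
    (h : ∀ r ∈ rels, FreeAlgebra.lift ℂ g r.1 = FreeAlgebra.lift ℂ g r.2) (i : ι) :
    lift g h (mk rels (FreeAlgebra.ι ℂ i)) = g i :=
  (RingQuot.liftAlgHom_mkAlgHom_apply ℂ _ _ _).trans (FreeAlgebra.lift_ι_apply _ _)

theorem hom_ext {S : Type*} [Semiring S] [Algebra ℂ S] {f g : Presented rels →ₐ[ℂ] S}
    (h : ∀ i, f (mk rels (FreeAlgebra.ι ℂ i)) = g (mk rels (FreeAlgebra.ι ℂ i))) : f = g :=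
  RingQuot.ringQuot_ext' ℂ _ _ (FreeAlgebra.hom_ext (funext h))

end Presented

end Presentation

/-- The four generators of the algebra of `SU_q(2)`. -/
inductive SUGen
  | α | α' | γ | γ'

/-- The algebra `O(SU_q(2))`. -/
abbrev OSU (q : ℝ) : Type :=
  Presented (suRels q (FreeAlgebra.ι ℂ SUGen.α) (FreeAlgebra.ι ℂ SUGen.α')
    (FreeAlgebra.ι ℂ SUGen.γ) (FreeAlgebra.ι ℂ SUGen.γ'))

/-- The algebra `O(S^7_q)`: the generators `Sum.inl i` are the `x_{i+1}`,
the generators `Sum.inr i` their adjoints. -/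
abbrev OS7 (q : ℝ) : Type :=
  Presented (s7Rels q (fun i => FreeAlgebra.ι ℂ (Sum.inl i : Fin 4 ⊕ Fin 4))
    (fun i => FreeAlgebra.ι ℂ (Sum.inr i : Fin 4 ⊕ Fin 4)))

namespace OSU

variable (q : ℝ)

/-- The generator `α`. -/
def α : OSU q := Presented.mk _ (FreeAlgebra.ι ℂ SUGen.α)

/-- The generator `α^*`. -/
def α' : OSU q := Presented.mk _ (FreeAlgebra.ι ℂ SUGen.α')

/-- The generator `γ`. -/
def γ : OSU q := Presented.mk _ (FreeAlgebra.ι ℂ SUGen.γ)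

/-- The generator `γ^*`. -/
def γ' : OSU q := Presented.mk _ (FreeAlgebra.ι ℂ SUGen.γ')

variable {R : Type*} [Ring R] [Algebra ℂ R]

theorem map_rels {q : ℝ} {S : Type*} [Ring S] [Algebra ℂ S] (f : R →ₐ[ℂ] S) (a a' c c' : R) :
    suRels q (f a) (f a') (f c) (f c') = (suRels q a a' c c').map (Prod.map f f) := by
  simp [suRels, -Complex.coe_smul]

theorem rels : ∀ r ∈ suRels q (α q) (α' q) (γ q) (γ' q), r.1 = r.2 := by
  unfold α α' γ γ'
  rw [map_rels]
  intro r hr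
  obtain ⟨s, hs, rfl⟩ := List.mem_map.1 hr
  exact Presented.mk_eq _ s hs

variable {q}

/-- The algebra map out of `O(SU_q(2))` with prescribed values on the generators. -/
def lift (a a' c c' : R) (h : ∀ r ∈ suRels q a a' c c', r.1 = r.2) : OSU q →ₐ[ℂ] R :=
  Presented.lift (fun | .α => a | .α' => a' | .γ => c | .γ' => c') (by
    intro r hr
    have key := map_rels (q := q) (FreeAlgebra.lift ℂ
      (fun | SUGen.α => a | .α' => a' | .γ => c | .γ' => c'))
      (FreeAlgebra.ι ℂ SUGen.α) (FreeAlgebra.ι ℂ SUGen.α')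
      (FreeAlgebra.ι ℂ SUGen.γ) (FreeAlgebra.ι ℂ SUGen.γ')
    simp only [FreeAlgebra.lift_ι_apply] at key
    exact h _ (key ▸ List.mem_map_of_mem hr))

section
variable (a a' c c' : R) (h : ∀ r ∈ suRels q a a' c c', r.1 = r.2)

@[simp] theorem lift_α : lift a a' c c' h (α q) = a := by simp [lift, α]
@[simp] theorem lift_α' : lift a a' c c' h (α' q) = a' := by simp [lift, α']
@[simp] theorem lift_γ : lift a a' c c' h (γ q) = c := by simp [lift, γ]
@[simp] theorem lift_γ' : lift a a' c c' h (γ' q) = c' := by simp [lift, γ']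
end

theorem hom_ext {R : Type*} [Semiring R] [Algebra ℂ R] {f g : OSU q →ₐ[ℂ] R}
    (h1 : f (α q) = g (α q)) (h2 : f (α' q) = g (α' q))
    (h3 : f (γ q) = g (γ q)) (h4 : f (γ' q) = g (γ' q)) : f = g := by
  apply Presented.hom_ext
  intro i
  cases i <;> assumption

end OSU

namespace OS7

variable (q : ℝ)

/-- The generators `x_1, …, x_4`. -/
def x (i : Fin 4) : OS7 q := Presented.mk _ (FreeAlgebra.ι ℂ (Sum.inl i))

/-- The adjoints `x_1^*, …, x_4^*` of the generators. -/
def x' (i : Fin 4) : OS7 q := Presented.mk _ (FreeAlgebra.ι ℂ (Sum.inr i))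

variable {R : Type*} [Ring R] [Algebra ℂ R]

theorem map_rels {q : ℝ} {S : Type*} [Ring S] [Algebra ℂ S] (f : R →ₐ[ℂ] S) (x y : Fin 4 → R) :
    s7Rels q (fun i => f (x i)) (fun i => f (y i)) = (s7Rels q x y).map (Prod.map f f) := by
  simp [s7Rels, -Complex.coe_smul]

theorem rels : ∀ r ∈ s7Rels q (x q) (x' q), r.1 = r.2 := by
  unfold x x'
  rw [map_rels]
  intro r hr
  obtain ⟨s, hs, rfl⟩ := List.mem_map.1 hr
  exact Presented.mk_eq _ s hs

variable {q}

/-- The algebra map out of `O(S^7_q)` with prescribed values on the generators. -/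
def lift (x y : Fin 4 → R) (h : ∀ r ∈ s7Rels q x y, r.1 = r.2) : OS7 q →ₐ[ℂ] R :=
  Presented.lift (Sum.elim x y) (by
    intro r hr
    have key := map_rels (q := q) (FreeAlgebra.lift ℂ (Sum.elim x y))
      (fun i => FreeAlgebra.ι ℂ (Sum.inl i : Fin 4 ⊕ Fin 4))
      (fun i => FreeAlgebra.ι ℂ (Sum.inr i : Fin 4 ⊕ Fin 4))
    simp only [FreeAlgebra.lift_ι_apply, Sum.elim_inl, Sum.elim_inr] at key
    exact h _ (key ▸ List.mem_map_of_mem hr))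

@[simp] theorem lift_x (x y : Fin 4 → R) (h : ∀ r ∈ s7Rels q x y, r.1 = r.2) (i : Fin 4) :
    lift x y h (OS7.x q i) = x i := by simp [lift, OS7.x]

@[simp] theorem lift_x' (x y : Fin 4 → R) (h : ∀ r ∈ s7Rels q x y, r.1 = r.2) (i : Fin 4) :
    lift x y h (OS7.x' q i) = y i := by simp [lift, OS7.x']

end OS7

/-! ### The bialgebra structure of `O(SU_q(2))` and its coaction on `O(S^7_q)` -/

namespace OSU

variable (q : ℝ)

/-- The defining relations, solved for the products that are not in normal order. -/
theorem mul_rels :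
    α q * α' q = 1 - (q : ℂ) ^ 2 • (γ' q * γ q) ∧ α' q * α q = 1 - γ' q * γ q ∧
    γ q * γ' q = γ' q * γ q ∧ α q * γ' q = (q : ℂ) • (γ' q * α q) ∧
    γ q * α' q = (q : ℂ) • (α' q * γ q) ∧ γ' q * α' q = (q : ℂ) • (α' q * γ' q) ∧
    α q * γ q = (q : ℂ) • (γ q * α q) := by
  have h := rels q
  simp only [suRels, List.forall_mem_cons, List.not_mem_nil, false_imp_iff, implies_true,
    and_true, sub_eq_zero] at h
  obtain ⟨h1, h2, h3, h4, h5, h6, h7, h8⟩ := h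
  refine ⟨eq_sub_of_add_eq h1, eq_sub_of_add_eq h5, ?_, h2, h3, h6, h7⟩
  rw [← h5, add_comm] at h4
  exact add_left_cancel h4

/-- The comultiplication: `Δ(T i j) = ∑ k, T i k ⊗ T k j` for the matrix
`T = !![α, -q γ^*; γ, α^*]`. -/
def comul : OSU q →ₐ[ℂ] OSU q ⊗[ℂ] OSU q :=
  lift (R := OSU q ⊗[ℂ] OSU q)
    (α q ⊗ₜ α q - (q : ℂ) • (γ' q ⊗ₜ γ q)) (α' q ⊗ₜ α' q - (q : ℂ) • (γ q ⊗ₜ γ' q))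
    (γ q ⊗ₜ α q + α' q ⊗ₜ γ q) (γ' q ⊗ₜ α' q + α q ⊗ₜ γ' q) (by
    obtain ⟨e1, e2, e3, h2, h3, h6, h7⟩ := mul_rels q
    simp only [suRels, List.forall_mem_cons, List.not_mem_nil, false_imp_iff, implies_true,
      and_true]
    simp only [mul_add, add_mul, mul_sub, sub_mul, Algebra.TensorProduct.tmul_mul_tmul,
      smul_mul_assoc, mul_smul_comm, h2, h3, h6, h7, e1, e2, e3, TensorProduct.tmul_sub,
      TensorProduct.sub_tmul, TensorProduct.tmul_smul, ← TensorProduct.smul_tmul',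
      Algebra.TensorProduct.one_def, smul_sub, smul_add]
    refine ⟨?_, ?_, ?_, ?_, ?_, ?_, ?_, ?_⟩ <;> module)

/-- The counit, `ε(T) = 1`. -/
def counit : OSU q →ₐ[ℂ] ℂ := lift 1 1 0 0 (by simp [suRels])

instance instBialgebra : Bialgebra ℂ (OSU q) :=
  Bialgebra.ofAlgHom (comul q) (counit q)
    (by apply hom_ext <;> simp [comul, TensorProduct.tmul_add, TensorProduct.add_tmul,
          TensorProduct.tmul_sub, TensorProduct.sub_tmul, ← TensorProduct.smul_tmul',
          TensorProduct.tmul_smul, smul_add, -Complex.coe_smul] <;> module)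
    (by apply hom_ext <;> simp [comul, counit, -Complex.coe_smul])
    (by apply hom_ext <;> simp [comul, counit, -Complex.coe_smul])

end OSU

namespace OS7

variable (q : ℝ)

/-- The right coaction of `O(SU_q(2))`, an algebra map; `coaction_instanton` below is its matrix
form. -/
def coaction : OS7 q →ₐ[ℂ] OS7 q ⊗[ℂ] OSU q :=
  lift (R := OS7 q ⊗[ℂ] OSU q)
    ![x q 0 ⊗ₜ OSU.α q + x q 1 ⊗ₜ OSU.γ q,
      x q 1 ⊗ₜ OSU.α' q - (q : ℂ) • (x q 0 ⊗ₜ OSU.γ' q),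
      x q 2 ⊗ₜ OSU.α q - x q 3 ⊗ₜ OSU.γ q,
      x q 3 ⊗ₜ OSU.α' q + (q : ℂ) • (x q 2 ⊗ₜ OSU.γ' q)]
    ![x' q 0 ⊗ₜ OSU.α' q + x' q 1 ⊗ₜ OSU.γ' q,
      x' q 1 ⊗ₜ OSU.α q - (q : ℂ) • (x' q 0 ⊗ₜ OSU.γ q),
      x' q 2 ⊗ₜ OSU.α' q - x' q 3 ⊗ₜ OSU.γ' q,
      x' q 3 ⊗ₜ OSU.α q + (q : ℂ) • (x' q 2 ⊗ₜ OSU.γ q)] (by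
    obtain ⟨e1, e2, e3, e4, e5, e6, e7⟩ := OSU.mul_rels q
    have h := rels q
    have k1 : (q : ℂ) ^ 2 * ((q : ℂ) - (q : ℂ)⁻¹) = (q : ℂ) ^ 3 - q := by
      by_cases h0 : (q : ℂ) = 0
      · simp [h0]
      · field_simp
    have k2 : (q : ℂ) ^ 4 * ((q : ℂ) - (q : ℂ)⁻¹) = (q : ℂ) ^ 5 - (q : ℂ) ^ 3 := by
      by_cases h0 : (q : ℂ) = 0
      · simp [h0]
      · field_simp
    simp only [s7Rels, List.forall_mem_cons, List.not_mem_nil, false_imp_iff, implies_true,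
      and_true, k1, k2] at h ⊢
    obtain ⟨h1, h2, h3, h4, h5, h6, h7, h8, h9, h10, h11, h12, h13, h14, h15, h16, h17, h18, h19,
      h20, h21, h22, h23, h24, h25, h26, h27, h28, h29⟩ := h
    replace h16 := eq_sub_of_add_eq' h16
    replace h17 := eq_sub_of_add_eq' h17
    simp only [Matrix.cons_val, mul_add, add_mul, mul_sub, sub_mul,
      Algebra.TensorProduct.tmul_mul_tmul, smul_mul_assoc, mul_smul_comm,
      e1, e2, e3, e4, e5, e6, e7, h1, h2, h3, h4, h5, h6, h7, h8, h9, h10, h11, h12, h13, h14, h15,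
      h16, h17, h18, h19, h20, h21, h22, h23, h24, h25, h26, h27, h28, h29,
      TensorProduct.tmul_sub, TensorProduct.sub_tmul,
      TensorProduct.add_tmul, TensorProduct.tmul_smul, ← TensorProduct.smul_tmul',
      Algebra.TensorProduct.one_def, smul_sub, smul_add]
    refine ⟨?_, ?_, ?_, ?_, ?_, ?_, ?_, ?_, ?_, ?_, ?_, ?_, ?_, ?_, ?_, ?_, ?_, ?_, ?_, ?_, ?_, ?_,
      ?_, ?_, ?_, ?_, ?_, ?_, ?_⟩ <;> module)

end OS7

namespace OS7

variable (q : ℝ)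

/-- The matrix `u` of generators, with rows `(q x_1, q x_2)`, `(-q^2 x_2^*, q^3 x_1^*)`,
`(-x_3, x_4)`, `(x_4^*, q x_3^*)`. -/
def instanton : Matrix (Fin 4) (Fin 2) (OS7 q) :=
  !![(q : ℂ) • x q 0, (q : ℂ) • x q 1;
    -((q : ℂ) ^ 2 • x' q 1), (q : ℂ) ^ 3 • x' q 0;
    -x q 2, x q 3;
    x' q 3, (q : ℂ) • x' q 2]

/-- The coaction is the one determined by `δ(u) = u ⊗ T`. -/
theorem coaction_instanton (i : Fin 4) (k : Fin 2) :
    coaction q (instanton q i k) =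
      ∑ j, instanton q i j ⊗ₜ
        (!![OSU.α q, -((q : ℂ) • OSU.γ' q); OSU.γ q, OSU.α' q] : Matrix _ _ (OSU q)) j k := by
  fin_cases i <;> fin_cases k <;>
    simp [instanton, coaction, TensorProduct.tmul_neg, TensorProduct.neg_tmul,
      ← TensorProduct.smul_tmul', TensorProduct.tmul_smul, smul_sub, smul_add,
      -Complex.coe_smul] <;>
    module

/-- The counit of the quantum symplectic group restricted to `O(S^7_q)`: the character with
`ε(x_i) = 0` for `i ≠ 4` and `ε(x_4) = 1`. -/
def character : OS7 q →ₐ[ℂ] ℂ := lift ![0, 0, 0, 1] ![0, 0, 0, 1] (by simp [s7Rels])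

end OS7

/-- The algebra `O(S^4_q)` of coinvariant elements, `δ(b) = b ⊗ 1`. -/
def OS4 (q : ℝ) : Subalgebra ℂ (OS7 q) :=
  AlgHom.equalizer (OS7.coaction q) Algebra.TensorProduct.includeLeft

/-! ### Comodules and cotensor products -/

/-- A left coaction of a coalgebra `H` on a complex vector space `V`. -/
structure LeftCoaction (H : Type*) [AddCommGroup H] [Module ℂ H] [Coalgebra ℂ H]
    (V : Type*) [AddCommGroup V] [Module ℂ V] where
  /-- The coaction `V → H ⊗ V`. -/
  toLin : V →ₗ[ℂ] H ⊗[ℂ] V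
  coassoc : (TensorProduct.assoc ℂ H H V).toLinearMap ∘ₗ
    Coalgebra.comul.rTensor V ∘ₗ toLin = toLin.lTensor H ∘ₗ toLin
  counit : (TensorProduct.lid ℂ V).toLinearMap ∘ₗ Coalgebra.counit.rTensor V ∘ₗ toLin =
    LinearMap.id

/-- A corepresentation is irreducible if it is nonzero and its only subcomodules are `0` and the
whole space. -/
def LeftCoaction.IsIrreducible {H : Type*} [AddCommGroup H] [Module ℂ H] [Coalgebra ℂ H]
    {V : Type*} [AddCommGroup V] [Module ℂ V] (ρ : LeftCoaction H V) : Prop :=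
  Nontrivial V ∧ ∀ W : Submodule ℂ V,
    (∀ w ∈ W, ρ.toLin w ∈ LinearMap.range (W.subtype.lTensor H)) → W = ⊥ ∨ W = ⊤

section Cotensor

variable {q : ℝ} {V : Type*} [AddCommGroup V] [Module ℂ V]

/-- The first of the two maps `O(S^7_q) ⊗ V → O(S^7_q) ⊗ O(SU_q(2)) ⊗ V` whose equalizer is the
cotensor product: `δ_R ⊗ id`. -/
def coactRight (q : ℝ) (V : Type*) [AddCommGroup V] [Module ℂ V] :
    OS7 q ⊗[ℂ] V →ₗ[ℂ] OS7 q ⊗[ℂ] (OSU q ⊗[ℂ] V) :=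
  (TensorProduct.assoc ℂ (OS7 q) (OSU q) V).toLinearMap ∘ₗ
    (OS7.coaction q).toLinearMap.rTensor V

/-- The second of these maps: `id ⊗ δ_L`. -/
def coactLeft (ρ : LeftCoaction (OSU q) V) :
    OS7 q ⊗[ℂ] V →ₗ[ℂ] OS7 q ⊗[ℂ] (OSU q ⊗[ℂ] V) :=
  ρ.toLin.lTensor (OS7 q)

/-- Left multiplication by `a ∈ O(S^7_q)` on the first factor of `O(S^7_q) ⊗ W`. -/
def mulL (W : Type*) [AddCommGroup W] [Module ℂ W] (a : OS7 q) :
    OS7 q ⊗[ℂ] W →ₗ[ℂ] OS7 q ⊗[ℂ] W :=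
  (LinearMap.mulLeft ℂ a).rTensor W

/-- Right multiplication by `a ∈ O(S^7_q)` on the first factor of `O(S^7_q) ⊗ W`. -/
def mulR (W : Type*) [AddCommGroup W] [Module ℂ W] (a : OS7 q) :
    OS7 q ⊗[ℂ] W →ₗ[ℂ] OS7 q ⊗[ℂ] W :=
  (LinearMap.mulRight ℂ a).rTensor W

theorem coactRight_mulL (b : OS4 q) (t : OS7 q ⊗[ℂ] V) :
    coactRight q V (mulL V (b : OS7 q) t) = mulL _ (b : OS7 q) (coactRight q V t) := by
  have hb : OS7.coaction q b = (b : OS7 q) ⊗ₜ 1 := b.2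
  suffices h : coactRight q V ∘ₗ mulL V (b : OS7 q) = mulL _ (b : OS7 q) ∘ₗ coactRight q V from
    LinearMap.congr_fun h t
  ext a v
  simp only [coactRight, mulL, TensorProduct.AlgebraTensorModule.curry_apply, LinearMap.comp_apply,
    TensorProduct.curry_apply, LinearMap.coe_restrictScalars, LinearMap.rTensor_tmul,
    LinearMap.mulLeft_apply, AlgHom.toLinearMap_apply, map_mul, hb, LinearEquiv.coe_coe]
  induction OS7.coaction q a using TensorProduct.induction_on with
  | zero => simp
  | tmul x y => simp
  | add x y hx hy => simp only [mul_add, TensorProduct.add_tmul, map_add, hx, hy]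

theorem coactRight_mulR (b : OS4 q) (t : OS7 q ⊗[ℂ] V) :
    coactRight q V (mulR V (b : OS7 q) t) = mulR _ (b : OS7 q) (coactRight q V t) := by
  have hb : OS7.coaction q b = (b : OS7 q) ⊗ₜ 1 := b.2
  suffices h : coactRight q V ∘ₗ mulR V (b : OS7 q) = mulR _ (b : OS7 q) ∘ₗ coactRight q V from
    LinearMap.congr_fun h t
  ext a v
  simp only [coactRight, mulR, TensorProduct.AlgebraTensorModule.curry_apply, LinearMap.comp_apply,
    TensorProduct.curry_apply, LinearMap.coe_restrictScalars, LinearMap.rTensor_tmul,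
    LinearMap.mulRight_apply, AlgHom.toLinearMap_apply, map_mul, hb, LinearEquiv.coe_coe]
  induction OS7.coaction q a using TensorProduct.induction_on with
  | zero => simp
  | tmul x y => simp
  | add x y hx hy => simp only [add_mul, TensorProduct.add_tmul, map_add, hx, hy]

theorem coactLeft_mulL (ρ : LeftCoaction (OSU q) V) (a : OS7 q) (t : OS7 q ⊗[ℂ] V) :
    coactLeft ρ (mulL V a t) = mulL _ a (coactLeft ρ t) := by
  simp only [coactLeft, mulL, ← LinearMap.comp_apply, LinearMap.lTensor_comp_rTensor,
    LinearMap.rTensor_comp_lTensor]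

theorem coactLeft_mulR (ρ : LeftCoaction (OSU q) V) (a : OS7 q) (t : OS7 q ⊗[ℂ] V) :
    coactLeft ρ (mulR V a t) = mulR _ a (coactLeft ρ t) := by
  simp only [coactLeft, mulR, ← LinearMap.comp_apply, LinearMap.lTensor_comp_rTensor,
    LinearMap.rTensor_comp_lTensor]

/-- The cotensor product `O(S^7_q) □ V`: the space of all `t ∈ O(S^7_q) ⊗ V` with
`(δ_R ⊗ id) t = (id ⊗ δ_L) t`. -/
def Cotensor (ρ : LeftCoaction (OSU q) V) : Submodule ℂ (OS7 q ⊗[ℂ] V) :=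
  LinearMap.eqLocus (coactRight q V) (coactLeft ρ)

namespace Cotensor

variable (ρ : LeftCoaction (OSU q) V)

/-- The left action `b · (a ⊗ v) = b a ⊗ v` of `O(S^4_q)`. -/
instance : SMul (OS4 q) (Cotensor ρ) where
  smul b t := ⟨mulL V (b : OS7 q) t, by
    change coactRight q V _ = coactLeft ρ _
    rw [coactRight_mulL, coactLeft_mulL, show coactRight q V t = coactLeft ρ t from t.2]⟩

/-- The right action `(a ⊗ v) · b = a b ⊗ v` of `O(S^4_q)`, as an action of the opposite
algebra. -/
instance : SMul (OS4 q)ᵐᵒᵖ (Cotensor ρ) where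
  smul b t := ⟨mulR V (b.unop : OS7 q) t, by
    change coactRight q V _ = coactLeft ρ _
    rw [coactRight_mulR, coactLeft_mulR, show coactRight q V t = coactLeft ρ t from t.2]⟩

theorem coe_smul (b : OS4 q) (t : Cotensor ρ) :
    ((b • t : Cotensor ρ) : OS7 q ⊗[ℂ] V) = mulL V (b : OS7 q) t := rfl

theorem coe_op_smul (b : (OS4 q)ᵐᵒᵖ) (t : Cotensor ρ) :
    ((b • t : Cotensor ρ) : OS7 q ⊗[ℂ] V) = mulR V (b.unop : OS7 q) t := rfl

instance : Module (OS4 q) (Cotensor ρ) where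
  one_smul t := Subtype.ext (by simp [coe_smul, mulL])
  mul_smul a b t := Subtype.ext (by
    simp [coe_smul, mulL, LinearMap.mulLeft_mul, LinearMap.rTensor_comp])
  smul_zero a := Subtype.ext (by simp [coe_smul])
  smul_add a s t := Subtype.ext (by simp [coe_smul])
  add_smul a b t := Subtype.ext (by
    simp [coe_smul, mulL, ← LinearMap.add_apply, ← LinearMap.rTensor_add]
    congr 2; ext; simp [add_mul])
  zero_smul t := Subtype.ext (by simp [coe_smul, mulL])

instance : Module (OS4 q)ᵐᵒᵖ (Cotensor ρ) where
  one_smul t := Subtype.ext (by simp [coe_op_smul, mulR])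
  mul_smul a b t := Subtype.ext (by
    simp [coe_op_smul, mulR, LinearMap.mulRight_mul, LinearMap.rTensor_comp])
  smul_zero a := Subtype.ext (by simp [coe_op_smul])
  smul_add a s t := Subtype.ext (by simp [coe_op_smul])
  add_smul a b t := Subtype.ext (by
    simp [coe_op_smul, mulR, ← LinearMap.add_apply, ← LinearMap.rTensor_add]
    congr 2; ext; simp [mul_add])
  zero_smul t := Subtype.ext (by simp [coe_op_smul, mulR])

instance : SMulCommClass (OS4 q) (OS4 q)ᵐᵒᵖ (Cotensor ρ) where
  smul_comm a b t := Subtype.ext (by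
    simp only [coe_smul, coe_op_smul, mulL, mulR, ← LinearMap.comp_apply, ← LinearMap.rTensor_comp]
    congr 2; ext; simp [mul_assoc])

end Cotensor

end Cotensor

/-! ### The representation on `ℓ²(ℕ²)` -/

/-- The Hilbert space `ℓ²(ℕ²)`. -/
abbrev L2 : Type := lp (fun _ : ℕ × ℕ => ℂ) 2

/-- The canonical orthonormal basis `|k₁, k₂⟩`. -/
def ket (k : ℕ × ℕ) : L2 := lp.single 2 k (1 : ℂ)

theorem inner_ket (k : ℕ × ℕ) (f : L2) : inner ℂ (ket k) f = f k := by
  simp [ket, lp.inner_single_left]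

theorem ket_apply_self (k : ℕ × ℕ) : ket k k = 1 := lp.single_apply_self 2 k 1

theorem ket_apply_ne {k m : ℕ × ℕ} (h : m ≠ k) : ket k m = 0 := lp.single_apply_ne 2 k 1 h

/-- The vectors `|s k⟩` form an orthonormal family when `s` is injective. -/
theorem orthogonalFamily_ket (s : ℕ × ℕ → ℕ × ℕ) (hs : Function.Injective s) :
    OrthogonalFamily ℂ (fun _ : ℕ × ℕ => ℂ) fun k =>
      LinearIsometry.toSpanSingleton ℂ L2 (v := ket (s k))
        (by rw [ket, lp.norm_single (by norm_num)]; simp) := by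
  intro i j hij a b
  simp only [LinearIsometry.toSpanSingleton_apply, inner_smul_left, inner_smul_right, inner_ket]
  simp [ket_apply_ne (fun h => hij (hs h) : s i ≠ s j)]

/-- The isometry `|k⟩ ↦ |s k⟩` of an injective map `s`. -/
def shift (s : ℕ × ℕ → ℕ × ℕ) (hs : Function.Injective s) : L2 →L[ℂ] L2 :=
  (orthogonalFamily_ket s hs).linearIsometry.toContinuousLinearMap

theorem shift_ket (s : ℕ × ℕ → ℕ × ℕ) (hs : Function.Injective s) (k : ℕ × ℕ) :
    shift s hs (ket k) = ket (s k) := by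
  simp [shift, ket]

theorem shift_apply (s : ℕ × ℕ → ℕ × ℕ) (hs : Function.Injective s) (f : L2) (k : ℕ × ℕ) :
    shift s hs f (s k) = f k := by
  rw [← inner_ket, ← shift_ket s hs, ← inner_ket]
  exact (orthogonalFamily_ket s hs).linearIsometry.inner_map_map _ _

theorem shift_apply_of_ne (s : ℕ × ℕ → ℕ × ℕ) (hs : Function.Injective s) (f : L2) (m : ℕ × ℕ)
    (hm : ∀ k, m ≠ s k) : shift s hs f m = 0 := by
  rw [← inner_ket]
  have h := ((orthogonalFamily_ket s hs).hasSum_linearIsometry f).mapL (innerSL ℂ (ket m))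
  refine h.unique ?_
  convert! hasSum_zero using 2 with k
  simp [inner_ket, ket_apply_ne (hm k)]

/-- The diagonal operator `|k⟩ ↦ w k |k⟩` of a weight `w` with values in `[-1, 1]`. -/
def diag (w : ℕ × ℕ → ℝ) (hw : ∀ k, |w k| ≤ 1) : L2 →L[ℂ] L2 :=
  have hle (f : L2) (k : ℕ × ℕ) : ‖(w k : ℂ) * f k‖ ≤ ‖f k‖ := by
    rw [norm_mul, Complex.norm_real, Real.norm_eq_abs]
    exact mul_le_of_le_one_left (norm_nonneg _) (hw k)
  LinearMap.mkContinuous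
    { toFun := fun f => ⟨fun k => (w k : ℂ) * f k, (lp.memℓp f).mono' (hle f)⟩
      map_add' := fun f g => by
        ext k
        exact mul_add (w k : ℂ) (f k) (g k)
      map_smul' := fun c f => by
        ext k
        exact mul_left_comm (w k : ℂ) c (f k) } 1
    (fun f => by
      rw [one_mul]
      exact lp.norm_mono (by norm_num) (hle f))

theorem diag_apply (w : ℕ × ℕ → ℝ) (hw : ∀ k, |w k| ≤ 1) (f : L2) (k : ℕ × ℕ) :
    diag w hw f k = (w k : ℂ) * f k := rfl

theorem diag_ket (w : ℕ × ℕ → ℝ) (hw : ∀ k, |w k| ≤ 1) (k : ℕ × ℕ) :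
    diag w hw (ket k) = (w k : ℂ) • ket k := by
  ext j
  rw [diag_apply, lp.coeFn_smul, Pi.smul_apply, smul_eq_mul]
  rcases eq_or_ne j k with rfl | h
  · rfl
  · simp [ket_apply_ne h]

/-- The weighted shift `|k⟩ ↦ w k |s k⟩`. -/
def wshift (s : ℕ × ℕ → ℕ × ℕ) (hs : Function.Injective s) (w : ℕ × ℕ → ℝ)
    (hw : ∀ k, |w k| ≤ 1) : L2 →L[ℂ] L2 := shift s hs ∘L diag w hw

section wshift

variable (s : ℕ × ℕ → ℕ × ℕ) (hs : Function.Injective s) (w : ℕ × ℕ → ℝ) (hw : ∀ k, |w k| ≤ 1)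

theorem wshift_ket (k : ℕ × ℕ) : wshift s hs w hw (ket k) = (w k : ℂ) • ket (s k) := by
  simp only [wshift, ContinuousLinearMap.comp_apply, diag_ket, map_smul, shift_ket]

theorem wshift_apply (f : L2) (k : ℕ × ℕ) : wshift s hs w hw f (s k) = (w k : ℂ) * f k :=
  shift_apply s hs _ k

theorem wshift_apply_of_ne (f : L2) (m : ℕ × ℕ) (hm : ∀ k, m ≠ s k) :
    wshift s hs w hw f m = 0 := shift_apply_of_ne s hs _ m hm

theorem star_wshift_apply (f : L2) (k : ℕ × ℕ) :
    star (wshift s hs w hw) f k = (w k : ℂ) * f (s k) := by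
  rw [← inner_ket, ContinuousLinearMap.star_eq_adjoint, ContinuousLinearMap.adjoint_inner_right,
    wshift_ket, inner_smul_left, inner_ket, Complex.conj_ofReal]

end wshift

theorem abs_weight_le_one {a b : ℝ} (ha0 : 0 ≤ a) (ha : a ≤ 1) (hb : 0 ≤ b) :
    |a * √(1 - b)| ≤ 1 := by
  rw [abs_of_nonneg (mul_nonneg ha0 (Real.sqrt_nonneg _))]
  exact mul_le_one₀ ha (Real.sqrt_nonneg _) (Real.sqrt_le_one.2 (by linarith))

section Rep

variable {q : ℝ} (hq : q ∈ Set.Ioo (0 : ℝ) 1)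

/-- `|k₁, k₂⟩ ↦ q^(k₁ + 2 k₂) |k₁, k₂⟩`. -/
def repX₂ : L2 →L[ℂ] L2 :=
  wshift id Function.injective_id (fun k => q ^ (k.1 + 2 * k.2)) fun k => by
    rw [abs_of_nonneg (pow_nonneg hq.1.le _)]
    exact pow_le_one₀ hq.1.le hq.2.le

/-- `|k₁, k₂⟩ ↦ q^k₁ √(1 - q^(4 (k₂ + 1))) |k₁, k₂ + 1⟩`. -/
def repX₃ : L2 →L[ℂ] L2 :=
  wshift (fun k => (k.1, k.2 + 1)) (fun k m h => by simpa [Prod.ext_iff] using h)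
    (fun k => q ^ k.1 * √(1 - q ^ (4 * (k.2 + 1)))) fun _ =>
      abs_weight_le_one (pow_nonneg hq.1.le _) (pow_le_one₀ hq.1.le hq.2.le)
        (pow_nonneg hq.1.le _)

/-- `|k₁, k₂⟩ ↦ √(1 - q^(2 (k₁ + 1))) |k₁ + 1, k₂⟩`. -/
def repX₄ : L2 →L[ℂ] L2 :=
  wshift (fun k => (k.1 + 1, k.2)) (fun k m h => by simpa [Prod.ext_iff] using h)
    (fun k => √(1 - q ^ (2 * (k.1 + 1)))) fun _ =>
      by
      simpa using abs_weight_le_one zero_le_one le_rfl (pow_nonneg hq.1.le _)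

theorem repX₂_apply (f : L2) (k l : ℕ) :
    repX₂ hq f (k, l) = (q : ℂ) ^ (k + 2 * l) * f (k, l) := by
  have := wshift_apply id Function.injective_id (fun k => q ^ (k.1 + 2 * k.2)) (fun k => by
    rw [abs_of_nonneg (pow_nonneg hq.1.le _)]
    exact pow_le_one₀ hq.1.le hq.2.le) f (k, l)
  simpa using! this

theorem star_repX₂_apply (f : L2) (k l : ℕ) :
    star (repX₂ hq) f (k, l) = (q : ℂ) ^ (k + 2 * l) * f (k, l) := by
  rw [repX₂, star_wshift_apply]
  simp

theorem repX₃_apply_zero (f : L2) (k : ℕ) : repX₃ hq f (k, 0) = 0 :=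
  wshift_apply_of_ne _ _ _ _ f _ (by simp [Prod.ext_iff])

theorem repX₃_apply_succ (f : L2) (k l : ℕ) : repX₃ hq f (k, l + 1) =
    (q : ℂ) ^ k * (√(1 - q ^ (4 * (l + 1))) : ℝ) * f (k, l) := by
  have := wshift_apply (fun k => (k.1, k.2 + 1)) (fun k m h => by simpa [Prod.ext_iff] using h)
    (fun k => q ^ k.1 * √(1 - q ^ (4 * (k.2 + 1)))) (fun _ =>
      abs_weight_le_one (pow_nonneg hq.1.le _) (pow_le_one₀ hq.1.le hq.2.le)
        (pow_nonneg hq.1.le _)) f (k, l)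
  simpa using! this

theorem star_repX₃_apply (f : L2) (k l : ℕ) : star (repX₃ hq) f (k, l) =
    (q : ℂ) ^ k * (√(1 - q ^ (4 * (l + 1))) : ℝ) * f (k, l + 1) := by
  exact (star_wshift_apply _ _ _ _ f (k, l)).trans (by simp)

theorem repX₄_apply_zero (f : L2) (l : ℕ) : repX₄ hq f (0, l) = 0 :=
  wshift_apply_of_ne _ _ _ _ f _ (by simp [Prod.ext_iff])

theorem repX₄_apply_succ (f : L2) (k l : ℕ) : repX₄ hq f (k + 1, l) =
    (√(1 - q ^ (2 * (k + 1))) : ℝ) * f (k, l) := by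
  have := wshift_apply (fun k => (k.1 + 1, k.2)) (fun k m h => by simpa [Prod.ext_iff] using h)
    (fun k => √(1 - q ^ (2 * (k.1 + 1)))) (fun _ =>
      by
      simpa using abs_weight_le_one zero_le_one le_rfl (pow_nonneg hq.1.le _)) f (k, l)
  simpa using! this

theorem star_repX₄_apply (f : L2) (k l : ℕ) : star (repX₄ hq) f (k, l) =
    (√(1 - q ^ (2 * (k + 1))) : ℝ) * f (k + 1, l) := by
  exact star_wshift_apply _ _ _ _ f (k, l)

theorem sqrt_weight_sq {q : ℝ} (hq : q ∈ Set.Ioo (0 : ℝ) 1) (n : ℕ) : ((√(1 - q ^ n) : ℝ) : ℂ) ^ 2 = 1 - (q : ℂ) ^ n := by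
  rw [← Complex.ofReal_pow, Real.sq_sqrt (sub_nonneg.2 (pow_le_one₀ hq.1.le hq.2.le))]
  simp

theorem sqrt_weight_sq' {q : ℝ} (hq : q ∈ Set.Ioo (0 : ℝ) 1) (m n : ℕ) :
    ((√(1 - q ^ m * q ^ n) : ℝ) : ℂ) ^ 2 = 1 - (q : ℂ) ^ m * (q : ℂ) ^ n := by
  rw [← pow_add, ← pow_add, ← Complex.ofReal_pow,
    Real.sq_sqrt (sub_nonneg.2 (pow_le_one₀ hq.1.le hq.2.le))]
  simp

theorem op_ext {S T : L2 →L[ℂ] L2} (h : ∀ f k l, S f (k, l) = T f (k, l)) : S = T :=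
  ContinuousLinearMap.ext fun f => lp.ext (funext fun k => h f k.1 k.2)

theorem op_mul_apply (S T : L2 →L[ℂ] L2) (f : L2) (k : ℕ × ℕ) : (S * T) f k = S (T f) k := rfl

theorem op_add_apply (S T : L2 →L[ℂ] L2) (f : L2) (k : ℕ × ℕ) : (S + T) f k = S f k + T f k := rfl

theorem op_smul_apply (c : ℂ) (S : L2 →L[ℂ] L2) (f : L2) (k : ℕ × ℕ) : (c • S) f k = c * S f k :=
  rfl

theorem op_one_apply (f : L2) (k : ℕ × ℕ) : (1 : L2 →L[ℂ] L2) f k = f k := rfl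

/-- The *-representation `π` of `O(S^7_q)` on `ℓ²(ℕ²)`; the adjoints of the generators act by
adjoint operators. -/
def rep : OS7 q →ₐ[ℂ] (L2 →L[ℂ] L2) :=
  OS7.lift ![0, repX₂ hq, repX₃ hq, repX₄ hq]
    ![0, star (repX₂ hq), star (repX₃ hq), star (repX₄ hq)] (by
    simp only [s7Rels, List.forall_mem_cons, List.not_mem_nil, false_imp_iff, implies_true,
      and_true, Matrix.cons_val]
    refine ⟨?_, ?_, ?_, ?_, ?_, ?_, ?_, ?_, ?_, ?_, ?_, ?_, ?_, ?_, ?_, ?_, ?_, ?_, ?_, ?_, ?_, ?_,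
      ?_, ?_, ?_, ?_, ?_, ?_, ?_⟩ <;>
      (try simp only [mul_zero, zero_mul, smul_zero, add_zero, sub_zero, zero_add]) <;>
      refine op_ext fun f k l => ?_ <;>
      rcases k with _ | k <;> rcases l with _ | l <;>
      simp only [op_mul_apply, op_add_apply, op_smul_apply, op_one_apply,
        repX₂_apply, star_repX₂_apply, repX₃_apply_zero, repX₃_apply_succ, star_repX₃_apply,
        repX₄_apply_zero, repX₄_apply_succ, star_repX₄_apply] <;>
      ring_nf <;> (try simp only [sqrt_weight_sq hq, sqrt_weight_sq' hq]) <;> (try ring_nf))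

end Rep

/-! ### Trace class operators and the first Chern number -/

/-- Trace class operators on a Hilbert space: norm-convergent sums `∑ ‖a n‖ ‖b n‖ < ∞` of rank one
operators `x ↦ ⟨a n, x⟩ b n`. -/
def IsTraceClass {H : Type*} [NormedAddCommGroup H] [InnerProductSpace ℂ H] (T : H →L[ℂ] H) :
    Prop :=
  ∃ a b : ℕ → H, Summable (fun n => ‖a n‖ * ‖b n‖) ∧
    ∀ x, HasSum (fun n => inner ℂ (a n) x • b n) (T x)

/-- `T` is of trace class on `ℓ²(ℕ²)` and its trace `∑_k ⟨k|T|k⟩` is `c`. -/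
def HasTrace (T : L2 →L[ℂ] L2) (c : ℂ) : Prop :=
  IsTraceClass T ∧ HasSum (fun k => inner ℂ (ket k) (T (ket k))) c

section Chern

variable {q : ℝ}

/-- The right `B`-module `p B^N` of a matrix `p` with entries in `B = O(S^4_q)`. -/
def imageModule {N : ℕ} (p : Matrix (Fin N) (Fin N) (OS4 q)) :
    Submodule (OS4 q)ᵐᵒᵖ (Fin N → OS4 q) where
  carrier := {v | ∃ w, p.mulVec w = v}
  zero_mem' := ⟨0, Matrix.mulVec_zero p⟩
  add_mem' := by
    rintro _ _ ⟨v, rfl⟩ ⟨w, rfl⟩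
    exact ⟨v + w, Matrix.mulVec_add p v w⟩
  smul_mem' := by
    rintro b _ ⟨w, rfl⟩
    exact ⟨b • w, Matrix.mulVec_smul p b w⟩

/-- The right `B`-module `E` is isomorphic to `p B^N` for the idempotent `p ∈ M_N(B)`. -/
def IsPresentedBy (E : Type*) [AddCommGroup E] [Module (OS4 q)ᵐᵒᵖ E] {N : ℕ}
    (p : Matrix (Fin N) (Fin N) (OS4 q)) : Prop :=
  IsIdempotentElem p ∧ Nonempty (E ≃ₗ[(OS4 q)ᵐᵒᵖ] imageModule p)

/-- `ch₁(E) = c` for a right module `E` over `B = O(S^4_q)`: the module is finitely generated and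
projective, i.e. `E ≅ p B^N` for some idempotent `p ∈ M_N(B)`, and for each such `N` and `p` the
operator `π(Tr p) - ε(Tr p)` is of trace class with trace `c`. -/
def HasCh₁ (hq : q ∈ Set.Ioo (0 : ℝ) 1) (E : Type*) [AddCommGroup E] [Module (OS4 q)ᵐᵒᵖ E]
    (c : ℂ) : Prop :=
  (∃ (N : ℕ) (p : Matrix (Fin N) (Fin N) (OS4 q)), IsPresentedBy E p) ∧
    ∀ (N : ℕ) (p : Matrix (Fin N) (Fin N) (OS4 q)), IsPresentedBy E p →
      HasTrace (rep hq (p.trace : OS4 q) - OS7.character q (p.trace : OS4 q) • 1) c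

end Chern

end QuantumSphere

end

set_option linter.unusedSimpArgs false
set_option linter.unnecessarySeqFocus false

noncomputable section

namespace QuantumSphere

/-! ### The spin matrices of `O(SU_q(2))` -/

/-! Let `V_m` be the corepresentation on the polynomials of degree `m` of the quantum plane, with
matrix `spinMat q m`, and let `c_m` be the Chern number of its associated module. The value of `c_m`
comes from a linear recursion. Chern numbers are additive on direct sums (`HasChern.of_fromBlocks`)
and obey a Leibniz rule weighted by dimensions, `c(t ⊗ s) = dim s · c(t) + dim t · c(s)`
(`HasChern.tensor`). Since `V_1 ⊗ V_(m+1) ≅ V_(m+2) ⊕ V_m` (`clebschGordan`), this gives `c_(m+2) =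
2 c_(m+1) - c_m - (m + 2)`. From `c_0 = 0` and `c_1 = -1` it follows that `c_m = -m(m+1)(m+2)/6`.
Only `c_1` needs a computation with operators: a product of two geometric series
(`hasChern_spinMat_one`).

The bookkeeping device is a frame of `t`: covariant elements `y` and contravariant elements `z` with
`y z = 1`. Then `z y` is an idempotent over `O(S^4_q)` that presents the cotensor product
(`IsFrame.isPresentedBy`). Frames can be tensored, conjugated and restricted to summands, so a frame
of `V_1`, read off from the matrix `u`, suffices for the recursion.

Traces exist because `π(x_1) = 0` and `π(x_2)` is of trace class. Modulo trace class operators, `π`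
therefore factors through the restriction to the fibre `O(SU_q(2))` over a point, where a
coinvariant `b` becomes the scalar `ε(b)` (`isTraceClass_rep_sub`). As `ε` is a character, `Tr (π -
ε)` vanishes on commutators of coinvariants, so it depends only on the isomorphism class of the
module (`hasTrace_chernOp_trace_of_equiv`).

It remains to see that an irreducible `V` of dimension `n + 1` is `V_n`
(`exists_basis_of_isIrreducible`). Raising and lowering functionals show that spin comodules are
simple, Clebsch–Gordan shows that `O(SU_q(2))` is a sum of them, and matrix coefficients embed `V`
into that sum. -/

/-- The sequence `0, f 0, f 1, …`. -/
def delay {R : Type*} [Zero R] (f : ℕ → R) : ℕ → R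
  | 0 => 0
  | l + 1 => f l

@[simp] theorem delay_zero {R : Type*} [Zero R] (f : ℕ → R) : delay f 0 = 0 := rfl

@[simp] theorem delay_succ {R : Type*} [Zero R] (f : ℕ → R) (l : ℕ) : delay f (l + 1) = f l := rfl

namespace OSU

variable (q : ℝ)

/-- The matrix elements of the corepresentation of dimension `m + 1` on the span of the monomials
`x^i y^(m - i)`, `0 ≤ i ≤ m`, of the quantum plane `x y = q y x`; indices `> m` give `0`. -/
def spin : ℕ → ℕ → ℕ → OSU q
  | 0, 0, 0 => 1
  | 0, 0, _ + 1 => 0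
  | 0, _ + 1, _ => 0
  | m + 1, 0, l => γ q * delay (spin m 0) l + ((q : ℂ)⁻¹ ^ l) • (α' q * spin m 0 l)
  | m + 1, i + 1, l =>
    α q * delay (spin m i) l - ((q : ℂ) * (q : ℂ)⁻¹ ^ l) • (γ' q * spin m i l)

theorem spin_succ_zero (m l : ℕ) : spin q (m + 1) 0 l =
    γ q * delay (spin q m 0) l + ((q : ℂ)⁻¹ ^ l) • (α' q * spin q m 0 l) := by rw [spin]

theorem spin_succ_succ (m i l : ℕ) : spin q (m + 1) (i + 1) l =
    α q * delay (spin q m i) l - ((q : ℂ) * (q : ℂ)⁻¹ ^ l) • (γ' q * spin q m i l) := by rw [spin]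

@[simp] theorem spin_zero_zero : spin q 0 0 0 = 1 := by rw [spin]
@[simp] theorem spin_zero_right (j : ℕ) : spin q 0 0 (j + 1) = 0 := by rw [spin]
@[simp] theorem spin_zero_left (i j : ℕ) : spin q 0 (i + 1) j = 0 := by rw [spin]

theorem spin_eq_zero_of_lt_left {m i : ℕ} (h : m < i) (j : ℕ) : spin q m i j = 0 := by
  induction m generalizing i j with
  | zero => obtain ⟨i, rfl⟩ := Nat.exists_eq_succ_of_ne_zero h.ne'; simp
  | succ m ih =>
    obtain ⟨i, rfl⟩ := Nat.exists_eq_succ_of_ne_zero (Nat.ne_zero_of_lt h)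
    have hi : ∀ j, spin q m i j = 0 := fun j => ih (by simpa using h) j
    cases j <;> simp [spin_succ_succ, hi]

theorem spin_eq_zero_of_lt_right {m j : ℕ} (h : m < j) (i : ℕ) : spin q m i j = 0 := by
  induction m generalizing i j with
  | zero =>
    obtain ⟨j, rfl⟩ := Nat.exists_eq_succ_of_ne_zero h.ne'
    cases i <;> simp
  | succ m ih =>
    obtain ⟨j, rfl⟩ := Nat.exists_eq_succ_of_ne_zero (Nat.ne_zero_of_lt h)
    have hj : ∀ i, spin q m i j = 0 := fun i => ih (by simpa using h) i
    have hj' : ∀ i, spin q m i (j + 1) = 0 := fun i => ih (by omega) i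
    cases i <;> simp [spin_succ_succ, spin_succ_zero, hj, hj']

variable {q}

/-- Multiplication by `y` in the quantum plane. -/
theorem spin_mul_y (hq : (q : ℂ) ≠ 0) {m i : ℕ} (hi : i ≤ m) (l : ℕ) :
    γ q * delay (spin q m i) l + ((q : ℂ)⁻¹ ^ l) • (α' q * spin q m i l) =
      ((q : ℂ)⁻¹ ^ i) • spin q (m + 1) i l := by
  induction m generalizing i l with
  | zero =>
    obtain rfl : i = 0 := by omega
    rw [spin_succ_zero]; simp
  | succ m ih =>
    rcases i with _ | i
    · rw [spin_succ_zero _ (m + 1)]; simp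
    · obtain ⟨e1, e2, e3, h2, h3, h6, h7⟩ := mul_rels q
      rw [spin_succ_succ _ (m + 1)]
      replace ih := fun l => @ih i (by omega) l
      -- The definition builds row `i + 1` by a factor `x`. The induction hypothesis also expresses
      -- row `i ≤ m` by a factor `y`, so both sides become quadratic in the generators times `spin q
      -- m i`.
      have hs (l) : spin q (m + 1) i l = (q : ℂ) ^ i •
          (γ q * delay (spin q m i) l + ((q : ℂ)⁻¹ ^ l) • (α' q * spin q m i l)) := by
        rw [ih, smul_smul, ← mul_pow, mul_inv_cancel₀ hq, one_pow, one_smul]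
      rcases l with _ | l
      · rw [hs 0]
        simp only [delay_zero, mul_zero, spin_succ_succ, zero_add, zero_sub, mul_neg, smul_neg,
          mul_smul_comm, ← mul_assoc, h6, smul_mul_assoc]
        match_scalars <;> simp only [inv_pow] <;> field_simp <;> ring
      · rw [delay_succ, delay_succ, hs l, hs (l + 1)]
        simp only [delay_succ, spin_succ_succ, mul_add, mul_sub, mul_smul_comm, smul_add, smul_sub,
          ← mul_assoc, e1, e2, e3, h6, h7, smul_mul_assoc, sub_mul, one_mul]
        match_scalars <;> simp only [inv_pow] <;> field_simp <;> ring

/-- The two intertwining relations of a section of the multiplication map. -/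
theorem spin_section (hq : (q : ℂ) ≠ 0) {m i : ℕ} (hi : i ≤ m + 1) (j : ℕ) :
    ((q : ℂ)⁻¹ ^ (2 * (j + 1)) - 1) • spin q (m + 1) i (j + 1) =
        ((q : ℂ)⁻¹ ^ (2 * i) - 1) • (α q * delay (fun i => spin q m i j) i) +
        ((q : ℂ) ^ i * (q : ℂ)⁻¹ ^ (2 * m + 2) - (q : ℂ)⁻¹ ^ i) • (γ q * spin q m i j) ∧
    ((q : ℂ) ^ j * (q : ℂ)⁻¹ ^ (2 * m + 2) - (q : ℂ)⁻¹ ^ j) • spin q (m + 1) i j =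
        -((q : ℂ) * ((q : ℂ)⁻¹ ^ (2 * i) - 1)) • (γ' q * delay (fun i => spin q m i j) i) +
        ((q : ℂ) ^ i * (q : ℂ)⁻¹ ^ (2 * m + 2) - (q : ℂ)⁻¹ ^ i) • (α' q * spin q m i j) := by
  obtain ⟨e1, e2, e3, h2, h3, h6, h7⟩ := mul_rels q
  induction m generalizing i j with
  | zero =>
    rcases i with _ | _ | i
    · rcases j with _ | _ | j <;> simp [spin_succ_zero, -Complex.coe_smul]
      left
      field_simp
      simp
    · rcases j with _ | _ | j <;> simp [spin_succ_succ, -Complex.coe_smul]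
      · rw [smul_smul, mul_comm]
      · left
        field_simp
        simp
    · omega
  | succ m ih =>
    -- Row `0` is built by a factor `y`, the other rows by a factor `x`. In both cases the goal is a
    -- combination of the relations in degree `m`, multiplied on the left by generators and brought
    -- to normal order. The powers of `q⁻¹` come from moving `y` past powers of `x`.
    rcases i with _ | i
    · have ih1 := congrArg (α' q * ·) (ih (i := 0) (by omega) j).1
      rw [spin_succ_zero _ (m + 1), spin_succ_zero _ (m + 1)]
      simp only [mul_smul_comm, ← mul_assoc, h3, smul_mul_assoc, delay_succ, delay_zero,
        mul_zero, smul_zero, zero_add, pow_zero, one_mul] at ih1 ⊢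
      constructor
      · have ih2 := congrArg (γ q * ·) (ih (i := 0) (by omega) j).2
        simp only [mul_smul_comm, ← mul_assoc, h3, smul_mul_assoc, delay_succ, delay_zero,
          mul_zero, smul_zero, zero_add, pow_zero, one_mul] at ih2
        linear_combination (norm := skip) ((q : ℂ)⁻¹ ^ (j+1)) • ih1 - ((q : ℂ)⁻¹ ^ (j+2)) • ih2
        match_scalars <;> simp only [inv_pow] <;> field_simp <;> ring
      · rcases j with _ | l
        · simp
        · have ih1 := congrArg (α' q * ·) (ih (i := 0) (by omega) l).1
          have ih2 := congrArg (γ q * ·) (ih (i := 0) (by omega) l).2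
          simp only [mul_smul_comm, ← mul_assoc, h3, smul_mul_assoc, delay_succ, delay_zero,
            mul_zero, smul_zero, zero_add, pow_zero, one_mul] at ih1 ih2 ⊢
          linear_combination (norm := skip) ((q : ℂ)⁻¹) • ih2 - ih1
          match_scalars <;> simp only [inv_pow] <;> field_simp <;> ring
    -- At `i = m + 1` the monomial relation `spin_mul_y` is not available, but there the prefactor
    -- vanishes.
    · have hM (j : ℕ) : ((q : ℂ) ^ i * (q : ℂ)⁻¹ ^ (2 * m + 2) - (q : ℂ)⁻¹ ^ i) •
          (γ q * delay (spin q m i) j + ((q : ℂ)⁻¹ ^ j) • (α' q * spin q m i j)) =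
          ((q : ℂ) ^ i * (q : ℂ)⁻¹ ^ (2 * m + 2) - (q : ℂ)⁻¹ ^ i) •
            ((q : ℂ)⁻¹ ^ i) • spin q (m + 1) i j := by
        rcases Nat.lt_or_ge m i with h | h
        · obtain rfl : i = m + 1 := by omega
          have : (q : ℂ) ^ (m + 1) * (q : ℂ)⁻¹ ^ (2 * m + 2) - (q : ℂ)⁻¹ ^ (m + 1) = 0 := by
            simp only [inv_pow]; field_simp; ring
          rw [this, zero_smul, zero_smul]
        · rw [spin_mul_y hq h]
      constructor
      · have ih1 := congrArg (γ' q * ·) (ih (i := i) (by omega) j).1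
        have ih2 := congrArg (α q * ·) (ih (i := i) (by omega) j).2
        have h5 := congrArg (α q * ·) (hM j)
        rw [spin_succ_succ _ (m + 1)]
        simp only [delay_succ, spin_succ_succ q m i j]
        simp only [mul_smul_comm, ← mul_assoc, mul_add, mul_sub, smul_mul_assoc, sub_mul, one_mul,
          e1, e2, e3, h2, h3, h6, h7] at ih1 ih2 h5 ⊢
        linear_combination (norm := skip) -((q : ℂ)⁻¹ ^ (j+2)) • ih2 - ((q : ℂ)⁻¹ ^ j) • ih1
          - ((q : ℂ)⁻¹ ^ 2) • h5
        match_scalars <;> simp only [inv_pow] <;> field_simp <;> ring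
      · rcases j with _ | l
        · have h5 := congrArg (γ' q * ·) (hM 0)
          rw [spin_succ_succ _ (m + 1)]
          simp only [delay_succ, delay_zero, spin_succ_succ q m i 0]
          simp only [mul_smul_comm, ← mul_assoc, mul_add, mul_sub, smul_mul_assoc, sub_mul, one_mul,
            e1, e2, e3, h2, h3, h6, h7, delay_zero, mul_zero] at h5 ⊢
          linear_combination (norm := skip) ((q : ℂ) * (q : ℂ)⁻¹ ^ 2) • h5
          match_scalars <;> simp only [inv_pow] <;> field_simp <;> ring
        · have ih1 := congrArg (γ' q * ·) (ih (i := i) (by omega) l).1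
          have ih2 := congrArg (α q * ·) (ih (i := i) (by omega) l).2
          have h5 := congrArg (γ' q * ·) (hM (l + 1))
          rw [spin_succ_succ _ (m + 1)]
          simp only [delay_succ, spin_succ_succ q m i (l + 1)]
          simp only [mul_smul_comm, ← mul_assoc, mul_add, mul_sub, smul_mul_assoc, sub_mul, one_mul,
            e1, e2, e3, h2, h3, h6, h7, delay_succ] at ih1 ih2 h5 ⊢
          linear_combination (norm := skip) ((q : ℂ)⁻¹) • ih2 + (q : ℂ) • ih1 +
            ((q : ℂ) * (q : ℂ)⁻¹ ^ 2) • h5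
          match_scalars <;> simp only [inv_pow] <;> field_simp <;> ring

/-- The intertwining relations of the contraction `V_1 ⊗ V_(m + 1) → V_m`. -/
theorem spin_contract (hq : (q : ℂ) ≠ 0) {m i : ℕ} (hi : i ≤ m + 1) (j : ℕ) :
    ((q : ℂ) ^ j * (q : ℂ)⁻¹ ^ (2 * m + 2) - (q : ℂ)⁻¹ ^ j) • (α q * spin q (m + 1) i j) +
      ((q : ℂ) ^ 2 * ((q : ℂ)⁻¹ ^ (2 * (j + 1)) - 1)) • (γ' q * spin q (m + 1) i (j + 1)) =
      ((q : ℂ) ^ i * (q : ℂ)⁻¹ ^ (2 * m + 2) - (q : ℂ)⁻¹ ^ i) • spin q m i j ∧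
    ((q : ℂ) ^ j * (q : ℂ)⁻¹ ^ (2 * m + 2) - (q : ℂ)⁻¹ ^ j) • (γ q * spin q (m + 1) i j) -
      ((q : ℂ) * ((q : ℂ)⁻¹ ^ (2 * (j + 1)) - 1)) • (α' q * spin q (m + 1) i (j + 1)) =
      -((q : ℂ) * ((q : ℂ)⁻¹ ^ (2 * i) - 1)) • delay (fun i => spin q m i j) i := by
  obtain ⟨e1, e2, e3, h2, h3, h6, h7⟩ := mul_rels q
  obtain ⟨s1, s2⟩ := spin_section hq hi j
  -- The matrix `T` is inverted: combining the two relations of the section with a row of `T⁻¹` on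
  -- the left cancels one of the two terms on the right and turns the other into a scalar multiple
  -- of an entry of degree `m`.
  constructor
  · have s1 := congrArg (γ' q * ·) s1
    have s2 := congrArg (α q * ·) s2
    simp only [mul_smul_comm, ← mul_assoc, mul_add, mul_sub, smul_mul_assoc, sub_mul, one_mul,
      e1, e2, e3, h2, h3, h6, h7, smul_smul] at s1 s2 ⊢
    linear_combination (norm := skip) s2 + ((q : ℂ) ^ 2) • s1
    match_scalars <;> ring
  · have s1 := congrArg (α' q * ·) s1
    have s2 := congrArg (γ q * ·) s2
    simp only [mul_smul_comm, ← mul_assoc, mul_add, mul_sub, smul_mul_assoc, sub_mul, one_mul,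
      e1, e2, e3, h2, h3, h6, h7, smul_smul] at s1 s2 ⊢
    linear_combination (norm := skip) s2 - (q : ℂ) • s1
    match_scalars <;> ring

theorem comul_delay (m i l : ℕ)
    (h : ∀ l, comul q (spin q m i l) =
      ∑ k ∈ Finset.range (m + 1), spin q m i k ⊗ₜ spin q m k l) :
    comul q (delay (spin q m i) l) =
      ∑ k ∈ Finset.range (m + 1), spin q m i k ⊗ₜ delay (spin q m k) l := by
  cases l <;> simp [h]

/-- Multiplying a monomial by `x` or `y` multiplies its coaction by a row of `T`, and `Δ` is
multiplicative, so the corepresentation property passes from degree `m` to degree `m + 1`. -/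
theorem comul_spin (hq : (q : ℂ) ≠ 0) {m i : ℕ} (hi : i ≤ m) (l : ℕ) :
    comul q (spin q m i l) = ∑ k ∈ Finset.range (m + 1), spin q m i k ⊗ₜ spin q m k l := by
  induction m generalizing i l with
  | zero =>
    obtain rfl : i = 0 := by omega
    cases l <;> simp [Algebra.TensorProduct.one_def]
  | succ m ih =>
    -- Here `a`, `c` are the coefficients of `x`, `y` in a row of `T`, and the two factors on the
    -- left are their comultiplications. This covers the rows of `x` and of `y` at once; `hg`
    -- removes the extra term of the longer sum.
    have key (a c : OSU q) (g : ℕ → OSU q) (hg : g (m + 1) = 0) :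
        (a ⊗ₜ α q + c ⊗ₜ γ q) * ∑ k ∈ Finset.range (m + 1), g k ⊗ₜ delay (spin q m k) l +
          ((q : ℂ)⁻¹ ^ l) • ((c ⊗ₜ α' q - (q : ℂ) • (a ⊗ₜ γ' q)) *
            ∑ k ∈ Finset.range (m + 1), g k ⊗ₜ spin q m k l) =
        ∑ k ∈ Finset.range (m + 2),
          (a * delay g k + ((q : ℂ)⁻¹ ^ k) • (c * g k)) ⊗ₜ[ℂ] spin q (m + 1) k l := by
      have h1 : ∑ k ∈ Finset.range (m + 2), (a * delay g k) ⊗ₜ[ℂ] spin q (m + 1) k l =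
          ∑ k ∈ Finset.range (m + 1), (a * g k) ⊗ₜ[ℂ] spin q (m + 1) (k + 1) l := by
        rw [Finset.sum_range_succ']; simp
      have h2 : ∑ k ∈ Finset.range (m + 2),
            (((q : ℂ)⁻¹ ^ k) • (c * g k)) ⊗ₜ[ℂ] spin q (m + 1) k l =
          ∑ k ∈ Finset.range (m + 1), (c * g k) ⊗ₜ[ℂ] (((q : ℂ)⁻¹ ^ k) • spin q (m + 1) k l) := by
        rw [Finset.sum_range_succ]; simp [hg, TensorProduct.smul_tmul, -Complex.coe_smul]
      simp only [TensorProduct.add_tmul, Finset.sum_add_distrib, h1, h2]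
      rw [← Finset.sum_add_distrib, Finset.mul_sum, Finset.mul_sum, Finset.smul_sum,
        ← Finset.sum_add_distrib]
      refine Finset.sum_congr rfl fun k hk => ?_
      rw [← spin_mul_y hq (by simpa [Nat.lt_succ_iff] using hk), spin_succ_succ]
      simp only [add_mul, sub_mul, Algebra.TensorProduct.tmul_mul_tmul, smul_mul_assoc,
        TensorProduct.tmul_add, TensorProduct.tmul_sub, TensorProduct.tmul_smul, smul_sub]
      module
    rcases i with _ | i
    · rw [spin_succ_zero, map_add, map_mul, map_smul, map_mul, ih (by omega),
        comul_delay _ _ _ (ih (by omega))]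
      simp only [comul, lift_γ, lift_α']
      rw [key (γ q) (α' q) _ (spin_eq_zero_of_lt_right q (by omega) _)]
      simp only [spin_succ_zero]
    · rw [spin_succ_succ, map_sub, map_mul, map_smul, map_mul, ih (by omega),
        comul_delay _ _ _ (ih (by omega))]
      have := key (α q) (-((q : ℂ) • γ' q)) _ (spin_eq_zero_of_lt_right q (Nat.lt_succ_self m) i)
      simp only [spin_succ_succ, comul, lift_α, lift_γ']
      convert this using 1
      · simp only [TensorProduct.neg_tmul, ← TensorProduct.smul_tmul', mul_smul, smul_add,
          ← sub_eq_add_neg]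
        rw [sub_eq_add_neg]
        congr 1
        rw [smul_comm, ← smul_neg, ← smul_mul_assoc, ← neg_mul]
        congr 2
      · refine Finset.sum_congr rfl fun k _ => ?_
        congr 1
        simp only [neg_mul, smul_mul_assoc, smul_neg, mul_smul]
        rw [sub_eq_add_neg, smul_comm]

theorem counit_spin {m i : ℕ} (hi : i ≤ m) (l : ℕ) :
    counit q (spin q m i l) = if i = l then 1 else 0 := by
  induction m generalizing i l with
  | zero =>
    obtain rfl : i = 0 := by omega
    cases l <;> simp
  | succ m ih =>
    rcases i with _ | i
    · rw [spin_succ_zero]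
      simp only [counit, map_add, map_mul, map_smul, lift_γ, lift_α'] at ih ⊢
      rw [ih (by omega)]
      cases l <;> simp
    · rw [spin_succ_succ]
      simp only [counit, map_sub, map_mul, map_smul, lift_α, lift_γ'] at ih ⊢
      rcases l with _ | l
      · simp
      · simp [ih (i := i) (by omega)]

/-! ### Raising and lowering functionals -/

/-- An upper triangular representation of `O(SU_q(2))` of dimension 2. -/
def triRep (hq : (q : ℂ) ≠ 0) (u v : ℂ) : OSU q →ₐ[ℂ] Matrix (Fin 2) (Fin 2) ℂ :=
  lift !![(q : ℂ), 0; 0, 1] !![(q : ℂ)⁻¹, 0; 0, 1] !![0, u; 0, 0] !![0, v; 0, 0] (by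
    simp [suRels, Matrix.one_fin_two, hq, -Complex.coe_smul]
    ext i j; fin_cases i <;> fin_cases j <;> rfl)

/-- The coefficients of the raising operator. -/
def raiseCoeff (q : ℝ) : ℕ → ℕ → ℝ
  | 0, _ => 0
  | m + 1, 0 => 1 + q⁻¹ ^ 2 * raiseCoeff q m 0
  | m + 1, i + 1 => q * raiseCoeff q m i

/-- The coefficients of the lowering operator. -/
def lowerCoeff (q : ℝ) : ℕ → ℕ → ℝ
  | 0, _ => 0
  | _ + 1, 0 => 0
  | m + 1, i + 1 => q * lowerCoeff q m i + if i ≤ m then q * q⁻¹ ^ i else 0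

theorem raiseCoeff_nonneg (hq : 0 < q) (m i : ℕ) : 0 ≤ raiseCoeff q m i := by
  induction m generalizing i with
  | zero => simp [raiseCoeff]
  | succ m ih =>
    cases i with
    | zero => have := ih 0; simp only [raiseCoeff]; positivity
    | succ i => have := ih i; simp only [raiseCoeff]; positivity

theorem raiseCoeff_pos (hq : 0 < q) {m i : ℕ} (h : i < m) : 0 < raiseCoeff q m i := by
  induction m generalizing i with
  | zero => omega
  | succ m ih =>
    cases i with
    | zero => have := raiseCoeff_nonneg hq m 0; simp only [raiseCoeff]; positivity
    | succ i => have := ih (i := i) (by omega); simp only [raiseCoeff]; positivity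

theorem lowerCoeff_nonneg (hq : 0 < q) (m i : ℕ) : 0 ≤ lowerCoeff q m i := by
  induction m generalizing i with
  | zero => simp [lowerCoeff]
  | succ m ih =>
    cases i with
    | zero => simp [lowerCoeff]
    | succ i => have := ih i; simp only [lowerCoeff]; positivity

theorem lowerCoeff_pos (hq : 0 < q) {m i : ℕ} (h : i ≤ m) : 0 < lowerCoeff q (m + 1) (i + 1) := by
  have := lowerCoeff_nonneg hq m i
  simp only [lowerCoeff, h, if_true]
  positivity

section triRep

variable (hq : (q : ℂ) ≠ 0) (u v : ℂ) (h : OSU q) (j : Fin 2)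

theorem triRep_α_mul_zero : triRep hq u v (α q * h) 0 j = q * triRep hq u v h 0 j := by
  simp [triRep, Matrix.mul_apply, -Matrix.cons_mul]

theorem triRep_α_mul_one : triRep hq u v (α q * h) 1 j = triRep hq u v h 1 j := by
  simp [triRep, Matrix.mul_apply, -Matrix.cons_mul]

theorem triRep_α'_mul_zero : triRep hq u v (α' q * h) 0 j = (q : ℂ)⁻¹ * triRep hq u v h 0 j := by
  simp [triRep, Matrix.mul_apply, -Matrix.cons_mul]

theorem triRep_α'_mul_one : triRep hq u v (α' q * h) 1 j = triRep hq u v h 1 j := by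
  simp [triRep, Matrix.mul_apply, -Matrix.cons_mul]

theorem triRep_γ_mul_zero : triRep hq u v (γ q * h) 0 j = u * triRep hq u v h 1 j := by
  simp [triRep, Matrix.mul_apply, -Matrix.cons_mul]

theorem triRep_γ_mul_one : triRep hq u v (γ q * h) 1 j = 0 := by
  simp [triRep, Matrix.mul_apply, -Matrix.cons_mul]

theorem triRep_γ'_mul_zero : triRep hq u v (γ' q * h) 0 j = v * triRep hq u v h 1 j := by
  simp [triRep, Matrix.mul_apply, -Matrix.cons_mul]

theorem triRep_γ'_mul_one : triRep hq u v (γ' q * h) 1 j = 0 := by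
  simp [triRep, Matrix.mul_apply, -Matrix.cons_mul]

end triRep

/-- By triangularity the lower right entry is a character, and on the generators it is the counit.
-/
theorem triRep_spin_one (hq : (q : ℂ) ≠ 0) (u v : ℂ) (m i l : ℕ) :
    triRep hq u v (spin q m i l) 1 1 = if i = l ∧ i ≤ m then 1 else 0 := by
  induction m generalizing i l with
  | zero => rcases i with _ | i <;> rcases l with _ | l <;> simp
  | succ m ih =>
    rcases i with _ | i
    · rw [spin_succ_zero, map_add, map_smul, Matrix.add_apply, Matrix.smul_apply,
        triRep_γ_mul_one, triRep_α'_mul_one, ih]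
      rcases l with _ | l <;> simp
    · rw [spin_succ_succ, map_sub, map_smul, Matrix.sub_apply, Matrix.smul_apply,
        triRep_α_mul_one, triRep_γ'_mul_one]
      rcases l with _ | l
      · simp
      · rw [delay_succ, ih]; simp

/-- The upper right entry of a triangular representation is a twisted derivation, determined by its
values `u`, `v` on `γ`, `γ^*`. The choices `(u, v) = (1, 0)` and `(0, 1)` serve as raising and
lowering operators, which is why only the two neighbouring diagonals survive. -/
theorem triRep_spin (hq : (q : ℂ) ≠ 0) (u v : ℂ) (m i l : ℕ) :
    triRep hq u v (spin q m i l) 0 1 =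
      (if l = i + 1 then u * raiseCoeff q m i else 0) -
        if i = l + 1 then v * lowerCoeff q m i else 0 := by
  induction m generalizing i l with
  | zero => rcases i with _ | i <;> rcases l with _ | l <;> simp [raiseCoeff, lowerCoeff]
  | succ m ih =>
    have h1 := triRep_spin_one hq u v m
    rcases i with _ | i
    · rw [spin_succ_zero, map_add, map_smul, Matrix.add_apply, Matrix.smul_apply,
        triRep_γ_mul_zero, triRep_α'_mul_zero, ih, smul_eq_mul]
      rcases l with _ | l
      · simp
      · rw [delay_succ, h1]
        rcases l with _ | l
        · simp [raiseCoeff]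
          ring
        · simp
    · rw [spin_succ_succ, map_sub, map_smul, Matrix.sub_apply, Matrix.smul_apply,
        triRep_α_mul_zero, triRep_γ'_mul_zero, h1, smul_eq_mul]
      rcases l with _ | l
      · rcases i with _ | i
        · cases m <;> simp [lowerCoeff] <;> ring
        · simp
      · rw [delay_succ, ih]
        by_cases h2 : l = i + 1
        · subst h2
          have h3 : ¬ i = i + 1 + 1 := by omega
          simp [raiseCoeff, h3]
          ring
        · by_cases h3 : i = l + 1
          · subst h3
            have h4 : ¬ l = l + 1 + 1 := by omega
            simp [lowerCoeff, h2]
            split_ifs <;> simp <;> ring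
          · have h4 : ¬ i + 1 = l + 1 + 1 := by omega
            simp [h2, h3]

/-! ### Matrix corepresentations and the Clebsch–Gordan decomposition -/

/-- `t` is the matrix of a corepresentation. -/
structure IsCorep {ι : Type*} [Fintype ι] [DecidableEq ι] (t : Matrix ι ι (OSU q)) : Prop where
  comul_apply : ∀ i j, comul q (t i j) = ∑ k, t i k ⊗ₜ t k j
  counit_apply : ∀ i j, counit q (t i j) = if i = j then 1 else 0

/-- The scalar matrix `P` intertwines `t` and `s`, i.e. `t P = P s`. -/
def Intertwines {ι κ : Type*} [Fintype ι] [Fintype κ] (t : Matrix ι ι (OSU q))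
    (s : Matrix κ κ (OSU q)) (P : Matrix ι κ ℂ) : Prop :=
  ∀ i l, ∑ j, P j l • t i j = ∑ k, P i k • s k l

variable (q) in
/-- The matrix of the corepresentation of dimension `m + 1`. -/
def spinMat (m : ℕ) : Matrix (Fin (m + 1)) (Fin (m + 1)) (OSU q) := fun i j => spin q m i j

theorem isCorep_spinMat (hq : (q : ℂ) ≠ 0) (m : ℕ) : IsCorep (spinMat q m) where
  comul_apply i j := by
    rw [spinMat, comul_spin hq (by omega),
      ← Fin.sum_univ_eq_sum_range fun k => spin q m i k ⊗ₜ[ℂ] spin q m k j]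
    rfl
  counit_apply i j := by
    rw [spinMat, counit_spin (by omega)]
    simp [Fin.ext_iff]

/-- The tensor product of two matrix corepresentations. -/
def tensorMat {ι κ : Type*} (t : Matrix ι ι (OSU q)) (s : Matrix κ κ (OSU q)) :
    Matrix (ι × κ) (ι × κ) (OSU q) := fun a b => t a.1 b.1 * s a.2 b.2

@[simp] theorem spin_one_zero_zero : spin q 1 0 0 = α' q := by simp [spin_succ_zero]
@[simp] theorem spin_one_zero_one : spin q 1 0 1 = γ q := by simp [spin_succ_zero]
@[simp] theorem spin_one_one_zero : spin q 1 1 0 = -((q : ℂ) • γ' q) := by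
  simp [spin_succ_succ q 0 0]
@[simp] theorem spin_one_one_one : spin q 1 1 1 = α q := by simp [spin_succ_succ q 0 0]

section ClebschGordan

/-- The matrix of the multiplication map of the quantum plane. -/
def mulCoeff (q : ℝ) (k j l : ℕ) : ℂ :=
  if k = 0 then if l = j then (q : ℂ)⁻¹ ^ j else 0 else if l = j + 1 then 1 else 0

/-- The matrix of the contraction map. -/
def contractCoeff (q : ℝ) (m k j l : ℕ) : ℂ :=
  if k = 0 then if j = l + 1 then -((q : ℂ) * ((q : ℂ)⁻¹ ^ (2 * j) - 1)) else 0
  else if j = l then (q : ℂ) ^ j * (q : ℂ)⁻¹ ^ (2 * m + 2) - (q : ℂ)⁻¹ ^ j else 0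

theorem sum_ite_eq_succ_smul {M : Type*} [AddCommGroup M] [Module ℂ M] (f : ℕ → M)
    (c : ℕ → ℂ) {n l : ℕ} (h : l ≤ n) :
    ∑ j : Fin n, (if l = (j : ℕ) + 1 then c j else 0) • f j = delay (fun j => c j • f j) l := by
  rw [Fin.sum_univ_eq_sum_range fun j => (if l = j + 1 then c j else 0) • f j]
  rcases l with _ | l
  · simp
  · have : l < n := h
    simp [ite_smul, this]

theorem sum_ite_eq_smul {M : Type*} [AddCommGroup M] [Module ℂ M] (f : ℕ → M)
    (c : ℕ → ℂ) {n l : ℕ} (h : l < n ∨ f l = 0) :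
    ∑ j : Fin n, (if l = (j : ℕ) then c j else 0) • f j = c l • f l := by
  rw [Fin.sum_univ_eq_sum_range fun j => (if l = j then c j else 0) • f j]
  simp only [ite_smul, zero_smul, Finset.sum_ite_eq, Finset.mem_range]
  rcases h with h | h <;> simp [h]

/-- Multiplication in the quantum plane is a comodule map: for a left factor `y` this is
`spin_mul_y`, for a left factor `x` it is the recursion defining `spin`. -/
theorem intertwines_mulCoeff (hq : (q : ℂ) ≠ 0) (m : ℕ) :
    Intertwines (tensorMat (spinMat q 1) (spinMat q m)) (spinMat q (m + 1))
      fun a l => mulCoeff q a.1 a.2 l := by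
  rintro ⟨k, i⟩ l
  have hl := l.2
  have h0 : (l : ℕ) < m + 1 ∨ spin q m i l = 0 := by
    by_cases h : (l : ℕ) < m + 1
    · exact .inl h
    · exact .inr (spin_eq_zero_of_lt_right q (by omega) _)
  rw [Fintype.sum_prod_type, Fin.sum_univ_two]
  simp only [tensorMat, spinMat, mulCoeff, Fin.val_zero, Fin.val_one, if_true, one_ne_zero,
    if_false, ← mul_smul_comm, ← Finset.mul_sum]
  rw [sum_ite_eq_smul (spin q m i) (fun j => (q : ℂ)⁻¹ ^ j) h0,
    sum_ite_eq_succ_smul (spin q m i) (fun _ => 1) (by omega)]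
  simp only [one_smul]
  match k with
  | 0 =>
    simp only [Fin.val_zero, if_true, spin_one_zero_zero, spin_one_zero_one]
    simp only [eq_comm (b := (i : ℕ))]
    rw [sum_ite_eq_smul (fun k => spin q (m + 1) k l) (fun _ => (q : ℂ)⁻¹ ^ (i : ℕ))
        (.inl (by omega)), ← spin_mul_y hq (by omega), mul_smul_comm, add_comm]
  | 1 =>
    simp only [Fin.val_one, one_ne_zero, if_false, spin_one_one_zero, spin_one_one_one]
    simp only [eq_comm (b := (i : ℕ) + 1)]
    rw [sum_ite_eq_smul (fun k => spin q (m + 1) k l) (fun _ => (1 : ℂ)) (.inl (by omega)),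
      spin_succ_succ, one_smul]
    simp only [neg_mul, smul_mul_assoc, mul_smul_comm]
    module

theorem intertwines_contractCoeff (hq : (q : ℂ) ≠ 0) (m : ℕ) :
    Intertwines (tensorMat (spinMat q 1) (spinMat q (m + 1))) (spinMat q m)
      fun a l => contractCoeff q m a.1 a.2 l := by
  rintro ⟨k, i⟩ l
  have hl := l.2
  have hi := i.2
  obtain ⟨h1, h2⟩ := spin_contract hq (m := m) (i := i) (by omega) l
  rw [Fintype.sum_prod_type, Fin.sum_univ_two]
  simp only [tensorMat, spinMat, contractCoeff, Fin.val_zero, Fin.val_one, if_true, one_ne_zero,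
    if_false, ← mul_smul_comm, ← Finset.mul_sum]
  have e1 := sum_ite_eq_smul (spin q (m + 1) i)
    (fun j => -((q : ℂ) * ((q : ℂ)⁻¹ ^ (2 * j) - 1))) (n := m + 2) (l := l + 1) (.inl (by omega))
  have e2 := sum_ite_eq_smul (spin q (m + 1) i)
    (fun j => (q : ℂ) ^ j * (q : ℂ)⁻¹ ^ (2 * m + 2) - (q : ℂ)⁻¹ ^ j) (n := m + 2) (l := l)
      (.inl (by omega))
  simp only [eq_comm (a := (l : ℕ) + 1), eq_comm (a := (l : ℕ))] at e1 e2
  rw [e1, e2]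
  match k with
  | 0 =>
    simp only [Fin.val_zero, if_true, spin_one_zero_zero, spin_one_zero_one]
    rw [sum_ite_eq_succ_smul (fun j => spin q m j l)
      (fun _ => -((q : ℂ) * ((q : ℂ)⁻¹ ^ (2 * (i : ℕ)) - 1))) (by omega)]
    have : delay (fun j => -((q : ℂ) * ((q : ℂ)⁻¹ ^ (2 * (i : ℕ)) - 1)) • spin q m j l) i =
        -((q : ℂ) * ((q : ℂ)⁻¹ ^ (2 * (i : ℕ)) - 1)) • delay (fun j => spin q m j l) i := by
      cases (i : ℕ) <;> simp
    rw [this, ← h2, mul_smul_comm, mul_smul_comm, neg_smul]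
    abel
  | 1 =>
    simp only [Fin.val_one, one_ne_zero, if_false, spin_one_one_zero, spin_one_one_one]
    rw [sum_ite_eq_smul (fun j => spin q m j l)
      (fun _ => (q : ℂ) ^ (i : ℕ) * (q : ℂ)⁻¹ ^ (2 * m + 2) - (q : ℂ)⁻¹ ^ (i : ℕ)), ← h1]
    · simp only [neg_mul, smul_mul_assoc, mul_smul_comm]
      module
    · by_cases h : (i : ℕ) < m + 1
      · exact .inl h
      · exact .inr (spin_eq_zero_of_lt_left q (by omega) _)

theorem sum_ite_val_eq_mul {n : ℕ} (f : Fin n → ℂ) (c : ℂ) {a : ℕ} (h : a < n) :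
    ∑ l : Fin n, (if (l : ℕ) = a then c else 0) * f l = c * f ⟨a, h⟩ := by
  rw [Finset.sum_eq_single ⟨a, h⟩ (fun b _ hb => ?_) (by simp), if_pos rfl]
  rw [if_neg (by simpa [Fin.ext_iff] using hb), zero_mul]

theorem pow_inv_sub_one_ne_zero (hq : q ∈ Set.Ioo (0 : ℝ) 1) {n : ℕ} (hn : n ≠ 0) :
    (q : ℂ)⁻¹ ^ n - 1 ≠ 0 := by
  rw [sub_ne_zero]
  have := (one_lt_pow₀ (one_lt_inv_iff₀.2 hq) hn).ne'
  exact_mod_cast this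

/-- The decomposition `V_1 ⊗ V_(m + 1) ≅ V_(m + 2) ⊕ V_m`. -/
theorem clebschGordan (hq : q ∈ Set.Ioo (0 : ℝ) 1) (m : ℕ) :
    ∃ (P : Matrix (Fin 2 × Fin (m + 2)) (Fin (m + 3) ⊕ Fin (m + 1)) ℂ)
      (P' : Matrix (Fin (m + 3) ⊕ Fin (m + 1)) (Fin 2 × Fin (m + 2)) ℂ),
      P * P' = 1 ∧ P' * P = 1 ∧
      Intertwines (tensorMat (spinMat q 1) (spinMat q (m + 1)))
        (Matrix.fromBlocks (spinMat q (m + 2)) 0 0 (spinMat q m)) P := by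
  have h0 : (q : ℂ) ≠ 0 := by exact_mod_cast hq.1.ne'
  -- The scalar by which multiplication composed with the section of `spin_section` acts on
  -- `V_(m+2)`; it is nonzero because `0 < q < 1`.
  set D : ℂ := (q : ℂ)⁻¹ ^ (2 * m + 4) - 1 with hD
  have hD0 : D ≠ 0 := pow_inv_sub_one_ne_zero hq (by omega)
  let P : Matrix (Fin 2 × Fin (m + 2)) (Fin (m + 3) ⊕ Fin (m + 1)) ℂ := fun a =>
    Sum.elim (fun l => mulCoeff q a.1 a.2 l) (fun l => contractCoeff q m a.1 a.2 l)
  -- The first block is the section of `spin_section` divided by `D`. The second sends `e_l` to a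
  -- multiple of `q^(-l) x ⊗ e_l - q y ⊗ e_(l+1)`, which multiplication kills, scaled so that
  -- contraction returns `e_l`.
  let P' : Matrix (Fin (m + 3) ⊕ Fin (m + 1)) (Fin 2 × Fin (m + 2)) ℂ :=
    Sum.elim
      (fun l a => if a.1 = 0 then
          if (l : ℕ) = a.2 then
            ((q : ℂ) ^ (l : ℕ) * (q : ℂ)⁻¹ ^ (2 * m + 4) - (q : ℂ)⁻¹ ^ (l : ℕ)) / D else 0
        else if (l : ℕ) = a.2 + 1 then ((q : ℂ)⁻¹ ^ (2 * (l : ℕ)) - 1) / D else 0)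
      (fun l a => if a.1 = 0 then if (a.2 : ℕ) = l + 1 then -(q : ℂ) / (q ^ 2 * D) else 0
        else if (a.2 : ℕ) = l then (q : ℂ)⁻¹ ^ (l : ℕ) / (q ^ 2 * D) else 0)
  have hPP : P * P' = 1 := by
    ext ⟨k, j⟩ ⟨k', j'⟩
    have hj := j.2
    have hj' := j'.2
    have e1 : ∑ l : Fin (m + 3), P (k, j) (Sum.inl l) * P' (Sum.inl l) (k', j') =
        if k = 0 then (q : ℂ)⁻¹ ^ (j : ℕ) * P' (Sum.inl ⟨j, by omega⟩) (k', j')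
        else P' (Sum.inl ⟨j + 1, by omega⟩) (k', j') := by
      simp only [P, Sum.elim_inl, mulCoeff]
      match k with
      | 0 =>
        simp only [Fin.val_zero, if_true]
        exact sum_ite_val_eq_mul _ _ _
      | 1 =>
        simp only [Fin.val_one, one_ne_zero, if_false]
        rw [sum_ite_val_eq_mul _ _ (by omega), one_mul]
    -- The contraction vanishes on `y ⊗ e_0` and on `x ⊗ e_(m+1)`; these are the two exceptional
    -- cases.
    have e2 : ∑ l : Fin (m + 1), P (k, j) (Sum.inr l) * P' (Sum.inr l) (k', j') =
        if k = 0 then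
          if h : (j : ℕ) ≠ 0 then -((q : ℂ) * ((q : ℂ)⁻¹ ^ (2 * (j : ℕ)) - 1)) *
            P' (Sum.inr ⟨j - 1, by omega⟩) (k', j') else 0
        else if h : (j : ℕ) < m + 1 then
          ((q : ℂ) ^ (j : ℕ) * (q : ℂ)⁻¹ ^ (2 * m + 2) - (q : ℂ)⁻¹ ^ (j : ℕ)) *
            P' (Sum.inr ⟨j, h⟩) (k', j') else 0 := by
      simp only [P, Sum.elim_inr, contractCoeff]
      match k with
      | 0 =>
        simp only [Fin.val_zero, if_true]
        split_ifs with h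
        · have (l : Fin (m + 1)) : (j : ℕ) = l + 1 ↔ (l : ℕ) = j - 1 := by omega
          simp only [this]
          exact sum_ite_val_eq_mul _ _ _
        · refine Finset.sum_eq_zero fun l _ => ?_
          rw [if_neg (by omega), zero_mul]
      | 1 =>
        simp only [Fin.val_one, one_ne_zero, if_false, eq_comm (a := (j : ℕ))]
        split_ifs with h
        · exact sum_ite_val_eq_mul _ _ _
        · refine Finset.sum_eq_zero fun l _ => ?_
          rw [if_neg (by omega), zero_mul]
    rw [Matrix.mul_apply, Fintype.sum_sum_type, e1, e2]
    obtain ⟨j, hj⟩ := j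
    obtain ⟨j', hj'⟩ := j'
    have hD' : D = ((q : ℂ) ^ (2 * m + 4))⁻¹ - 1 := by rw [hD, inv_pow]
    clear_value D
    match k, k' with
    | 0, 0 =>
      simp only [P', Matrix.one_apply]
      rcases j with _ | j
      · by_cases h : 0 = j'
        · subst h
          simp [← hD', hD0]
        · simp [h, Ne.symm h]
      · by_cases h : j + 1 = j'
        · subst h
          simp
          field_simp
          rw [hD']
          field_simp
          ring
        · simp [h, Ne.symm h]
    | 0, 1 =>
      simp only [P', Matrix.one_apply]
      rcases j with _ | j
      · simp
      · by_cases h : j = j'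
        · subst h
          simp
          field_simp
          ring
        · simp [h, Ne.symm h]
    | 1, 0 =>
      simp only [P', Matrix.one_apply]
      by_cases h : j + 1 = j'
      · subst h
        have h' : j < m + 1 := by omega
        simp [h', Nat.lt_succ_iff.1 h']
        field_simp
        ring
      · simp [h, Ne.symm h]
    | 1, 1 =>
      simp only [P', Matrix.one_apply]
      by_cases h : j = j'
      · subst h
        by_cases h' : j < m + 1
        · simp [h', Nat.lt_succ_iff.1 h']
          field_simp
          rw [hD']
          field_simp
          ring
        · obtain rfl : j = m + 1 := by omega
          simp
          field_simp
          rw [hD']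
          field_simp
          ring
      · simp [h, Ne.symm h]
  -- The dimensions agree, `2(m + 2) = (m + 3) + (m + 1)`, so a one-sided inverse is two-sided.
  refine ⟨P, P', hPP, (Matrix.mul_eq_one_comm_of_card_eq _ _ _ ?_).1 hPP, ?_⟩
  · simp; omega
  · rintro a (l | l)
    · simpa [P] using intertwines_mulCoeff h0 (m + 1) a l
    · simpa [P] using intertwines_contractCoeff h0 m a l

end ClebschGordan
end OSU

/-! ### Slices of corepresentations -/

section Slice

variable {H V W : Type*} [AddCommGroup H] [Module ℂ H] [AddCommGroup V] [Module ℂ V]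
  [AddCommGroup W] [Module ℂ W]

/-- `φ ⊗ id : H ⊗ V → V`. -/
def sliceMap (V : Type*) [AddCommGroup V] [Module ℂ V] (φ : Module.Dual ℂ H) : H ⊗[ℂ] V →ₗ[ℂ] V :=
  (TensorProduct.lid ℂ V).toLinearMap ∘ₗ φ.rTensor V

@[simp] theorem sliceMap_tmul (φ : Module.Dual ℂ H) (h : H) (v : V) :
    sliceMap V φ (h ⊗ₜ v) = φ h • v := by simp [sliceMap]

theorem sliceMap_lTensor (φ : Module.Dual ℂ H) (f : V →ₗ[ℂ] W) (x : H ⊗[ℂ] V) :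
    sliceMap W φ (f.lTensor H x) = f (sliceMap V φ x) := by
  induction x with
  | zero => simp
  | tmul h v => simp
  | add x y hx hy => simp [hx, hy]

theorem eq_zero_of_sliceMap_eq_zero {x : H ⊗[ℂ] V} (h : ∀ φ, sliceMap V φ x = 0) : x = 0 := by
  let b := Module.Free.chooseBasis ℂ H
  apply (TensorProduct.equivFinsuppOfBasisLeft b (N := V)).injective
  rw [map_zero]
  ext i
  have : ∀ y : H ⊗[ℂ] V, TensorProduct.equivFinsuppOfBasisLeft b y i = sliceMap V (b.coord i) y := by
    intro y
    induction y with
    | zero => simp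
    | tmul h v => simp [TensorProduct.equivFinsuppOfBasisLeft_apply_tmul_apply]
    | add x y hx hy => simp [hx, hy]
  rw [this, h, Finsupp.zero_apply]

theorem eq_of_sliceMap_eq {x y : H ⊗[ℂ] V} (h : ∀ φ, sliceMap V φ x = sliceMap V φ y) : x = y :=
  sub_eq_zero.1 <| eq_zero_of_sliceMap_eq_zero fun φ => by rw [map_sub, h, sub_self]

/-- Tensoring over a field is exact, so `H ⊗ K` is the kernel of `H ⊗ V → H ⊗ V/K`, and slices
detect vanishing. This identifies subspaces stable under slices with subcomodules. -/
theorem mem_range_lTensor_subtype {K : Submodule ℂ V} {x : H ⊗[ℂ] V}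
    (h : ∀ φ, sliceMap V φ x ∈ K) : x ∈ LinearMap.range (K.subtype.lTensor H) := by
  have := lTensor_exact H (LinearMap.exact_subtype_mkQ K) (Submodule.mkQ_surjective K)
  rw [← this.linearMap_ker_eq, LinearMap.mem_ker]
  refine eq_zero_of_sliceMap_eq_zero fun φ => ?_
  rw [sliceMap_lTensor, Submodule.mkQ_apply, Submodule.Quotient.mk_eq_zero]
  exact h φ

end Slice

namespace OSU

variable {q : ℝ}

/-- The left slices `h ↦ φ(h₁) h₂`. -/
def slice (φ : Module.Dual ℂ (OSU q)) : Module.End ℂ (OSU q) :=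
  sliceMap (OSU q) φ ∘ₗ (comul q).toLinearMap

variable (q) in
/-- The algebra of operators generated by the left slices; its invariant subspaces are the left
subcomodules. -/
def SliceAlg : Type := Algebra.adjoin ℂ (Set.range (slice (q := q)))

instance : Ring (SliceAlg q) := inferInstanceAs (Ring (Algebra.adjoin ℂ (Set.range slice)))

instance : Algebra ℂ (SliceAlg q) :=
  inferInstanceAs (Algebra ℂ (Algebra.adjoin ℂ (Set.range slice)))

instance : Module (SliceAlg q) (OSU q) :=
  inferInstanceAs (Module (Algebra.adjoin ℂ (Set.range slice)) (OSU q))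

instance : IsScalarTower ℂ (SliceAlg q) (OSU q) :=
  inferInstanceAs (IsScalarTower ℂ (Algebra.adjoin ℂ (Set.range slice)) (OSU q))

/-- A slice as an element of the algebra of slices. -/
def SliceAlg.of (φ : Module.Dual ℂ (OSU q)) : SliceAlg q :=
  ⟨slice φ, Algebra.subset_adjoin ⟨φ, rfl⟩⟩

theorem slice_mem (N : Submodule (SliceAlg q) (OSU q)) (φ : Module.Dual ℂ (OSU q)) {x : OSU q}
    (hx : x ∈ N) : slice φ x ∈ N :=
  N.smul_mem (SliceAlg.of φ) hx

/-- A subspace that is invariant under the slices, as a submodule. -/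
def subOfSlice (W : Submodule ℂ (OSU q)) (h : ∀ φ, ∀ w ∈ W, slice φ w ∈ W) :
    Submodule (SliceAlg q) (OSU q) where
  __ := W
  smul_mem' := by
    rintro ⟨f, hf⟩ w hw
    change f w ∈ W
    induction hf using Algebra.adjoin_induction generalizing w with
    | mem f hf => obtain ⟨φ, rfl⟩ := hf; exact h φ w hw
    | algebraMap r => exact W.smul_mem r hw
    | add f g _ _ hf hg => exact W.add_mem (hf hw) (hg hw)
    | mul f g _ _ hf hg => exact hf (hg hw)

theorem mem_subOfSlice {W : Submodule ℂ (OSU q)} {h : ∀ φ, ∀ w ∈ W, slice φ w ∈ W} {x : OSU q} :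
    x ∈ subOfSlice W h ↔ x ∈ W := Iff.rfl

/-- The vector `h` with entries in `O(SU_q(2))` transforms under the left coaction by `t`. -/
def LeftCovariant {ι : Type*} [Fintype ι] (t : Matrix ι ι (OSU q)) (h : ι → OSU q) : Prop :=
  ∀ i, comul q (h i) = ∑ j, t i j ⊗ₜ h j

/-! ### Covariant vectors and their behaviour under products and intertwiners. -/

section LeftCovariant

variable {ι κ : Type*} [Fintype ι] [Fintype κ] {t : Matrix ι ι (OSU q)} {h : ι → OSU q}

theorem LeftCovariant.slice (ht : LeftCovariant t h) (φ : Module.Dual ℂ (OSU q)) (i : ι) :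
    slice φ (h i) = ∑ j, φ (t i j) • h j := by
  simp [OSU.slice, ht i]

/-- The subcomodule spanned by the entries of `h`. -/
def LeftCovariant.span (ht : LeftCovariant t h) : Submodule (SliceAlg q) (OSU q) :=
  subOfSlice (Submodule.span ℂ (Set.range h)) fun φ w hw => by
    induction hw using Submodule.span_induction with
    | mem x hx =>
      obtain ⟨i, rfl⟩ := hx
      rw [ht.slice]
      exact Submodule.sum_mem _ fun j _ => Submodule.smul_mem _ _ (Submodule.subset_span ⟨j, rfl⟩)
    | zero => simp
    | add x y _ _ hx hy => rw [map_add]; exact Submodule.add_mem _ hx hy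
    | smul c x _ hx => rw [map_smul]; exact Submodule.smul_mem _ _ hx

theorem LeftCovariant.mem_span (ht : LeftCovariant t h) (i : ι) : h i ∈ ht.span :=
  mem_subOfSlice.2 (Submodule.subset_span ⟨i, rfl⟩)

theorem LeftCovariant.mul {s : Matrix κ κ (OSU q)} {g : κ → OSU q} (hs : LeftCovariant s g)
    (ht : LeftCovariant t h) :
    LeftCovariant (tensorMat s t) fun a => g a.1 * h a.2 := by
  rintro ⟨k, i⟩
  simp only [map_mul, hs k, ht i, Finset.sum_mul_sum, Algebra.TensorProduct.tmul_mul_tmul,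
    tensorMat, Fintype.sum_prod_type]

theorem Intertwines.symm [DecidableEq ι] [DecidableEq κ] {s : Matrix κ κ (OSU q)}
    {P : Matrix ι κ ℂ} {P' : Matrix κ ι ℂ} (h : Intertwines t s P) (h1 : P * P' = 1)
    (h2 : P' * P = 1) : Intertwines s t P' := by
  intro i l
  calc ∑ j, P' j l • s i j = ∑ j, P' j l • ∑ a, P' i a • ∑ k, P a k • s k j := by
        refine Finset.sum_congr rfl fun j _ => ?_
        have : ∑ a, P' i a • ∑ k, P a k • s k j = ∑ k, (P' * P) i k • s k j := by
          simp only [Finset.smul_sum, smul_smul, Matrix.mul_apply, Finset.sum_smul]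
          exact Finset.sum_comm
        rw [this, h2]
        simp [Matrix.one_apply]
    _ = ∑ j, P' j l • ∑ a, P' i a • ∑ k, P k j • t a k := by simp only [h _ _]
    _ = ∑ a, P' i a • ∑ k, (P * P') k l • t a k := by
        simp only [Finset.smul_sum, smul_smul, Matrix.mul_apply, Finset.sum_smul]
        rw [Finset.sum_comm]
        refine Finset.sum_congr rfl fun a _ => ?_
        rw [Finset.sum_comm]
        exact Finset.sum_congr rfl fun k _ => Finset.sum_congr rfl fun j _ => by ring_nf
    _ = _ := by
        rw [h1]
        simp [Matrix.one_apply]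

theorem LeftCovariant.mulVec {s : Matrix κ κ (OSU q)} {P : Matrix κ ι ℂ}
    (hP : Intertwines s t P) (ht : LeftCovariant t h) :
    LeftCovariant s fun k => ∑ i, P k i • h i := by
  intro k
  calc comul q (∑ i, P k i • h i) = ∑ i, P k i • ∑ j, t i j ⊗ₜ h j := by simp [ht _]
    _ = ∑ j, (∑ i, P k i • t i j) ⊗ₜ h j := by
        simp only [TensorProduct.sum_tmul, ← TensorProduct.smul_tmul', Finset.smul_sum]
        exact Finset.sum_comm
    _ = ∑ j, (∑ l, P l j • s k l) ⊗ₜ h j := by simp only [hP _ _]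
    _ = _ := by
        simp only [TensorProduct.sum_tmul, TensorProduct.tmul_sum, TensorProduct.tmul_smul,
          ← TensorProduct.smul_tmul']
        exact Finset.sum_comm

theorem LeftCovariant.of_fromBlocks {s : Matrix κ κ (OSU q)} {g : ι ⊕ κ → OSU q}
    (hg : LeftCovariant (Matrix.fromBlocks t 0 0 s) g) :
    LeftCovariant t (fun i => g (.inl i)) ∧ LeftCovariant s fun i => g (.inr i) :=
  ⟨fun i => by rw [hg]; simp, fun i => by rw [hg]; simp⟩

end LeftCovariant

/-! ### Simplicity of the spin corepresentations -/

/-- The ladder operators on a spin comodule. Continuing `h` by zero past `m` accounts for the end of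
the ladder. -/
theorem LeftCovariant.slice_triRep (hq : (q : ℂ) ≠ 0) {m : ℕ} {h : ℕ → OSU q}
    (h0 : ∀ i, m < i → h i = 0)
    (ht : LeftCovariant (spinMat q m) fun i => h i) (u v : ℂ) (i : ℕ) (hi : i ≤ m) :
    OSU.slice ((Matrix.entryLinearMap ℂ ℂ 0 1) ∘ₗ (triRep hq u v).toLinearMap) (h i) =
      (u * raiseCoeff q m i) • h (i + 1) - (v * lowerCoeff q m i) • (delay h i) := by
  have := ht.slice ((Matrix.entryLinearMap ℂ ℂ 0 1) ∘ₗ (triRep hq u v).toLinearMap)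
    ⟨i, Nat.lt_succ_of_le hi⟩
  simp only [LinearMap.comp_apply, AlgHom.toLinearMap_apply, Matrix.entryLinearMap_apply, spinMat,
    triRep_spin, sub_smul, Finset.sum_sub_distrib] at this
  rw [this]
  congr 1
  · have e := sum_ite_eq_smul h (fun j => u * raiseCoeff q m i) (n := m + 1) (l := i + 1) ?_
    · simpa only [eq_comm (a := i + 1)] using e
    · rcases hi.lt_or_eq with h | rfl
      · exact .inl (by omega)
      · exact .inr (h0 _ (by omega))
  · rw [sum_ite_eq_succ_smul h (fun j => v * lowerCoeff q m i) (n := m + 1) (l := i) (by omega)]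
    cases i <;> simp

/-- If `k` is the lowest index in a combination, raising it `m - k` times pushes every other term
past the top and leaves a nonzero multiple of `h m`. -/
theorem LeftCovariant.top_mem (hq : 0 < q) {m : ℕ} {h : ℕ → OSU q}
    (h0 : ∀ i, m < i → h i = 0) (ht : LeftCovariant (spinMat q m) fun i => h i)
    (N : Submodule (SliceAlg q) (OSU q)) {k : ℕ} (hk : k ≤ m) (c : ℕ → ℂ)
    (hc : ∀ i < k, c i = 0) (hck : c k ≠ 0)
    (hN : ∑ i ∈ Finset.range (m + 1), c i • h i ∈ N) : h m ∈ N := by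
  have hq0 : (q : ℂ) ≠ 0 := by exact_mod_cast hq.ne'
  induction hk using Nat.decreasingInduction generalizing c with
  | self =>
    rw [Finset.sum_eq_single m (fun i hi hne => ?_) (by simp)] at hN
    · have := (N.restrictScalars ℂ).smul_mem (c m)⁻¹ hN
      rwa [smul_smul, inv_mul_cancel₀ hck, one_smul] at this
    · rw [hc i (by have := Finset.mem_range.1 hi; omega), zero_smul]
  | of_succ k hk ih =>
    -- The coefficients after one application of the raising operator; the term of `h m` is lost
    -- because `h (m + 1) = 0`.
    refine ih (delay fun i => c i * raiseCoeff q m i) ?_ ?_ ?_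
    · rintro (_ | i) hi
      · rfl
      · simp [hc i (by omega)]
    · simpa [hck] using (raiseCoeff_pos hq hk).ne'
    · have := slice_mem N ((Matrix.entryLinearMap ℂ ℂ 0 1) ∘ₗ
        (triRep hq0 1 0).toLinearMap) hN
      convert this using 1
      rw [map_sum, Finset.sum_range_succ', Finset.sum_range_succ, map_smul,
        ht.slice_triRep hq0 h0 1 0 m le_rfl, h0 (m + 1) (by omega)]
      simp only [delay_zero, zero_smul, add_zero, smul_zero, delay_succ, zero_mul, sub_zero]
      refine Finset.sum_congr rfl fun i hi => ?_
      rw [map_smul, ht.slice_triRep hq0 h0 1 0 i (Finset.mem_range.1 hi).le]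
      simp [smul_smul, -Complex.coe_smul]

/-- The lowering operator has nonzero coefficients on `h 1, …, h m`, so it recovers all vectors from
the top one. -/
theorem LeftCovariant.mem_of_top_mem (hq : 0 < q) {m : ℕ} {h : ℕ → OSU q}
    (h0 : ∀ i, m < i → h i = 0) (ht : LeftCovariant (spinMat q m) fun i => h i)
    (N : Submodule (SliceAlg q) (OSU q)) (hN : h m ∈ N) {i : ℕ} (hi : i ≤ m) : h i ∈ N := by
  have hq0 : (q : ℂ) ≠ 0 := by exact_mod_cast hq.ne'
  induction hi using Nat.decreasingInduction with
  | self => exact hN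
  | of_succ i hi ih =>
    have := slice_mem N ((Matrix.entryLinearMap ℂ ℂ 0 1) ∘ₗ (triRep hq0 0 1).toLinearMap) ih
    rw [ht.slice_triRep hq0 h0 0 1 (i + 1) hi] at this
    obtain ⟨m, rfl⟩ := Nat.exists_eq_succ_of_ne_zero (Nat.ne_zero_of_lt hi)
    have hp := lowerCoeff_pos hq (show i ≤ m by omega)
    have hp' : (lowerCoeff q (m + 1) (i + 1) : ℂ) ≠ 0 := by exact_mod_cast hp.ne'
    have := (N.restrictScalars ℂ).smul_mem (-(lowerCoeff q (m + 1) (i + 1) : ℂ)⁻¹) this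
    simpa [smul_smul, hp', -Complex.coe_smul] using this

/-- A family of vectors such that each nonzero linear combination of its members generates the
whole family. -/
def IsCyclic {ι : Type*} [Fintype ι] (h : ι → OSU q) : Prop :=
  ∀ (N : Submodule (SliceAlg q) (OSU q)) (c : ι → ℂ), c ≠ 0 → ∑ i, c i • h i ∈ N → ∀ i, h i ∈ N

/-- From the lowest nonzero coefficient one climbs to the top of the ladder and then descends to
every vector. -/
theorem LeftCovariant.isCyclic (hq : 0 < q) {m : ℕ} {h : Fin (m + 1) → OSU q}
    (ht : LeftCovariant (spinMat q m) h) : IsCyclic h := by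
  intro N c hc hN i
  let h' : ℕ → OSU q := fun i => if hi : i < m + 1 then h ⟨i, hi⟩ else 0
  let c' : ℕ → ℂ := fun i => if hi : i < m + 1 then c ⟨i, hi⟩ else 0
  have hh : ∀ i : Fin (m + 1), h' i = h i := fun i => dif_pos i.2
  have hcc : ∀ i : Fin (m + 1), c' i = c i := fun i => dif_pos i.2
  have h0 : ∀ i, m < i → h' i = 0 := fun i hi => dif_neg (by omega)
  have ht' : LeftCovariant (spinMat q m) fun i => h' i := by simpa only [hh] using ht
  have hN' : ∑ i ∈ Finset.range (m + 1), c' i • h' i ∈ N := by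
    rw [← Fin.sum_univ_eq_sum_range fun i => c' i • h' i]
    simpa only [hh, hcc] using hN
  have hex : ∃ k, c' k ≠ 0 := by
    obtain ⟨k, hk⟩ := Function.ne_iff.1 hc
    exact ⟨k, by rw [hcc]; exact hk⟩
  classical
  have hk : Nat.find hex ≤ m := by
    by_contra! hlt
    exact Nat.find_spec hex (dif_neg (by omega))
  rw [← hh]
  refine ht'.mem_of_top_mem hq h0 N (ht'.top_mem hq h0 N hk c' (fun i hi => ?_)
    (Nat.find_spec hex) hN') (Nat.lt_succ_iff.1 i.2)
  simpa using Nat.find_min hex hi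

section Cyclic

variable {ι : Type*} [Fintype ι] {t : Matrix ι ι (OSU q)} {h : ι → OSU q}

/-- A nontrivial relation would be a combination lying in the zero submodule, which by cyclicity
forces `h = 0`. -/
theorem IsCyclic.linearIndependent (hc : IsCyclic h) (h0 : h ≠ 0) : LinearIndependent ℂ h := by
  rw [Fintype.linearIndependent_iff]
  intro c hsum
  by_contra! hne
  obtain ⟨i, hi⟩ := hne
  refine h0 (funext fun j => ?_)
  have := hc ⊥ c (fun h => hi (congrFun h i)) (by rw [hsum]; exact Submodule.zero_mem _) j
  simpa using this

theorem LeftCovariant.isSimpleModule_span (ht : LeftCovariant t h) (hc : IsCyclic h) (h0 : h ≠ 0) :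
    IsSimpleModule (SliceAlg q) ht.span := by
  rw [isSimpleModule_iff_isAtom]
  refine ⟨fun hbot => h0 (funext fun i => ?_), fun N hN => ?_⟩
  · have := ht.mem_span i
    rw [hbot] at this
    simpa using this
  · rw [Submodule.eq_bot_iff]
    intro x hx
    by_contra hx0
    obtain ⟨c, rfl⟩ := (Submodule.mem_span_range_iff_exists_fun ℂ).1
      (mem_subOfSlice.1 (hN.le hx))
    have hall := hc N c (by rintro rfl; simp at hx0) hx
    refine hN.not_ge fun y hy => ?_
    have hle : Submodule.span ℂ (Set.range h) ≤ N.restrictScalars ℂ :=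
      Submodule.span_le.2 (by rintro _ ⟨i, rfl⟩; exact hall i)
    exact hle (mem_subOfSlice.1 hy)

end Cyclic

/-! ### Peter–Weyl decomposition -/

variable (q) in
/-- The sum of all spin subcomodules. -/
def spinSum : Submodule (SliceAlg q) (OSU q) :=
  sSup {S | ∃ (m : ℕ) (h : Fin (m + 1) → OSU q) (ht : LeftCovariant (spinMat q m) h),
    h ≠ 0 ∧ S = ht.span}

theorem LeftCovariant.mem_spinSum {m : ℕ} {h : Fin (m + 1) → OSU q}
    (ht : LeftCovariant (spinMat q m) h) (i : Fin (m + 1)) : h i ∈ spinSum q := by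
  by_cases h0 : h = 0
  · rw [h0]; exact Submodule.zero_mem _
  · exact (le_sSup (by exact ⟨m, h, ht, h0, rfl⟩) : ht.span ≤ spinSum q) (ht.mem_span i)

theorem spinMat_zero : spinMat q 0 = 1 := by
  ext i j
  obtain rfl : i = 0 := Fin.eq_zero i
  obtain rfl : j = 0 := Fin.eq_zero j
  simp [spinMat]

/-- By Clebsch–Gordan, the products of a spin `V_1` family with a spin `V_(m+1)` family are
combinations of entries covariant under `V_(m+2)` and under `V_m`. -/
theorem mul_mem_spinSum (hq : q ∈ Set.Ioo (0 : ℝ) 1) {g : Fin 2 → OSU q}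
    (hg : LeftCovariant (spinMat q 1) g) (k : Fin 2) {x : OSU q} (hx : x ∈ spinSum q) :
    g k * x ∈ spinSum q := by
  have hq0 : (q : ℂ) ≠ 0 := by exact_mod_cast hq.1.ne'
  have key : ∀ (m : ℕ) (h : Fin (m + 1) → OSU q), LeftCovariant (spinMat q m) h → ∀ i,
      g k * h i ∈ spinSum q := by
    rintro (_ | m) h ht i
    -- The case `V_1 ⊗ V_0 = V_1`, not covered by `clebschGordan`: `h i` is coinvariant.
    · have : LeftCovariant (spinMat q 1) fun k => g k * h i := by
        intro k
        have h1 : comul q (h i) = 1 ⊗ₜ h i := by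
          obtain rfl : i = 0 := Fin.eq_zero i
          rw [ht 0, spinMat_zero]
          exact (Fin.sum_univ_one _).trans (by simp)
        simp only [map_mul, hg k, h1, Finset.sum_mul, Algebra.TensorProduct.tmul_mul_tmul, mul_one]
      exact this.mem_spinSum k
    · obtain ⟨P, P', h1, h2, h3⟩ := clebschGordan hq m
      have hP := ((hg.mul ht).mulVec (h3.symm h1 h2)).of_fromBlocks
      set f := fun l => ∑ a, P' l a • (g a.1 * h a.2) with hf
      have hgh : g k * h i = ∑ l, P (k, i) l • f l := by
        simp only [hf, Finset.smul_sum, smul_smul]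
        rw [Finset.sum_comm]
        simp only [← Finset.sum_smul, ← Matrix.mul_apply, h1, Matrix.one_apply, ite_smul, one_smul,
          zero_smul, Finset.sum_ite_eq, Finset.mem_univ, if_true]
      rw [hgh, Fintype.sum_sum_type]
      refine Submodule.add_mem _ ?_ ?_
      · exact Submodule.sum_mem _ fun l _ =>
          ((spinSum q).restrictScalars ℂ).smul_mem _ (hP.1.mem_spinSum l)
      · exact Submodule.sum_mem _ fun l _ =>
          ((spinSum q).restrictScalars ℂ).smul_mem _ (hP.2.mem_spinSum l)
  rw [spinSum, sSup_eq_iSup'] at hx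
  induction hx using Submodule.iSup_induction' with
  | mem S x hx =>
    obtain ⟨m, h, ht, -, hS⟩ := S.2
    rw [hS] at hx
    replace hx : x ∈ Submodule.span ℂ (Set.range h) := hx
    induction hx using Submodule.span_induction with
    | mem x hx' => obtain ⟨i, rfl⟩ := hx'; exact key m h ht i
    | zero => simp
    | add x y _ _ hx hy =>
      rw [mul_add]; exact Submodule.add_mem _ hx hy
    | smul c x _ hx =>
      rw [mul_smul_comm]; exact ((spinSum q).restrictScalars ℂ).smul_mem _ hx
  | zero => simp
  | add x y _ _ hx hy => rw [mul_add]; exact Submodule.add_mem _ hx hy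

/-- The sum contains `1` and is stable under left multiplication by the generators, which up to
scalars are the entries of the columns of `spinMat q 1`. -/
theorem spinSum_eq_top (hq : q ∈ Set.Ioo (0 : ℝ) 1) : spinSum q = ⊤ := by
  have hq0 : (q : ℂ) ≠ 0 := by exact_mod_cast hq.1.ne'
  have hcol (l : Fin 2) : LeftCovariant (spinMat q 1) fun k => spinMat q 1 k l := fun k =>
    (isCorep_spinMat hq0 1).comul_apply k l
  have key : ∀ f, ∀ x ∈ spinSum q, (Presented.mk _ f : OSU q) * x ∈ spinSum q := by
    intro f
    induction f using FreeAlgebra.induction with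
    | grade0 r =>
      intro x hx
      rw [AlgHom.commutes, ← Algebra.smul_def]
      exact ((spinSum q).restrictScalars ℂ).smul_mem _ hx
    | add f g hf hg => intro x hx; rw [map_add, add_mul]; exact Submodule.add_mem _ (hf x hx) (hg x hx)
    | mul f g hf hg => intro x hx; rw [map_mul, mul_assoc]; exact hf _ (hg x hx)
    | grade1 i =>
      intro x hx
      match i with
      | .α => change α q * x ∈ _; simpa [spinMat] using mul_mem_spinSum hq (hcol 1) 1 hx
      | .α' => change α' q * x ∈ _; simpa [spinMat] using mul_mem_spinSum hq (hcol 0) 0 hx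
      | .γ => change γ q * x ∈ _; simpa [spinMat] using mul_mem_spinSum hq (hcol 1) 0 hx
      | .γ' =>
        have := ((spinSum q).restrictScalars ℂ).smul_mem (-(q : ℂ)⁻¹)
          (mul_mem_spinSum hq (hcol 0) 1 hx)
        change γ' q * x ∈ _
        simpa [spinMat, smul_smul, hq0, -Complex.coe_smul] using this
  have h1 : (1 : OSU q) ∈ spinSum q := by
    have : LeftCovariant (spinMat q 0) fun _ => 1 := fun i => by
      obtain rfl : i = 0 := Fin.eq_zero i
      rw [spinMat_zero]
      exact ((Fin.sum_univ_one _).trans (by simp [Algebra.TensorProduct.one_def])).symm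
    exact this.mem_spinSum 0
  rw [eq_top_iff]
  intro x _
  obtain ⟨f, rfl⟩ : ∃ f, Presented.mk _ f = x := RingQuot.mkAlgHom_surjective ℂ _ x
  simpa using key f 1 h1

/-! ### Classification of the irreducible corepresentations -/

section Classification

variable {V : Type*} [AddCommGroup V] [Module ℂ V] (ρ : LeftCoaction (OSU q) V)

/-- The map `V → H`, `v ↦ (id ⊗ ξ) (ρ v)`, of matrix coefficients. -/
def coeffMap (ξ : Module.Dual ℂ V) : V →ₗ[ℂ] OSU q :=
  (TensorProduct.rid ℂ (OSU q)).toLinearMap ∘ₗ ξ.lTensor (OSU q) ∘ₗ ρ.toLin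

/-- Coassociativity makes the map of matrix coefficients a homomorphism of left comodules from `V`
to `O(SU_q(2))`. -/
theorem comul_coeffMap (ξ : Module.Dual ℂ V) (v : V) :
    comul q (coeffMap ρ ξ v) = (coeffMap ρ ξ).lTensor (OSU q) (ρ.toLin v) := by
  have h1 : ∀ x : OSU q ⊗[ℂ] V,
      comul q (TensorProduct.rid ℂ (OSU q) (ξ.lTensor (OSU q) x)) =
      ((TensorProduct.rid ℂ (OSU q)).toLinearMap ∘ₗ ξ.lTensor (OSU q)).lTensor (OSU q)
        (TensorProduct.assoc ℂ (OSU q) (OSU q) V ((comul q).toLinearMap.rTensor V x)) := by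
    intro x
    induction x with
    | zero => simp
    | tmul h v =>
      simp only [LinearMap.lTensor_tmul, TensorProduct.rid_tmul, map_smul, LinearMap.rTensor_tmul,
        AlgHom.toLinearMap_apply]
      induction comul q h with
      | zero => simp
      | tmul a b => simp
      | add x y hx hy => simp only [smul_add, TensorProduct.add_tmul, map_add, hx, hy]
    | add x y hx hy => simp only [map_add, hx, hy]
  have h2 := LinearMap.congr_fun ρ.coassoc v
  have h3 : ((TensorProduct.rid ℂ (OSU q)).toLinearMap ∘ₗ ξ.lTensor (OSU q)).lTensor (OSU q)
      (ρ.toLin.lTensor (OSU q) (ρ.toLin v)) = (coeffMap ρ ξ).lTensor (OSU q) (ρ.toLin v) := by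
    rw [← LinearMap.comp_apply, ← LinearMap.lTensor_comp]
    rfl
  rw [← h3]
  exact (h1 _).trans (congrArg _ h2)

theorem slice_coeffMap (ξ : Module.Dual ℂ V) (φ : Module.Dual ℂ (OSU q)) (v : V) :
    slice φ (coeffMap ρ ξ v) = coeffMap ρ ξ (sliceMap V φ (ρ.toLin v)) := by
  rw [slice, LinearMap.comp_apply, AlgHom.toLinearMap_apply, comul_coeffMap, sliceMap_lTensor]

theorem counit_coeffMap (ξ : Module.Dual ℂ V) (v : V) :
    counit q (coeffMap ρ ξ v) = ξ v := by
  have h1 : ∀ x : OSU q ⊗[ℂ] V, counit q (TensorProduct.rid ℂ (OSU q) (ξ.lTensor (OSU q) x)) =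
      ξ (TensorProduct.lid ℂ V ((counit q).toLinearMap.rTensor V x)) := by
    intro x
    induction x with
    | zero => simp
    | tmul h v => simp [mul_comm]
    | add x y hx hy => simp only [map_add, hx, hy]
  exact (h1 _).trans (congrArg ξ (LinearMap.congr_fun ρ.counit v))

/-- Matrix coefficients realise `V` as a simple submodule of `O(SU_q(2))`. As the latter is a sum of
simple spin submodules, `V` is isomorphic to one of them, and the dimension tells which. -/
theorem exists_basis_of_isIrreducible (hq : q ∈ Set.Ioo (0 : ℝ) 1) (hρ : ρ.IsIrreducible)
    {n : ℕ} (hV : Module.finrank ℂ V = n + 1) :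
    ∃ b : Module.Basis (Fin (n + 1)) ℂ V,
      ∀ i, ρ.toLin (b i) = ∑ j, spinMat q n i j ⊗ₜ b j := by
  obtain ⟨hnt, hirr⟩ := hρ
  have hirr' : ∀ W : Submodule ℂ V, (∀ φ, ∀ w ∈ W, sliceMap V φ (ρ.toLin w) ∈ W) →
      W = ⊥ ∨ W = ⊤ := fun W hW =>
    hirr W fun w hw => mem_range_lTensor_subtype fun φ => hW φ w hw
  obtain ⟨v₀, hv₀⟩ := exists_ne (0 : V)
  obtain ⟨ξ, hξ⟩ : ∃ ξ : Module.Dual ℂ V, ξ v₀ ≠ 0 := by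
    by_contra! h
    exact hv₀ ((Module.forall_dual_apply_eq_zero_iff ℂ v₀).1 h)
  set ψ := coeffMap ρ ξ with hψ
  have hψ0 : ψ v₀ ≠ 0 := fun h => hξ (by rw [← counit_coeffMap ρ, ← hψ, h, map_zero])
  -- The kernel is a subcomodule, and it is not all of `V` because the counit recovers `ξ` from `ψ`.
  have hinj : Function.Injective ψ := by
    rw [← LinearMap.ker_eq_bot]
    refine (hirr' (LinearMap.ker ψ) fun φ w hw => ?_).resolve_right fun h => ?_
    · rw [LinearMap.mem_ker] at hw ⊢
      rw [hψ, ← slice_coeffMap, ← hψ, hw, map_zero]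
    · exact hψ0 (LinearMap.mem_ker.1 (h ▸ Submodule.mem_top))
  let R : Submodule (SliceAlg q) (OSU q) := subOfSlice (LinearMap.range ψ) (by
    rintro φ _ ⟨v, rfl⟩
    exact ⟨_, (slice_coeffMap ρ ξ φ v).symm⟩)
  have hR : IsSimpleModule (SliceAlg q) R := by
    rw [isSimpleModule_iff_isAtom]
    refine ⟨fun h => hψ0 ?_, fun N hN => ?_⟩
    · have : ψ v₀ ∈ R := ⟨v₀, rfl⟩
      rw [h] at this
      simpa using this
    · have hW : ∀ φ, ∀ w ∈ (N.restrictScalars ℂ).comap ψ,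
          sliceMap V φ (ρ.toLin w) ∈ (N.restrictScalars ℂ).comap ψ := fun φ w hw => by
        change ψ _ ∈ N
        rw [hψ, ← slice_coeffMap]
        exact slice_mem N φ hw
      rcases hirr' _ hW with h | h
      · rw [Submodule.eq_bot_iff]
        intro x hx
        obtain ⟨v, rfl⟩ := hN.le hx
        have : v ∈ (N.restrictScalars ℂ).comap ψ := hx
        rw [h, Submodule.mem_bot] at this
        rw [this, map_zero]
      · refine absurd ?_ hN.not_ge
        rintro _ ⟨v, rfl⟩
        have : v ∈ (N.restrictScalars ℂ).comap ψ := h ▸ Submodule.mem_top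
        exact this
  -- A simple submodule of a sum of simple modules is isomorphic to one of the summands.
  obtain ⟨S, ⟨m, h, ht, h0, rfl⟩, ⟨Φ⟩⟩ := Submodule.linearEquiv_of_sSup_eq_top (h := by
    rintro ⟨S, m, h, ht, h0, rfl⟩
    exact ht.isSimpleModule_span (ht.isCyclic hq.1) h0) R _ (spinSum_eq_top hq)
  let e : V ≃ₗ[ℂ] R := LinearEquiv.ofInjective ψ hinj
  let Ψ : V ≃ₗ[ℂ] ht.span := e.trans (Φ.restrictScalars ℂ)
  let F : V →ₗ[ℂ] OSU q := (ht.span.restrictScalars ℂ).subtype ∘ₗ Ψ.toLinearMap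
  have hFinj : Function.Injective F := Subtype.val_injective.comp Ψ.injective
  have hF (φ) (v) : F (sliceMap V φ (ρ.toLin v)) = slice φ (F v) := by
    have h1 : e (sliceMap V φ (ρ.toLin v)) = SliceAlg.of φ • e v :=
      Subtype.ext (slice_coeffMap ρ ξ φ v).symm
    change ((Φ (e (sliceMap V φ (ρ.toLin v))) : ht.span) : OSU q) = _
    rw [h1]
    exact congrArg Subtype.val (Φ.map_smul (SliceAlg.of φ) _)
  have hli := (ht.isCyclic hq.1).linearIndependent h0
  let bS : Module.Basis (Fin (m + 1)) ℂ ht.span := Module.Basis.span hli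
  have hbS (i) : ((bS i : ht.span) : OSU q) = h i :=
    congrArg Subtype.val (Module.Basis.span_apply hli i)
  let b := bS.map Ψ.symm
  obtain rfl : m = n := by
    have := Module.finrank_eq_card_basis b
    rw [hV, Fintype.card_fin] at this
    omega
  have hb (i) : F (b i) = h i := by
    change ((Ψ (b i) : ht.span) : OSU q) = h i
    simp only [b, Module.Basis.map_apply, LinearEquiv.apply_symm_apply, hbS]
  -- An element of `H ⊗ V` is determined by its slices, and `F` carries those injectively to slices
  -- in `O(SU_q(2))`, where the covariance of `h` applies.
  refine ⟨b, fun i => eq_of_sliceMap_eq fun φ => hFinj ?_⟩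
  simp only [hF, hb, ht.slice, map_sum, sliceMap_tmul, map_smul]

end Classification
end OSU

/-! ### Trace class operators -/

section TraceClass

variable {H : Type*} [NormedAddCommGroup H] [InnerProductSpace ℂ H] {S T : H →L[ℂ] H}

theorem IsTraceClass.of_equiv {ι : Type*} (e : ℕ ≃ ι) (a b : ι → H)
    (hs : Summable fun n => ‖a n‖ * ‖b n‖) (h : ∀ x, HasSum (fun n => inner ℂ (a n) x • b n) (T x)) :
    IsTraceClass T :=
  ⟨a ∘ e, b ∘ e, (e.summable_iff (f := fun n => ‖a n‖ * ‖b n‖)).2 hs,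
    fun x => (e.hasSum_iff (f := fun n => inner ℂ (a n) x • b n)).2 (h x)⟩

theorem IsTraceClass.zero : IsTraceClass (0 : H →L[ℂ] H) :=
  ⟨0, 0, by simp, fun x => by simp⟩

theorem IsTraceClass.add (hS : IsTraceClass S) (hT : IsTraceClass T) : IsTraceClass (S + T) := by
  obtain ⟨a, b, h1, h2⟩ := hS
  obtain ⟨c, d, h3, h4⟩ := hT
  refine .of_equiv Equiv.natSumNatEquivNat.symm (Sum.elim a c) (Sum.elim b d) ?_ fun x => ?_
  · exact (h1.hasSum.sum (f := fun n => ‖Sum.elim a c n‖ * ‖Sum.elim b d n‖) h3.hasSum).summable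
  · exact (h2 x).sum (f := fun n => inner ℂ (Sum.elim a c n) x • Sum.elim b d n) (h4 x)

theorem IsTraceClass.mul_left (S : H →L[ℂ] H) (hT : IsTraceClass T) : IsTraceClass (S * T) := by
  obtain ⟨a, b, h1, h2⟩ := hT
  refine ⟨a, fun n => S (b n), ?_, fun x => ?_⟩
  · refine .of_nonneg_of_le (fun n => by positivity) (fun n => ?_) (h1.mul_left ‖S‖)
    calc ‖a n‖ * ‖S (b n)‖ ≤ ‖a n‖ * (‖S‖ * ‖b n‖) := by gcongr; exact S.le_opNorm _
      _ = ‖S‖ * (‖a n‖ * ‖b n‖) := by ring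
  · simpa using (h2 x).mapL S

theorem IsTraceClass.mul_right [CompleteSpace H] (hT : IsTraceClass T) (S : H →L[ℂ] H) :
    IsTraceClass (T * S) := by
  obtain ⟨a, b, h1, h2⟩ := hT
  refine ⟨fun n => ContinuousLinearMap.adjoint S (a n), b, ?_, fun x => ?_⟩
  · refine .of_nonneg_of_le (fun n => by positivity) (fun n => ?_)
      (h1.mul_left ‖ContinuousLinearMap.adjoint S‖)
    rw [← mul_assoc]
    gcongr
    exact ContinuousLinearMap.le_opNorm _ _
  · simpa [ContinuousLinearMap.adjoint_inner_left] using h2 (S x)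

theorem IsTraceClass.smul (c : ℂ) (hT : IsTraceClass T) : IsTraceClass (c • T) := by
  simpa using hT.mul_left (c • (1 : H →L[ℂ] H))

theorem IsTraceClass.neg (hT : IsTraceClass T) : IsTraceClass (-T) := by
  simpa using hT.smul (-1)

end TraceClass

/-! ### The trace on `ℓ²(ℕ²)` -/

section Trace

/-- The double series of `conj (a n k) * b n k` converges absolutely, by Cauchy–Schwarz for each
`n`, so the order of summation over `n` and `k` may be exchanged. -/
theorem hasSum_trace {T : L2 →L[ℂ] L2} {a b : ℕ → L2} (hs : Summable fun n => ‖a n‖ * ‖b n‖)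
    (h : ∀ x, HasSum (fun n => inner ℂ (a n) x • b n) (T x)) :
    HasSum (fun k => inner ℂ (ket k) (T (ket k))) (∑' n, inner ℂ (a n) (b n)) := by
  have h2 : (2 : ENNReal).toReal.HolderConjugate (2 : ENNReal).toReal := by
    simpa using Real.HolderConjugate.two_two
  let f : ℕ × (ℕ × ℕ) → ℂ := fun p => inner ℂ (a p.1 p.2) (b p.1 p.2)
  have hf : Summable f := by
    apply Summable.of_norm
    refine (summable_prod_of_nonneg fun _ => norm_nonneg _).2 ⟨fun n => ?_, ?_⟩
    · refine .of_nonneg_of_le (fun _ => norm_nonneg _) (fun k => ?_) (lp.summable_mul h2 (a n) (b n))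
      exact norm_inner_le_norm _ _
    · refine .of_nonneg_of_le (fun n => tsum_nonneg fun k => norm_nonneg _) (fun n => ?_) hs
      refine (Summable.tsum_le_tsum (fun k => norm_inner_le_norm _ _) ?_
        (lp.summable_mul h2 (a n) (b n))).trans (lp.tsum_mul_le_mul_norm' h2 (a n) (b n))
      exact .of_nonneg_of_le (fun _ => norm_nonneg _) (fun k => norm_inner_le_norm _ _)
        (lp.summable_mul h2 (a n) (b n))
  have h3 : ∑' p, f p = ∑' n, inner ℂ (a n) (b n) := by
    rw [hf.tsum_prod]
    exact tsum_congr fun n => (lp.hasSum_inner (a n) (b n)).tsum_eq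
  rw [← h3]
  have h4 : HasSum (f ∘ Prod.swap) (∑' p, f p) :=
    (Equiv.prodComm _ _).hasSum_iff.2 hf.hasSum
  refine h4.prod_fiberwise fun k => ?_
  have h5 := (h (ket k)).mapL (innerSL ℂ (ket k))
  simp only [innerSL_apply_apply, inner_smul_right] at h5
  convert! h5 using 2 with n
  rw [inner_ket, ← inner_conj_symm (a n), inner_ket]
  simp [f, mul_comm]

theorem IsTraceClass.exists_hasTrace {T : L2 →L[ℂ] L2} (hT : IsTraceClass T) :
    ∃ c, HasTrace T c := by
  obtain ⟨a, b, h1, h2⟩ := hT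
  exact ⟨_, ⟨a, b, h1, h2⟩, hasSum_trace h1 h2⟩

theorem HasTrace.unique {T : L2 →L[ℂ] L2} {c d : ℂ} (hc : HasTrace T c) (hd : HasTrace T d) :
    c = d := hc.2.unique hd.2

theorem HasTrace.add {S T : L2 →L[ℂ] L2} {c d : ℂ} (hc : HasTrace S c) (hd : HasTrace T d) :
    HasTrace (S + T) (c + d) :=
  ⟨hc.1.add hd.1, by simpa [inner_add_right] using hc.2.add hd.2⟩

theorem HasTrace.smul {T : L2 →L[ℂ] L2} {c : ℂ} (r : ℂ) (hc : HasTrace T c) :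
    HasTrace (r • T) (r * c) :=
  ⟨hc.1.smul r, by simpa [inner_smul_right] using hc.2.mul_left r⟩

theorem HasTrace.sub {S T : L2 →L[ℂ] L2} {c d : ℂ} (hc : HasTrace S c) (hd : HasTrace T d) :
    HasTrace (S - T) (c - d) := by
  have := hc.add (hd.smul (-1))
  rwa [neg_one_smul, ← sub_eq_add_neg, neg_one_mul, ← sub_eq_add_neg] at this

theorem HasTrace.zero : HasTrace 0 0 := ⟨.zero, by simp⟩

theorem HasTrace.sum {ι : Type*} (s : Finset ι) {T : ι → L2 →L[ℂ] L2} {c : ι → ℂ}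
    (h : ∀ i ∈ s, HasTrace (T i) (c i)) : HasTrace (∑ i ∈ s, T i) (∑ i ∈ s, c i) := by
  classical
  induction s using Finset.induction_on with
  | empty => simpa using HasTrace.zero
  | insert i s hi ih =>
    rw [Finset.sum_insert hi, Finset.sum_insert hi]
    exact (h i (by simp)).add (ih fun j hj => h j (by simp [hj]))

/-- If `T = ∑ |b n⟩⟨a n|`, then `S T = ∑ |S b n⟩⟨a n|` and `T S = ∑ |b n⟩⟨S^* a n|`, and both have
trace `∑ ⟨a n, S b n⟩`. Boundedness of `S` suffices. -/
theorem HasTrace.comm {S T : L2 →L[ℂ] L2} {c : ℂ} (hT : IsTraceClass T) (h : HasTrace (T * S) c) :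
    HasTrace (S * T) c := by
  obtain ⟨a, b, h1, h2⟩ := hT
  have h3 : Summable fun n => ‖a n‖ * ‖S (b n)‖ := by
    refine .of_nonneg_of_le (fun n => by positivity) (fun n => ?_) (h1.mul_left ‖S‖)
    calc ‖a n‖ * ‖S (b n)‖ ≤ ‖a n‖ * (‖S‖ * ‖b n‖) := by gcongr; exact S.le_opNorm _
      _ = ‖S‖ * (‖a n‖ * ‖b n‖) := by ring
  have h4 : Summable fun n => ‖ContinuousLinearMap.adjoint S (a n)‖ * ‖b n‖ := by
    refine .of_nonneg_of_le (fun n => by positivity) (fun n => ?_)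
      (h1.mul_left ‖ContinuousLinearMap.adjoint S‖)
    rw [← mul_assoc]
    gcongr
    exact ContinuousLinearMap.le_opNorm _ _
  have e1 : ∀ x, HasSum (fun n => inner ℂ (a n) x • S (b n)) ((S * T) x) := fun x => by
    simpa using (h2 x).mapL S
  have e2 : ∀ x, HasSum (fun n => inner ℂ (ContinuousLinearMap.adjoint S (a n)) x • b n)
      ((T * S) x) := fun x => by
    simpa [ContinuousLinearMap.adjoint_inner_left] using h2 (S x)
  have h5 := (hasSum_trace h4 e2).unique h.2
  simp only [ContinuousLinearMap.adjoint_inner_left] at h5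
  exact ⟨⟨a, _, h3, e1⟩, h5 ▸ hasSum_trace h3 e1⟩

/-- A diagonal operator with summable weights is of trace class. -/
theorem HasTrace.of_diagonal {T : L2 →L[ℂ] L2} {w : ℕ × ℕ → ℂ} (hw : Summable fun k => ‖w k‖)
    (hT : ∀ f k, T f k = w k * f k) : HasTrace T (∑' k, w k) := by
  have hket : ∀ k, ‖ket k‖ = 1 := fun k => by rw [ket, lp.norm_single (by norm_num)]; simp
  refine ⟨.of_equiv Nat.pairEquiv.symm ket (fun k => w k • ket k) ?_ fun x => ?_, ?_⟩
  · simpa [norm_smul, hket] using hw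
  · convert! lp.hasSum_single ENNReal.ofNat_ne_top (T x) using 2 with k
    ext j
    rw [inner_ket, hT, smul_smul]
    by_cases h : j = k
    · subst h
      rw [lp.coeFn_smul, Pi.smul_apply, ket_apply_self, lp.single_apply_self]
      simp [mul_comm]
    · rw [lp.coeFn_smul, Pi.smul_apply, ket_apply_ne h, lp.single_apply_ne _ _ _ h, smul_zero]
  · convert! hw.of_norm.hasSum using 2 with k
    rw [inner_ket, hT, ket_apply_self, mul_one]

end Trace

/-! ### The representation of coinvariant elements -/

section Rep

variable {q : ℝ} (hq : q ∈ Set.Ioo (0 : ℝ) 1)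

@[simp] theorem rep_x_zero : rep hq (OS7.x q 0) = 0 := by simp [rep]
@[simp] theorem rep_x_one : rep hq (OS7.x q 1) = repX₂ hq := by simp [rep]
@[simp] theorem rep_x'_zero : rep hq (OS7.x' q 0) = 0 := by simp [rep]
@[simp] theorem rep_x'_one : rep hq (OS7.x' q 1) = star (repX₂ hq) := by simp [rep]

theorem hasSum_geometric_prod {a b : ℝ} (ha : a ∈ Set.Ioo (0 : ℝ) 1) (hb : b ∈ Set.Ioo (0 : ℝ) 1) :
    HasSum (fun k : ℕ × ℕ => a ^ k.1 * b ^ k.2) ((1 - a)⁻¹ * (1 - b)⁻¹) := by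
  have h1 := hasSum_geometric_of_lt_one ha.1.le ha.2
  have h2 := hasSum_geometric_of_lt_one hb.1.le hb.2
  exact h1.mul h2 (h1.summable.mul_of_nonneg h2.summable (fun n => pow_nonneg ha.1.le n)
    fun n => pow_nonneg hb.1.le n)

theorem pow_mem_Ioo (hq : q ∈ Set.Ioo (0 : ℝ) 1) {n : ℕ} (hn : n ≠ 0) :
    q ^ n ∈ Set.Ioo (0 : ℝ) 1 := ⟨pow_pos hq.1 n, pow_lt_one₀ hq.1.le hq.2 hn⟩

theorem summable_weight (hq : q ∈ Set.Ioo (0 : ℝ) 1) :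
    Summable fun k : ℕ × ℕ => ‖(q : ℂ) ^ (k.1 + 2 * k.2)‖ := by
  convert (hasSum_geometric_prod hq (pow_mem_Ioo hq two_ne_zero)).summable using 2 with k
  rw [norm_pow, Complex.norm_real, Real.norm_of_nonneg hq.1.le, pow_add, pow_mul]

/-- The weights `q^(k₁ + 2 k₂)` are summable. Together with `π(x_1) = 0`, this kills `x_1` and `x_2`
modulo trace class operators. -/
theorem isTraceClass_repX₂ : IsTraceClass (repX₂ hq) :=
  (HasTrace.of_diagonal (summable_weight hq) fun f k => repX₂_apply hq f k.1 k.2).1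

theorem isTraceClass_star_repX₂ : IsTraceClass (star (repX₂ hq)) :=
  (HasTrace.of_diagonal (summable_weight hq) fun f k => star_repX₂_apply hq f k.1 k.2).1

/-- The congruence on `O(S^7_q)` modulo elements that are represented by trace class operators. -/
def traceCon : RingCon (OS7 q) where
  r a b := IsTraceClass (rep hq (a - b))
  iseqv :=
    { refl := fun a => by simpa using IsTraceClass.zero
      symm := fun {a b} h => by simpa using h.neg
      trans := fun {a b c} h h' => by simpa using h.add h' }
  mul' {a b c d} h h' := by
    have : a * c - b * d = (a - b) * c + b * (c - d) := by noncomm_ring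
    rw [this, map_add, map_mul, map_mul]
    exact (h.mul_right _).add (h'.mul_left _)
  add' {a b c d} h h' := by
    have : a + c - (b + d) = (a - b) + (c - d) := by abel
    rw [this, map_add]
    exact h.add h'

/-- The map `(ε ⊗ id) δ : O(S^7_q) → O(SU_q(2))`, the restriction to a fibre. -/
def fibre (q : ℝ) : OS7 q →ₐ[ℂ] OSU q :=
  (Algebra.TensorProduct.lid ℂ (OSU q)).toAlgHom.comp
    ((Algebra.TensorProduct.map (OS7.character q) (AlgHom.id ℂ (OSU q))).comp (OS7.coaction q))

/-- Coinvariant elements are constant along the fibre. -/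
theorem fibre_of_mem_OS4 {b : OS7 q} (hb : b ∈ OS4 q) :
    fibre q b = algebraMap ℂ _ (OS7.character q b) := by
  have : OS7.coaction q b = b ⊗ₜ 1 := hb
  simp [fibre, this, Algebra.algebraMap_eq_smul_one]

/-- Where `x_1` and `x_2` vanish, the relations of the sphere become those of `SU_q(2)` with `α =
x_4^*` and `γ = -x_3`. -/
theorem suRels_of_s7Rels {R : Type*} [Ring R] [Algebra ℂ R] {x y : Fin 4 → R} (hx0 : x 0 = 0)
    (hx1 : x 1 = 0) (hy0 : y 0 = 0) (hy1 : y 1 = 0) (h : ∀ r ∈ s7Rels q x y, r.1 = r.2) :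
    ∀ r ∈ suRels q (y 3) (x 3) (-x 2) (-y 2), r.1 = r.2 := by
  simp only [s7Rels, suRels, List.forall_mem_cons, List.not_mem_nil, false_imp_iff, implies_true,
    and_true, hx0, hx1, hy0, hy1, mul_zero, zero_mul, smul_zero, add_zero, zero_add, sub_zero,
    true_and] at h ⊢
  obtain ⟨h6, h12, h15, h16, h17, h23, h29⟩ := h
  simp only [neg_mul, mul_neg, neg_neg, h15, h6, h12, h23, h29, smul_neg, sub_self, true_and,
    ← h16, h17]
  refine ⟨?_, ?_, ?_⟩
  · rw [h16, ← h17, h15, add_comm]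
  · rw [add_comm]
  · rw [h16, ← h17, h15]

/-- The quotient map onto `O(S^7_q)` modulo elements represented by trace class operators. -/
def modTrace : OS7 q →ₐ[ℂ] (traceCon hq).Quotient := (traceCon hq).mkₐ ℂ

theorem modTrace_eq_iff {a b : OS7 q} :
    modTrace hq a = modTrace hq b ↔ IsTraceClass (rep hq (a - b)) := (traceCon hq).eq

theorem modTrace_eq_zero {a : OS7 q} (h : IsTraceClass (rep hq a)) : modTrace hq a = 0 := by
  rw [← map_zero (modTrace hq), modTrace_eq_iff, sub_zero]
  exact h

/-- The map from `O(SU_q(2))` to `O(S^7_q)` modulo elements represented by trace class operators. -/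
def fibreSection : OSU q →ₐ[ℂ] (traceCon hq).Quotient :=
  OSU.lift (modTrace hq (OS7.x' q 3)) (modTrace hq (OS7.x q 3))
    (-modTrace hq (OS7.x q 2)) (-modTrace hq (OS7.x' q 2)) (by
  refine suRels_of_s7Rels (x := fun i => modTrace hq (OS7.x q i))
    (y := fun i => modTrace hq (OS7.x' q i))
    (modTrace_eq_zero hq (by simpa using IsTraceClass.zero))
    (modTrace_eq_zero hq (by simpa using isTraceClass_repX₂ hq))
    (modTrace_eq_zero hq (by simpa using IsTraceClass.zero))
    (modTrace_eq_zero hq (by simpa using isTraceClass_star_repX₂ hq)) ?_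
  rw [OS7.map_rels]
  simpa only [List.forall_mem_map, Prod.map_fst, Prod.map_snd] using
    fun r hr => congrArg (modTrace hq) (OS7.rels q r hr))

/-- Both sides are algebra maps that agree on generators. Hence modulo trace class operators `π`
sees only the restriction to the fibre. -/
theorem fibreSection_fibre (a : OS7 q) : fibreSection hq (fibre q a) = modTrace hq a := by
  refine AlgHom.congr_fun (φ₁ := (fibreSection hq).comp (fibre q)) (Presented.hom_ext ?_) a
  have h0 : modTrace hq (OS7.x q 0) = 0 := modTrace_eq_zero hq (by simpa using IsTraceClass.zero)
  have h1 : modTrace hq (OS7.x q 1) = 0 :=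
    modTrace_eq_zero hq (by simpa using isTraceClass_repX₂ hq)
  have h2 : modTrace hq (OS7.x' q 0) = 0 := modTrace_eq_zero hq (by simpa using IsTraceClass.zero)
  have h3 : modTrace hq (OS7.x' q 1) = 0 :=
    modTrace_eq_zero hq (by simpa using isTraceClass_star_repX₂ hq)
  rintro (i | i)
  · change fibreSection hq (fibre q (OS7.x q i)) = modTrace hq (OS7.x q i)
    fin_cases i <;> simp [fibre, fibreSection, OS7.coaction, OS7.character, h0, h1,
      -Complex.coe_smul]
  · change fibreSection hq (fibre q (OS7.x' q i)) = modTrace hq (OS7.x' q i)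
    fin_cases i <;> simp [fibre, fibreSection, OS7.coaction, OS7.character, h2, h3,
      -Complex.coe_smul]

theorem isTraceClass_rep_sub {b : OS7 q} (hb : b ∈ OS4 q) :
    IsTraceClass (rep hq b - OS7.character q b • 1) := by
  have h := fibreSection_fibre hq b
  rw [fibre_of_mem_OS4 hb, AlgHom.commutes, ← (modTrace hq).commutes, eq_comm,
    modTrace_eq_iff] at h
  simpa [Algebra.algebraMap_eq_smul_one] using h

end Rep

/-! ### The trace of `π - ε` on coinvariant elements -/

section ChernOp

variable {q : ℝ} (hq : q ∈ Set.Ioo (0 : ℝ) 1)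

/-- The linear map `π - ε`. -/
def chernOp : OS7 q →ₗ[ℂ] (L2 →L[ℂ] L2) :=
  (rep hq).toLinearMap - (Algebra.linearMap ℂ (L2 →L[ℂ] L2)).comp (OS7.character q).toLinearMap

theorem chernOp_apply (b : OS7 q) : chernOp hq b = rep hq b - OS7.character q b • 1 := by
  simp [chernOp, Algebra.algebraMap_eq_smul_one]

variable {hq}

theorem isTraceClass_chernOp {b : OS7 q} (hb : b ∈ OS4 q) : IsTraceClass (chernOp hq b) := by
  rw [chernOp_apply]
  exact isTraceClass_rep_sub hq hb

/-- Since `ε` is a character, `π - ε` sends `[a, b]` to `[π(a) - ε(a), π(b) - ε(b)]`. Coinvariance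
of `a` alone makes one factor trace class, so the trace vanishes. -/
theorem hasTrace_chernOp_commutator {a b : OS7 q} (ha : a ∈ OS4 q) :
    HasTrace (chernOp hq (a * b - b * a)) 0 := by
  have h : chernOp hq (a * b - b * a) =
      chernOp hq a * chernOp hq b - chernOp hq b * chernOp hq a := by
    simp only [chernOp_apply, map_sub, map_mul, sub_mul, mul_sub, smul_mul_assoc, mul_smul_comm,
      one_mul, mul_one, mul_comm (OS7.character q b)]
    module
  obtain ⟨c, hc⟩ := ((isTraceClass_chernOp (hq := hq) ha).mul_right (chernOp hq b)).exists_hasTrace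
  rw [h, ← sub_self c]
  exact hc.sub (hc.comm (isTraceClass_chernOp ha))

variable {κ κ' : Type*} [Fintype κ] [Fintype κ']

theorem hasTrace_chernOp_trace_mul_comm {r : Matrix κ κ' (OS7 q)} {s : Matrix κ' κ (OS7 q)}
    (hr : ∀ a b, r a b ∈ OS4 q) {c : ℂ}
    (h : HasTrace (chernOp hq (r * s).trace) c) : HasTrace (chernOp hq (s * r).trace) c := by
  have h1 : (s * r).trace = (r * s).trace - ∑ a, ∑ b, (r a b * s b a - s b a * r a b) := by
    simp only [Matrix.trace, Matrix.diag, Matrix.mul_apply, Finset.sum_sub_distrib]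
    rw [Finset.sum_comm (f := fun a b => s b a * r a b)]
    abel
  have h2 : HasTrace (chernOp hq (∑ a, ∑ b, (r a b * s b a - s b a * r a b))) 0 := by
    simp only [map_sum]
    simpa using HasTrace.sum Finset.univ fun a _ => HasTrace.sum Finset.univ fun b _ =>
      hasTrace_chernOp_commutator (hq := hq) (hr a b)
  rw [h1, map_sub, ← sub_zero c]
  exact h.sub h2

end ChernOp

/-! ### Frames of associated modules -/

section Frame

open OSU

variable {q : ℝ} {ι ι' κ κ' : Type*} [Fintype ι] [Fintype ι'] [Fintype κ] [Fintype κ']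

/-- Elements `y_a` of the cotensor product of a matrix corepresentation `t`, and equivariant
functionals `z_a` dual to them. -/
structure IsFrame [DecidableEq ι] (t : Matrix ι ι (OSU q)) (y : ι → κ → OS7 q)
    (z : κ → ι → OS7 q) : Prop where
  coaction_left : ∀ j a, OS7.coaction q (y j a) = ∑ i, y i a ⊗ₜ t i j
  coaction_right : ∀ a i, ∑ j, OS7.coaction q (z a j) * (1 ⊗ₜ t i j) = z a i ⊗ₜ 1
  sum_mul : ∀ j i, ∑ a, y j a * z a i = if j = i then 1 else 0

/-- The trace of the idempotent `z y` of a frame. -/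
def frameTrace (y : ι → κ → OS7 q) (z : κ → ι → OS7 q) : OS7 q := ∑ a, ∑ i, z a i * y i a

theorem frameTrace_conj [DecidableEq ι] {y : ι → κ → OS7 q} {z : κ → ι → OS7 q}
    {P : Matrix ι ι' ℂ} {P' : Matrix ι' ι ℂ} (h1 : P * P' = 1) :
    frameTrace (fun l a => ∑ j, P j l • y j a) (fun a k => ∑ j, P' k j • z a j) =
      frameTrace y z := by
  have h3 := fun i j => congrFun₂ h1 i j
  simp only [Matrix.mul_apply] at h3
  refine Finset.sum_congr rfl fun a _ => ?_
  calc ∑ k, (∑ i, P' k i • z a i) * ∑ j, P j k • y j a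
      = ∑ k, ∑ i, ∑ j, (P j k * P' k i) • (z a i * y j a) := by
        simp only [Finset.sum_mul_sum, smul_mul_assoc, mul_smul_comm, smul_smul, mul_comm (P' _ _)]
    _ = ∑ i, ∑ j, (∑ k, P j k * P' k i) • (z a i * y j a) := by
        rw [Finset.sum_comm]
        refine Finset.sum_congr rfl fun i _ => ?_
        rw [Finset.sum_comm]
        simp only [Finset.sum_smul]
    _ = _ := by simp [h3, Matrix.one_apply]

theorem frameTrace_sum {y : ι ⊕ ι' → κ → OS7 q} {z : κ → ι ⊕ ι' → OS7 q} :
     frameTrace y z = frameTrace (fun i a => y (.inl i) a)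
    (fun a i => z a (.inl i)) + frameTrace (fun i a => y (.inr i) a) fun a i => z a (.inr i) := by
  simp [frameTrace, Finset.sum_add_distrib]

/-- With `v` placed to the left of `z`, the sums over the first factor close up to a full trace
between `v` and `w`. -/
theorem frameTrace_tensor {y : ι → κ → OS7 q} {z : κ → ι → OS7 q} {w : ι' → κ' → OS7 q}
    {v : κ' → ι' → OS7 q} :
     frameTrace (ι := ι × ι') (κ := κ × κ') (fun j a => y j.1 a.1 * w j.2 a.2)
      (fun a i => v a.2 i.2 * z a.1 i.1) =
    ∑ b, ∑ k, v b k * (frameTrace y z * w k b) := by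
  simp only [frameTrace, Fintype.sum_prod_type, Finset.sum_mul, Finset.mul_sum]
  rw [Finset.sum_comm]
  refine Finset.sum_congr rfl fun b _ => ?_
  simp only [mul_assoc]
  refine Eq.trans (Finset.sum_congr rfl fun a _ => Finset.sum_comm) Finset.sum_comm

/-- In the pairing of a contravariant with a covariant vector the matrix `t` cancels. -/
theorem sum_mul_mem_OS4 {t : Matrix ι ι (OSU q)} {y z : ι → OS7 q}
    (hy : ∀ j, OS7.coaction q (y j) = ∑ i, y i ⊗ₜ t i j)
    (hz : ∀ i, ∑ j, OS7.coaction q (z j) * (1 ⊗ₜ t i j) = z i ⊗ₜ 1) :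
    ∑ i, z i * y i ∈ OS4 q := by
  change OS7.coaction q _ = _ ⊗ₜ 1
  simp only [map_sum, map_mul, hy, Finset.mul_sum]
  rw [Finset.sum_comm, TensorProduct.sum_tmul]
  refine Finset.sum_congr rfl fun i _ => ?_
  have h : ∀ j, y i ⊗ₜ[ℂ] t i j = (1 ⊗ₜ t i j) * (y i ⊗ₜ 1) := fun j => by simp
  simp only [h, ← mul_assoc, ← Finset.sum_mul, hz]
  simp

variable [DecidableEq ι] [DecidableEq ι'] {t : Matrix ι ι (OSU q)} {s : Matrix ι' ι' (OSU q)}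
  {y : ι → κ → OS7 q} {z : κ → ι → OS7 q} {w : ι → κ' → OS7 q} {v : κ' → ι → OS7 q}

theorem IsFrame.sum_mul_mem (h : IsFrame t y z) (h' : IsFrame t w v) (a : κ) (b : κ') :
    ∑ i, z a i * w i b ∈ OS4 q :=
  sum_mul_mem_OS4 (fun j => h'.coaction_left j b) fun i => h.coaction_right a i

theorem IsFrame.frameTrace_mem (h : IsFrame t y z) : frameTrace y z ∈ OS4 q :=
  sum_mem fun a _ => h.sum_mul_mem h a a

theorem IsFrame.of_mul_of (h : IsFrame t y z) : Matrix.of y * Matrix.of z = 1 := by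
  ext i j
  simp [Matrix.mul_apply, h.sum_mul, Matrix.one_apply]

/-- As `y z = 1` and `w v = 1`, one has `z y = (z w)(v y)` and `v w = (v y)(z w)`, where `z w` has
coinvariant entries. The two idempotents are equivalent and have the same trace. -/
theorem IsFrame.hasTrace_of_hasTrace {hq : q ∈ Set.Ioo (0 : ℝ) 1} (h : IsFrame t y z)
    (h' : IsFrame t w v) {c : ℂ} (hc : HasTrace (chernOp hq (frameTrace y z)) c) :
    HasTrace (chernOp hq (frameTrace w v)) c := by
  have e : Matrix.of z * Matrix.of y =
      (Matrix.of z * Matrix.of w) * (Matrix.of v * Matrix.of y) := by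
    rw [Matrix.mul_assoc, ← Matrix.mul_assoc (Matrix.of w), h'.of_mul_of, Matrix.one_mul]
  have e' : Matrix.of v * Matrix.of w =
      (Matrix.of v * Matrix.of y) * (Matrix.of z * Matrix.of w) := by
    rw [Matrix.mul_assoc, ← Matrix.mul_assoc (Matrix.of y), h.of_mul_of, Matrix.one_mul]
  change HasTrace (chernOp hq (Matrix.of v * Matrix.of w).trace) c
  change HasTrace (chernOp hq (Matrix.of z * Matrix.of y).trace) c at hc
  rw [e']
  rw [e] at hc
  exact hasTrace_chernOp_trace_mul_comm (h.sum_mul_mem h') hc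

/-- A character takes commuting values, so the trace of `z y` may be computed as that of `y z = 1`.
-/
theorem IsFrame.character_frameTrace (h : IsFrame t y z) :
    OS7.character q (frameTrace y z) = Fintype.card ι := by
  have h1 : ∑ j, ∑ a, y j a * z a j = Fintype.card ι := by simp [h.sum_mul]
  rw [← map_natCast (OS7.character q), ← h1, frameTrace, Finset.sum_comm]
  simp only [map_sum, map_mul, mul_comm]

variable {P : Matrix ι ι' ℂ} {P' : Matrix ι' ι ℂ}

theorem IsFrame.conj (h : IsFrame t y z) (h1 : P * P' = 1) (h2 : P' * P = 1)
    (hP : Intertwines t s P) :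
    IsFrame s (fun l a => ∑ j, P j l • y j a) (fun a k => ∑ j, P' k j • z a j) where
  coaction_left l a := by
    simp only [map_sum, map_smul, h.coaction_left, Finset.smul_sum, TensorProduct.sum_tmul,
      ← TensorProduct.smul_tmul']
    rw [Finset.sum_comm]
    simp only [← TensorProduct.tmul_smul, ← TensorProduct.tmul_sum, hP _ l]
    simp only [TensorProduct.tmul_sum, TensorProduct.tmul_smul]
    exact Finset.sum_comm
  coaction_right a k := by
    have hP' := hP.symm h1 h2
    simp only [map_sum, map_smul, Finset.sum_mul, TensorProduct.sum_tmul,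
      ← TensorProduct.smul_tmul', ← h.coaction_right, smul_mul_assoc, Finset.smul_sum]
    refine Finset.sum_comm.trans ((Finset.sum_congr rfl fun j _ => ?_).trans Finset.sum_comm)
    simp only [← mul_smul_comm, ← TensorProduct.tmul_smul, ← Finset.mul_sum,
      ← TensorProduct.tmul_sum, hP' k j]
  sum_mul l k := by
    have h4 := congrFun₂ h2 k l
    rw [Matrix.mul_apply, Matrix.one_apply] at h4
    calc (∑ a, (∑ j, P j l • y j a) * ∑ i, P' k i • z a i)
        = ∑ j, ∑ i, (P j l * P' k i) • ∑ a, y j a * z a i := by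
          simp only [Finset.sum_mul_sum, Finset.smul_sum, smul_mul_assoc,
            mul_smul_comm, smul_smul]
          rw [Finset.sum_comm]
          refine Finset.sum_congr rfl fun j _ => ?_
          rw [Finset.sum_comm]
          simp only [mul_comm (P' _ _)]
      _ = (∑ j, P' k j * P j l) • (1 : OS7 q) := by
          simp [h.sum_mul, Finset.sum_smul, mul_comm]
      _ = _ := by
          rw [h4]
          simp [eq_comm]

section Blocks

variable {y : ι ⊕ ι' → κ → OS7 q} {z : κ → ι ⊕ ι' → OS7 q}

theorem IsFrame.inl (h : IsFrame (Matrix.fromBlocks t 0 0 s) y z) :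
    IsFrame t (fun i a => y (.inl i) a) fun a i => z a (.inl i) where
  coaction_left j a := by simpa using h.coaction_left (.inl j) a
  coaction_right a i := by simpa using h.coaction_right a (.inl i)
  sum_mul i j := by simpa using h.sum_mul (.inl i) (.inl j)

theorem IsFrame.inr (h : IsFrame (Matrix.fromBlocks t 0 0 s) y z) :
    IsFrame s (fun i a => y (.inr i) a) fun a i => z a (.inr i) where
  coaction_left j a := by simpa using h.coaction_left (.inr j) a
  coaction_right a i := by simpa using h.coaction_right a (.inr i)
  sum_mul i j := by simpa using h.sum_mul (.inr i) (.inr j)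

end Blocks

variable {w : ι' → κ' → OS7 q} {v : κ' → ι' → OS7 q}

/-- The dual elements are multiplied in the opposite order, so that `w v` collapses in the middle
before `y z` does; no commutation in `O(S^7_q)` is needed. -/
theorem IsFrame.tensor (h : IsFrame t y z) (h' : IsFrame s w v) :
    IsFrame (κ := κ × κ') (tensorMat t s) (fun j a => y j.1 a.1 * w j.2 a.2)
      fun a i => v a.2 i.2 * z a.1 i.1 where
  coaction_left j a := by
    simp [h.coaction_left, h'.coaction_left, Finset.sum_mul_sum, Fintype.sum_prod_type, tensorMat]
  coaction_right a i := by
    have e : ∀ (j : ι) (l : ι'), OS7.coaction q (v a.2 l) * OS7.coaction q (z a.1 j) *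
        (1 ⊗ₜ (t i.1 j * s i.2 l)) = OS7.coaction q (v a.2 l) * (OS7.coaction q (z a.1 j) *
          (1 ⊗ₜ t i.1 j)) * (1 ⊗ₜ s i.2 l) := fun j l => by
      simp only [mul_assoc, Algebra.TensorProduct.tmul_mul_tmul, one_mul]
    have e' : ∀ l, OS7.coaction q (v a.2 l) * (z a.1 i.1 ⊗ₜ 1) * (1 ⊗ₜ s i.2 l) =
        OS7.coaction q (v a.2 l) * (1 ⊗ₜ s i.2 l) * (z a.1 i.1 ⊗ₜ 1) := fun l => by
      simp only [mul_assoc, Algebra.TensorProduct.tmul_mul_tmul, one_mul, mul_one]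
    simp only [map_mul, Fintype.sum_prod_type, tensorMat, e]
    rw [Finset.sum_comm]
    simp only [← Finset.sum_mul, ← Finset.mul_sum, h.coaction_right, e', h'.coaction_right]
    simp
  sum_mul j i := by
    have e : ∀ a b, y j.1 a * w j.2 b * (v b i.2 * z a i.1) =
      y j.1 a * ((w j.2 b * v b i.2) * z a i.1) := fun a b => by simp only [mul_assoc]
    simp only [Fintype.sum_prod_type, e, ← Finset.mul_sum, ← Finset.sum_mul, h'.sum_mul]
    by_cases hji : j.2 = i.2 <;> simp [hji, h.sum_mul, Prod.ext_iff]

end Frame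

/-! ### Chern numbers of corepresentations and their recursion. -/

section HasChern

open OSU

variable {q : ℝ} (hq : q ∈ Set.Ioo (0 : ℝ) 1) {ι ι' : Type*} [Fintype ι] [Fintype ι']
  [DecidableEq ι] [DecidableEq ι']

/-- The matrix corepresentation `t` has a frame, whose idempotent has Chern number `c`. -/
def HasChern (t : Matrix ι ι (OSU q)) (c : ℂ) : Prop :=
  ∃ (κ : Type) (_ : Fintype κ) (y : ι → κ → OS7 q) (z : κ → ι → OS7 q),
    IsFrame t y z ∧ HasTrace (chernOp hq (frameTrace y z)) c

variable {hq} {t : Matrix ι ι (OSU q)} {s : Matrix ι' ι' (OSU q)}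

theorem HasChern.unique {c c' : ℂ} (h : HasChern hq t c) (h' : HasChern hq t c') : c = c' := by
  obtain ⟨κ, _, y, z, hf, hc⟩ := h
  obtain ⟨κ', _, w, v, hf', hc'⟩ := h'
  exact (hf.hasTrace_of_hasTrace hf' hc).unique hc'

theorem HasChern.conj {c : ℂ} (h : HasChern hq t c) {P : Matrix ι ι' ℂ} {P' : Matrix ι' ι ℂ}
    (h1 : P * P' = 1) (h2 : P' * P = 1) (hP : Intertwines t s P) : HasChern hq s c := by
  obtain ⟨κ, _, y, z, hf, hc⟩ := h
  exact ⟨κ, _, _, _, hf.conj h1 h2 hP, by rwa [frameTrace_conj h1]⟩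

theorem HasChern.of_fromBlocks {c : ℂ} (h : HasChern hq (Matrix.fromBlocks t 0 0 s) c) :
    ∃ c₁ c₂, c₁ + c₂ = c ∧ HasChern hq t c₁ ∧ HasChern hq s c₂ := by
  obtain ⟨κ, _, y, z, hf, hc⟩ := h
  obtain ⟨c₁, h1⟩ := (isTraceClass_chernOp (hq := hq) hf.inl.frameTrace_mem).exists_hasTrace
  obtain ⟨c₂, h2⟩ := (isTraceClass_chernOp (hq := hq) hf.inr.frameTrace_mem).exists_hasTrace
  refine ⟨c₁, c₂, ?_, ⟨κ, _, _, _, hf.inl, h1⟩, ⟨κ, _, _, _, hf.inr, h2⟩⟩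
  refine (h1.add h2).unique ?_
  rwa [← map_add, ← frameTrace_sum]

/-- By `frameTrace_tensor` the operator of the product is `∑ π(v) π(z y) π(w)`. Writing `π(z y) = X
+ dim t` with `X` of trace class, the scalar part contributes `dim t` times the operator of `s`, and
the other part has trace `dim s · Tr X` because `w v = 1`. -/
theorem HasChern.tensor {c d : ℂ} (h : HasChern hq t c) (h' : HasChern hq s d) :
    HasChern hq (tensorMat t s) (Fintype.card ι' * c + Fintype.card ι * d) := by
  obtain ⟨κ, _, y, z, hf, hc⟩ := h
  obtain ⟨κ', _, w, v, hf', hd⟩ := h'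
  refine ⟨κ × κ', inferInstance, _, _, hf.tensor hf', ?_⟩
  set X := chernOp hq (frameTrace y z) with hX
  have e1 : rep hq (frameTrace y z) = X + (Fintype.card ι : ℂ) • 1 := by
    rw [hX, chernOp_apply, hf.character_frameTrace]; abel
  have key : chernOp hq (frameTrace (ι := ι × ι') (κ := κ × κ') (fun j a => y j.1 a.1 * w j.2 a.2)
      (fun a i => v a.2 i.2 * z a.1 i.1)) =
      ∑ b, ∑ k, rep hq (v b k) * (X * rep hq (w k b)) +
        (Fintype.card ι : ℂ) • chernOp hq (frameTrace w v) := by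
    have e2 : rep hq (frameTrace w v) = ∑ b, ∑ k, rep hq (v b k) * rep hq (w k b) := by
      simp [frameTrace]
    rw [chernOp_apply, (hf.tensor hf').character_frameTrace, frameTrace_tensor, chernOp_apply hq
      (frameTrace w v), hf'.character_frameTrace, e2]
    simp only [map_sum, map_mul, e1, add_mul, mul_add, smul_mul_assoc, one_mul, mul_smul_comm,
      Finset.sum_add_distrib, ← Finset.smul_sum, Fintype.card_prod, Nat.cast_mul, smul_sub,
      smul_smul]
    abel
  -- The elements `v`, `w` are not coinvariant, but `X` is of trace class, so `π(v)` may be moved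
  -- cyclically; then `∑ w v = dim s`.
  have tr : ∀ b k, ∃ e, HasTrace (X * rep hq (w k b) * rep hq (v b k)) e := fun b k =>
    ((hc.1.mul_right _).mul_right _).exists_hasTrace
  choose e he using tr
  have h1 : HasTrace (∑ b, ∑ k, rep hq (v b k) * (X * rep hq (w k b))) (∑ b, ∑ k, e b k) :=
    .sum _ fun b _ => .sum _ fun k _ => (he b k).comm (hc.1.mul_right _)
  have h2 : HasTrace ((Fintype.card ι' : ℂ) • X) (∑ b, ∑ k, e b k) := by
    have h3 : ∑ k, ∑ b, w k b * v b k = Fintype.card ι' := by simp [hf'.sum_mul]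
    have h4 : (Fintype.card ι' : ℂ) • X = ∑ b, ∑ k, X * rep hq (w k b) * rep hq (v b k) := by
      simp only [mul_assoc, ← map_mul, ← Finset.mul_sum, ← map_sum]
      rw [Finset.sum_comm, h3, map_natCast]
      rw [← nsmul_eq_mul', Nat.cast_smul_eq_nsmul]
    rw [h4]
    exact .sum _ fun b _ => .sum _ fun k _ => he b k
  rw [key, (hc.smul (Fintype.card ι' : ℂ)).unique h2]
  exact h1.add (hd.smul _)

/-- The frame of the defining corepresentation that consists of the rows of the matrix `u` of
generators. -/
theorem isFrame_spinMat_one (h0 : (q : ℂ) ≠ 0) : IsFrame (κ := Fin 4) (spinMat q 1)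
    -- The rows of `u` divided by `q`, `q^3`, `1`, `q`. The columns are exchanged because index `0`
    -- of `spinMat q 1` is the row `(α^*, γ)` of `T`. The powers of `q` in `z` are those for which
    -- `y z = 1` follows from the sphere relations.
    ![![OS7.x q 1, OS7.x' q 0, OS7.x q 3, OS7.x' q 2],
      ![OS7.x q 0, -((q : ℂ)⁻¹ • OS7.x' q 1), -OS7.x q 2, (q : ℂ)⁻¹ • OS7.x' q 3]]
    ![![(q : ℂ) ^ 4 • OS7.x' q 1, (q : ℂ) ^ 6 • OS7.x' q 0],
      ![(q : ℂ) ^ 2 • OS7.x q 0, -((q : ℂ) ^ 3 • OS7.x q 1)],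
      ![OS7.x' q 3, -((q : ℂ) ^ 2 • OS7.x' q 2)],
      ![OS7.x q 2, (q : ℂ) • OS7.x q 3]] where
  coaction_left j a := by
    fin_cases j <;> fin_cases a <;>
      simp [OS7.coaction, Fin.sum_univ_two, spinMat, TensorProduct.tmul_neg, TensorProduct.neg_tmul,
        TensorProduct.tmul_smul, ← TensorProduct.smul_tmul', smul_sub, smul_add, smul_smul, h0,
        -Complex.coe_smul] <;>
      module
  coaction_right a i := by
    obtain ⟨e1, e2, e3, e4, e5, e6, e7⟩ := OSU.mul_rels q
    fin_cases i <;> fin_cases a <;>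
      simp [OS7.coaction, Fin.sum_univ_two, spinMat, TensorProduct.tmul_neg, TensorProduct.neg_tmul,
        TensorProduct.tmul_smul, ← TensorProduct.smul_tmul', smul_sub, smul_add, smul_smul, h0,
        add_mul, sub_mul, e1, e2, e3, e4, e5, e6, e7, TensorProduct.tmul_sub,
        -Complex.coe_smul] <;>
      module
  sum_mul j i := by
    have h := OS7.rels q
    have k1 : (q : ℂ) ^ 2 * ((q : ℂ) - (q : ℂ)⁻¹) = (q : ℂ) ^ 3 - q := by field_simp
    have k2 : (q : ℂ) ^ 4 * ((q : ℂ) - (q : ℂ)⁻¹) = (q : ℂ) ^ 5 - (q : ℂ) ^ 3 := by field_simp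
    simp only [s7Rels, List.forall_mem_cons, List.not_mem_nil, false_imp_iff, implies_true,
      and_true, k1, k2] at h
    obtain ⟨h1, h2, h3, h4, h5, h6, h7, h8, h9, h10, h11, h12, h13, h14, h15, h16, h17, h18, h19,
      h20, h21, h22, h23, h24, h25, h26, h27, h28, h29⟩ := h
    replace h16 := eq_sub_of_add_eq' h16
    replace h17 := eq_sub_of_add_eq' h17
    fin_cases j <;> fin_cases i <;>
      simp [Fin.sum_univ_four, smul_smul, h1, h2, h3, h4, h5, h6, h7, h8, h9, h10, h11, h12, h13,
        h14, h15, h16, h17, h18, h19, h20, h21, h22, h23, h24, h25, h26, h27, h28, h29, smul_sub,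
        smul_add, -Complex.coe_smul] <;>
      match_scalars <;> field_simp <;> ring

theorem hasTrace_chernOp_repX₂ (hq : q ∈ Set.Ioo (0 : ℝ) 1) :
    HasTrace (star (repX₂ hq) * repX₂ hq) ((1 - (q : ℂ) ^ 2)⁻¹ * (1 - (q : ℂ) ^ 4)⁻¹) := by
  have h := hasSum_geometric_prod (pow_mem_Ioo hq two_ne_zero) (pow_mem_Ioo hq four_ne_zero)
  have h' := Complex.hasSum_ofReal.2 h
  have e : (1 - (q : ℂ) ^ 2)⁻¹ * (1 - (q : ℂ) ^ 4)⁻¹ = (((1 - q ^ 2)⁻¹ * (1 - q ^ 4)⁻¹ : ℝ) : ℂ) := by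
    push_cast
    rfl
  rw [e, ← h'.tsum_eq]
  refine HasTrace.of_diagonal ?_ fun f k => ?_
  · exact h'.summable.norm
  · rw [op_mul_apply, star_repX₂_apply, repX₂_apply]
    push_cast
    ring

/-- The sphere relations eliminate `x_3` and `x_4`, and `π(x_1) = 0`. This leaves `-(1 - q^2)(1 -
q^4) π(x_2)^* π(x_2)`, whose prefactor cancels the sum of the geometric series up to sign. -/
theorem hasChern_spinMat_one (hq : q ∈ Set.Ioo (0 : ℝ) 1) : HasChern hq (spinMat q 1) (-1) := by
  have h0 : (q : ℂ) ≠ 0 := Complex.ofReal_ne_zero.2 hq.1.ne'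
  refine ⟨_, _, _, _, isFrame_spinMat_one h0, ?_⟩
  have key : chernOp hq (frameTrace (κ := Fin 4)
    ![![OS7.x q 1, OS7.x' q 0, OS7.x q 3, OS7.x' q 2],
      ![OS7.x q 0, -((q : ℂ)⁻¹ • OS7.x' q 1), -OS7.x q 2, (q : ℂ)⁻¹ • OS7.x' q 3]]
    ![![(q : ℂ) ^ 4 • OS7.x' q 1, (q : ℂ) ^ 6 • OS7.x' q 0],
      ![(q : ℂ) ^ 2 • OS7.x q 0, -((q : ℂ) ^ 3 • OS7.x q 1)],
      ![OS7.x' q 3, -((q : ℂ) ^ 2 • OS7.x' q 2)],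
      ![OS7.x q 2, (q : ℂ) • OS7.x q 3]]) =
      (-((1 - (q : ℂ) ^ 2) * (1 - (q : ℂ) ^ 4))) • (star (repX₂ hq) * repX₂ hq) := by
    have h := OS7.rels q
    simp only [s7Rels, List.forall_mem_cons, List.not_mem_nil, false_imp_iff, implies_true,
      and_true] at h
    obtain ⟨-, -, -, -, -, -, -, -, -, -, -, -, -, h14, -, h16, h17, -⟩ := h
    replace h14 := congrArg (rep hq) h14
    replace h16 := congrArg (rep hq) h16
    replace h17 := congrArg (rep hq) h17
    simp [-Complex.coe_smul] at h14 h16 h17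
    rw [chernOp_apply, (isFrame_spinMat_one h0).character_frameTrace, frameTrace]
    simp [Fin.sum_univ_four, smul_smul, h0, -Complex.coe_smul]
    replace h16 := eq_sub_of_add_eq' h16
    replace h17 := eq_sub_of_add_eq' h17
    simp only [← h14] at h16
    rw [h17, h16, ← h14, show (q : ℂ)⁻¹ * (q : ℂ) ^ 3 = (q : ℂ) ^ 2 by field_simp]
    module
  rw [key]
  convert (hasTrace_chernOp_repX₂ hq).smul _ using 1
  have h2 : (1 - (q : ℂ) ^ 2) ≠ 0 := by
    have := (pow_mem_Ioo hq (n := 2) (by norm_num)).2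
    exact sub_ne_zero.2 (by exact_mod_cast this.ne')
  have h4 : (1 - (q : ℂ) ^ 4) ≠ 0 := by
    have := (pow_mem_Ioo hq (n := 4) (by norm_num)).2
    exact sub_ne_zero.2 (by exact_mod_cast this.ne')
  field_simp

theorem hasChern_spinMat_zero (hq : q ∈ Set.Ioo (0 : ℝ) 1) : HasChern hq (spinMat q 0) 0 := by
  refine ⟨Fin 1, inferInstance, fun _ _ => 1, fun _ _ => 1,
    ⟨fun j a => ?_, fun a i => ?_, fun j i => ?_⟩, ?_⟩
  · obtain rfl := Fin.fin_one_eq_zero j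
    simp [spinMat_zero, Algebra.TensorProduct.one_def]
  · obtain rfl := Fin.fin_one_eq_zero i
    simp [spinMat_zero, Algebra.TensorProduct.one_def]
  · obtain rfl := Fin.fin_one_eq_zero i
    obtain rfl := Fin.fin_one_eq_zero j
    simp
  · simpa [frameTrace, chernOp_apply] using HasTrace.zero

/-- The Chern numbers of the frames of the irreducible corepresentations. -/
theorem hasChern_spinMat (hq : q ∈ Set.Ioo (0 : ℝ) 1) (m : ℕ) :
    HasChern hq (spinMat q m) (-((m : ℂ) * (m + 1) * (m + 2)) / 6) := by
  induction m using Nat.twoStepInduction with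
  | zero => simpa using hasChern_spinMat_zero hq
  | one => convert hasChern_spinMat_one hq using 1; norm_num
  | more m ih0 ih1 =>
    -- The Chern number of `V_1 ⊗ V_(m+1)` is `-(m + 2) + 2 c_(m+1)`, and it is also `c_(m+2) +
    -- c_m`.
    obtain ⟨P, P', h1, h2, hP⟩ := clebschGordan hq m
    obtain ⟨c₁, c₂, hc, hc₁, hc₂⟩ :=
      (((hasChern_spinMat_one hq).tensor ih1).conj h1 h2 hP).of_fromBlocks
    convert hc₁ using 1
    rw [hc₂.unique ih0] at hc
    rw [eq_sub_of_add_eq hc]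
    simp only [Fintype.card_fin]
    push_cast
    ring

end HasChern

/-! ### Coordinates of the cotensor product -/

section Coord

variable {V ι : Type*} [AddCommGroup V] [Module ℂ V] (b : Module.Basis ι ℂ V)

/-- The coefficient of `b i` of an element of `M ⊗ V`. -/
def tensorCoord (M : Type*) [AddCommGroup M] [Module ℂ M] (i : ι) : M ⊗[ℂ] V →ₗ[ℂ] M :=
  (TensorProduct.rid ℂ M).toLinearMap ∘ₗ (b.coord i).lTensor M

variable {M : Type*} [AddCommGroup M] [Module ℂ M]

theorem tensorCoord_tmul (i : ι) (m : M) (v : V) :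
    tensorCoord b M i (m ⊗ₜ v) = b.coord i v • m := by
  simp [tensorCoord]

theorem tensorCoord_mulR {q : ℝ} (i : ι) (a : OS7 q) (x : OS7 q ⊗[ℂ] V) :
    tensorCoord b _ i (mulR V a x) = tensorCoord b _ i x * a := by
  induction x using TensorProduct.induction_on with
  | zero => simp
  | tmul m v => simp [tensorCoord_tmul, mulR]
  | add x y hx hy => simp only [map_add, add_mul, hx, hy]

variable [Fintype ι]

theorem sum_tensorCoord_tmul (x : M ⊗[ℂ] V) : ∑ i, tensorCoord b M i x ⊗ₜ b i = x := by
  induction x using TensorProduct.induction_on with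
  | zero => simp
  | tmul m v =>
    simp only [tensorCoord_tmul, TensorProduct.smul_tmul, ← TensorProduct.tmul_sum]
    simp [b.sum_repr]
  | add x y hx hy =>
    simp only [map_add, TensorProduct.add_tmul, Finset.sum_add_distrib, hx, hy]

theorem tensorCoord_sum_tmul (f : ι → M) (i : ι) :
    tensorCoord b M i (∑ j, f j ⊗ₜ b j) = f i := by
  classical
  simp [tensorCoord_tmul, Finsupp.single_apply]

variable {q : ℝ} {ρ : LeftCoaction (OSU q) V} {t : Matrix ι ι (OSU q)}

theorem sum_tmul_mem_cotensor_iff (hb : ∀ i, ρ.toLin (b i) = ∑ j, t i j ⊗ₜ b j) (f : ι → OS7 q) :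
    ∑ i, f i ⊗ₜ b i ∈ Cotensor ρ ↔ ∀ j, OS7.coaction q (f j) = ∑ i, f i ⊗ₜ t i j := by
  have h1 : coactRight q V (∑ i, f i ⊗ₜ b i) = TensorProduct.assoc ℂ (OS7 q) (OSU q) V
      (∑ j, OS7.coaction q (f j) ⊗ₜ b j) := by
    simp [coactRight]
  have h2 : coactLeft ρ (∑ i, f i ⊗ₜ b i) = TensorProduct.assoc ℂ (OS7 q) (OSU q) V
      (∑ j, (∑ i, f i ⊗ₜ t i j) ⊗ₜ b j) := by
    simp only [coactLeft, map_sum, LinearMap.lTensor_tmul, hb, TensorProduct.tmul_sum,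
      TensorProduct.sum_tmul, TensorProduct.assoc_tmul]
    exact Finset.sum_comm
  rw [Cotensor, LinearMap.mem_eqLocus, h1, h2, EmbeddingLike.apply_eq_iff_eq]
  refine ⟨fun h j => ?_, fun h => by simp only [h]⟩
  simpa only [tensorCoord_sum_tmul] using congrArg (tensorCoord b _ j) h

theorem coaction_tensorCoord (hb : ∀ i, ρ.toLin (b i) = ∑ j, t i j ⊗ₜ b j) (x : Cotensor ρ)
    (j : ι) : OS7.coaction q (tensorCoord b _ j x) = ∑ i, tensorCoord b _ i x.1 ⊗ₜ t i j := by
  refine (sum_tmul_mem_cotensor_iff b hb fun i => tensorCoord b _ i x.1).1 ?_ j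
  rw [sum_tensorCoord_tmul]
  exact x.2

end Coord

/-! ### The cotensor product as a projective module -/

section Projective

variable {V ι : Type*} [AddCommGroup V] [Module ℂ V] [Fintype ι] [DecidableEq ι] {N : ℕ}
  (b : Module.Basis ι ℂ V) {q : ℝ} {ρ : LeftCoaction (OSU q) V} {t : Matrix ι ι (OSU q)}
  {y : ι → Fin N → OS7 q} {z : Fin N → ι → OS7 q}

/-- The idempotent matrix of a frame. -/
def IsFrame.idempotent (h : IsFrame t y z) : Matrix (Fin N) (Fin N) (OS4 q) :=
  .of fun a b => ⟨∑ i, z a i * y i b, h.sum_mul_mem h a b⟩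

theorem IsFrame.coe_idempotent (h : IsFrame t y z) (a c : Fin N) :
    (h.idempotent a c : OS7 q) = ∑ i, z a i * y i c := rfl

/-- The reproducing formula `y (z f) = f`: it makes `z y` idempotent and `f ↦ z f` injective. -/
theorem IsFrame.sum_mul_sum_mul (h : IsFrame t y z) (f : ι → OS7 q) (j : ι) :
    ∑ a, y j a * ∑ i, z a i * f i = f j := by
  simp only [Finset.mul_sum, ← mul_assoc]
  rw [Finset.sum_comm]
  simp [← Finset.sum_mul, h.sum_mul]

theorem IsFrame.coe_idempotent_mulVec (h : IsFrame t y z) (w : Fin N → OS4 q) (a : Fin N) :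
    (h.idempotent.mulVec w a : OS7 q) = ∑ i, z a i * ∑ c, y i c * w c := by
  simp only [Matrix.mulVec, dotProduct, AddSubmonoidClass.coe_finsetSum, MulMemClass.coe_mul,
    h.coe_idempotent, Finset.sum_mul, Finset.mul_sum, mul_assoc]
  exact Finset.sum_comm

theorem IsFrame.isIdempotentElem (h : IsFrame t y z) : IsIdempotentElem h.idempotent := by
  ext a c
  simp only [Matrix.mul_apply, AddSubmonoidClass.coe_finsetSum, MulMemClass.coe_mul,
    h.coe_idempotent, Finset.sum_mul, mul_assoc]
  rw [Finset.sum_comm]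
  simp only [← Finset.mul_sum, h.sum_mul_sum_mul]

theorem IsFrame.coe_trace_idempotent (h : IsFrame t y z) :
    (h.idempotent.trace : OS7 q) = frameTrace y z := by
  simp [Matrix.trace, frameTrace, h.coe_idempotent]

/-- The embedding of the cotensor product into a free module that is given by a frame. -/
def IsFrame.toFree (h : IsFrame t y z) (hb : ∀ i, ρ.toLin (b i) = ∑ j, t i j ⊗ₜ b j) :
    Cotensor ρ →ₗ[(OS4 q)ᵐᵒᵖ] (Fin N → OS4 q) where
  toFun x a := ⟨∑ i, z a i * tensorCoord b _ i x.1,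
    sum_mul_mem_OS4 (coaction_tensorCoord b hb x) (h.coaction_right a)⟩
  map_add' x x' := by
    ext a
    simp [mul_add, Finset.sum_add_distrib]
  map_smul' c x := by
    ext a
    simp [Cotensor.coe_op_smul, tensorCoord_mulR, Finset.sum_mul, mul_assoc]

theorem IsFrame.coe_toFree (h : IsFrame t y z) (hb : ∀ i, ρ.toLin (b i) = ∑ j, t i j ⊗ₜ b j)
    (x : Cotensor ρ) (a : Fin N) :
    (h.toFree b hb x a : OS7 q) = ∑ i, z a i * tensorCoord b _ i x.1 := rfl

theorem IsFrame.toFree_injective (h : IsFrame t y z)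
    (hb : ∀ i, ρ.toLin (b i) = ∑ j, t i j ⊗ₜ b j) : Function.Injective (h.toFree b hb) := by
  intro x x' hx
  have key : ∀ j, tensorCoord b _ j x.1 = tensorCoord b _ j x'.1 := fun j => by
    rw [← h.sum_mul_sum_mul (fun i => tensorCoord b _ i x.1),
      ← h.sum_mul_sum_mul (fun i => tensorCoord b _ i x'.1)]
    simp only [← h.coe_toFree b hb, hx]
  ext
  rw [← sum_tensorCoord_tmul b x.1, ← sum_tensorCoord_tmul b x'.1]
  simp only [key]

/-- The idempotent `z y` fixes every `z f`; conversely `z (y w)` comes from `∑ (y w)_i ⊗ b i`, which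
lies in the cotensor product because the entries of `w` are coinvariant. -/
theorem IsFrame.range_toFree (h : IsFrame t y z)
    (hb : ∀ i, ρ.toLin (b i) = ∑ j, t i j ⊗ₜ b j) :
    LinearMap.range (h.toFree b hb) = imageModule h.idempotent := by
  ext v
  constructor
  · rintro ⟨x, rfl⟩
    refine ⟨h.toFree b hb x, ?_⟩
    ext a
    rw [h.coe_idempotent_mulVec]
    simp only [h.coe_toFree b hb, h.sum_mul_sum_mul]
  · rintro ⟨w, rfl⟩
    have hw : ∀ c, OS7.coaction q (w c) = (w c : OS7 q) ⊗ₜ 1 := fun c => (w c).2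
    refine ⟨⟨∑ i, (∑ c, y i c * w c) ⊗ₜ b i, (sum_tmul_mem_cotensor_iff b hb _).2 fun j => ?_⟩, ?_⟩
    · simp only [map_sum, map_mul, h.coaction_left, hw, Finset.sum_mul, TensorProduct.sum_tmul,
        Algebra.TensorProduct.tmul_mul_tmul, mul_one]
      exact Finset.sum_comm
    · ext a
      rw [h.coe_idempotent_mulVec, h.coe_toFree]
      simp only [tensorCoord_sum_tmul]

theorem IsFrame.isPresentedBy (h : IsFrame t y z)
    (hb : ∀ i, ρ.toLin (b i) = ∑ j, t i j ⊗ₜ b j) : IsPresentedBy (Cotensor ρ) h.idempotent :=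
  ⟨h.isIdempotentElem, ⟨(LinearEquiv.ofInjective _ (h.toFree_injective b hb)).trans
    (LinearEquiv.ofEq _ _ (h.range_toFree b hb))⟩⟩

variable {κ : Type*} [Fintype κ]

theorem IsFrame.reindex {y : ι → κ → OS7 q} {z : κ → ι → OS7 q} (h : IsFrame t y z)
    (e : Fin N ≃ κ) : IsFrame t (fun i a => y i (e a)) fun a i => z (e a) i where
  coaction_left j a := h.coaction_left j (e a)
  coaction_right a i := h.coaction_right (e a) i
  sum_mul j i := by rw [← h.sum_mul, ← e.sum_comp]

end Projective

/-! ### Independence of the idempotent -/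

section HattoriStallings

variable {q : ℝ} {M N : ℕ} {p : Matrix (Fin M) (Fin M) (OS4 q)} {p' : Matrix (Fin N) (Fin N) (OS4 q)}

theorem mulVec_of_mem_imageModule (hp : IsIdempotentElem p) {v : Fin M → OS4 q}
    (hv : v ∈ imageModule p) : p.mulVec v = v := by
  obtain ⟨w, rfl⟩ := hv
  rw [Matrix.mulVec_mulVec, hp.eq]

theorem col_mem_imageModule (a : Fin M) : p.col a ∈ imageModule p :=
  ⟨Pi.single a 1, by simp⟩

/-- The matrix of a linear map between the modules of two idempotents. -/
def imageMatrix (f : imageModule p →ₗ[(OS4 q)ᵐᵒᵖ] imageModule p') :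
    Matrix (Fin N) (Fin M) (OS4 q) :=
  .of fun i a => (f ⟨p.col a, col_mem_imageModule a⟩ : Fin N → OS4 q) i

/-- An element of `p B^N` equals `p v`, hence is the combination of the columns of `p` with
coefficients `v` on the right, and a right linear map respects this. -/
theorem imageMatrix_mulVec (hp : IsIdempotentElem p)
    (f : imageModule p →ₗ[(OS4 q)ᵐᵒᵖ] imageModule p') (v : imageModule p) :
    (imageMatrix f).mulVec v = f v := by
  have h : v = ∑ a, MulOpposite.op ((v : Fin M → OS4 q) a) •
      (⟨p.col a, col_mem_imageModule a⟩ : imageModule p) := by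
    refine Subtype.ext ((mulVec_of_mem_imageModule hp v.2).symm.trans ?_)
    ext i
    simp [Matrix.mulVec, dotProduct]
  conv_rhs => rw [h, map_sum]
  simp only [LinearMap.map_smul]
  ext i
  simp only [Matrix.mulVec, dotProduct, imageMatrix, Matrix.of_apply, Submodule.coe_sum,
    Finset.sum_apply, Submodule.coe_smul, Pi.smul_apply, MulOpposite.smul_eq_mul_unop,
    MulOpposite.unop_op]

theorem imageMatrix_mul_imageMatrix (hp' : IsIdempotentElem p')
    (f : imageModule p →ₗ[(OS4 q)ᵐᵒᵖ] imageModule p')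
    (g : imageModule p' →ₗ[(OS4 q)ᵐᵒᵖ] imageModule p) (h : ∀ v, g (f v) = v) :
    imageMatrix g * imageMatrix f = p := by
  refine Matrix.ext fun i a => ?_
  have h1 := imageMatrix_mulVec hp' g (f ⟨p.col a, col_mem_imageModule a⟩)
  rw [h] at h1
  exact congrFun h1 i

/-- The matrices `r`, `s` of an isomorphism and its inverse satisfy `s r = p` and `r s = p'`, and
the trace of `π - ε` does not see the order of the factors. -/
theorem hasTrace_chernOp_trace_of_equiv {hq : q ∈ Set.Ioo (0 : ℝ) 1} (hp : IsIdempotentElem p)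
    (hp' : IsIdempotentElem p') (e : imageModule p ≃ₗ[(OS4 q)ᵐᵒᵖ] imageModule p') {c : ℂ}
    (h : HasTrace (chernOp hq (p.trace : OS4 q)) c) :
    HasTrace (chernOp hq (p'.trace : OS4 q)) c := by
  have h1 := imageMatrix_mul_imageMatrix hp' e.toLinearMap e.symm.toLinearMap (by simp)
  have h2 := imageMatrix_mul_imageMatrix hp e.symm.toLinearMap e.toLinearMap (by simp)
  have coe_trace : ∀ {m n : ℕ} (r : Matrix (Fin m) (Fin n) (OS4 q)) (s : Matrix (Fin n) (Fin m) _),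
      (((r * s).trace : OS4 q) : OS7 q) =
        (r.map ((↑) : OS4 q → OS7 q) * s.map ((↑) : OS4 q → OS7 q)).trace := by
    intro m n r s
    simp [Matrix.trace, Matrix.mul_apply]
  rw [← h1, coe_trace] at h
  rw [← h2, coe_trace]
  exact hasTrace_chernOp_trace_mul_comm (fun a b => (imageMatrix _ a b).2) h

end HattoriStallings

end QuantumSphere

end

/-- For `0 < q < 1` and `n ≥ 1`, the bimodule `O(S^7_q) □ V` associated with an irreducible left
corepresentation `V` of `O(SU_q(2))` of dimension `n + 1` has
`ch₁ = - n (n + 1) (n + 2) / 6`. -/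
theorem proposition5p4 (q : ℝ) (hq : q ∈ Set.Ioo (0 : ℝ) 1) (n : ℕ) (hn : 1 ≤ n)
    (V : Type*) [AddCommGroup V] [Module ℂ V]
    (ρ : QuantumSphere.LeftCoaction (QuantumSphere.OSU q) V)
    (hρ : ρ.IsIrreducible) (hV : Module.finrank ℂ V = n + 1) :
    QuantumSphere.HasCh₁ hq (QuantumSphere.Cotensor ρ)
      (-((n : ℂ) * (n + 1) * (n + 2)) / 6) := by
  obtain ⟨b, hb⟩ := QuantumSphere.OSU.exists_basis_of_isIrreducible ρ hq hρ hV
  obtain ⟨κ, _, y, z, hf, hc⟩ := QuantumSphere.hasChern_spinMat hq n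
  have hf' := hf.reindex (Fintype.equivFin κ).symm
  have hp := hf'.isPresentedBy b hb
  refine ⟨⟨_, _, hp⟩, fun N p h => ?_⟩
  -- An arbitrary presentation is compared with that of the frame through the module they both
  -- present.
  obtain ⟨e⟩ := hp.2
  obtain ⟨e'⟩ := h.2
  rw [← QuantumSphere.chernOp_apply]
  refine QuantumSphere.hasTrace_chernOp_trace_of_equiv hp.1 h.1 (e.symm.trans e') ?_
  rw [hf'.coe_trace_idempotent]
  convert hc using 2
  exact (Fintype.equivFin κ).symm.sum_comp fun a => ∑ i, z a i * y i a
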